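/- **Setting.** For $0\le\theta<\pi$ let $\Sigma_\theta=\{z\in\mathbb C:|\arg z|\le\theta\}\cup\{0\}$. Let $\Omega\subseteq\mathbb R^d$ be open and let $\mu\colon\Omega\to\mathcal L(\mathbb C^d)$ be bounded and Lebesgue measurable, with a constant $m_\bullet>0$ such that $\operatorname{Re}(\mu(x)\xi,\xi)\ge m_\bullet|\xi|^2$ for almost every $x\in\Omega$ and all $\xi\in\mathbb C^d$. Let $V$ be a closed subspace of the (complex) Sobolev space $W^{1,2}(\Omega)$ that is dense in $L^2(\Omega)$, and put $$\mathfrak t_V(u,v)=\int_\Omega(\mu\nabla u,\nabla v)\,dx\qquad(u,v\in V).$$ Let $A$ be the operator on $L^2(\Omega)$ induced by $\mathfrak t_V$: $\operatorname{dom}(A)$ is the set of all $u\in V$ for which there is $f\in L^2(\Omega)$ with $\mathfrak t_V(u,v)=(f,v)_{L^2(\Omega)}$ for all $v\in V$, and $Au=f$. Let $N(A)=\{(Au,u):u\in\operatorname{dom}(A),\ \|u\|_{L^2}=1\}$ and $N(\mathfrak t_V)=\{\mathfrak t_V(u,u):u\in V,\ \|u\|_{L^2}=1\}$ be the numerical ranges,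 and let $\omega(A)$, $\omega(\mathfrak t_V)$ be the infimum of all $\theta\in[0,\pi)$ such that $N(A)\subseteq\Sigma_\theta$, respectively $N(\mathfrak t_V)\subseteq\Sigma_\theta$. **Theorem 3.15.** One has $\omega(A)=\omega(\mathfrak t_V)=:\omega$, and the following hold. 1. $A$ is $m$-$\omega$-accretive: $0\le\omega\le\frac\pi2$, $A$ is closed, $N(A)\subseteq\Sigma_\omega\subseteq\Sigma_{\pi/2}$, and $-1\in\rho(A)$. 2. $A$ is sectorial of angle $\omega$: $\sigma(A)\subseteq\Sigma_\omega$ and $\sup_{\lambda\in\mathbb C\setminus\Sigma_\theta}\|\lambda(A-\lambda)^{-1}\|<\infty$ for every $\theta\in(\omega,\pi)$. In particular, the spectral angle of $A$ (the infimum of all $\phi\in[0,\pi)$ such that $A$ is sectorial of angle $\phi$) is at most $\omega$. 3. For every $\theta\in(\omega,\frac\pi2]$ and every $\lambda\in\mathbb C\setminus\Sigma_\theta$ one has $\lambda\in\rho(A)$ and $$\|\lambda(A-\lambda)^{-1}\|_{L^2(\Omega)\to L^2(\Omega)}\le\frac1{\sin(\theta-\omega)}.$$ 4. $-A$ generates a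 holomorphic semigroup of contractions of angle $\frac\pi2-\omega>0$: it generates a strongly continuous semigroup on $L^2(\Omega)$ which extends to $\Sigma_{\pi/2-\omega}$ as a strongly continuous family of contractions that satisfies the semigroup law there and is holomorphic in the interior of $\Sigma_{\pi/2-\omega}$. 5. $A$ has maximal parabolic regularity: for all $T\in(0,\infty]$, $q\in(1,\infty)$ and $f\in L^q(0,T;L^2(\Omega))$, the mild solution $u(t)=\int_0^tS(t-s)f(s)\,ds$, where $S$ is the semigroup generated by $-A$, satisfies $u(t)\in\operatorname{dom}(A)$ for almost every $t\in(0,T)$, $u',Au\in L^q(0,T;L^2(\Omega))$, and $u'+Au=f$ almost everywhere on $(0,T)$. -/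

import Mathlib

open MeasureTheory Set Filter Topology TopologicalSpace
open scoped ENNReal Distributions

noncomputable section

/-! ### Sectors, numerical ranges, resolvents -/

/-- The closed sector `Σ_θ = {z : |arg z| ≤ θ} ∪ {0}` of opening angle `2θ`. -/
def sector (θ : ℝ) : Set ℂ := {z | |z.arg| ≤ θ} ∪ {0}

/-- The optimal angle `inf {θ ∈ [0, π) : N ⊆ Σ_θ}` of a sector containing a set `N`
(a numerical range). -/
def optimalAngle (N : Set ℂ) : ℝ :=
  sInf {θ : ℝ | 0 ≤ θ ∧ θ < Real.pi ∧ N ⊆ sector θ}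

section Operators

variable {H : Type*} [NormedAddCommGroup H] [InnerProductSpace ℂ H]

/-- The numerical range `{(Bx, x) : x ∈ dom B, ‖x‖ = 1}`. Mathlib's inner product is
conjugate-linear in its first argument, so `(Bx, x)` is `inner ℂ x (B x)`. -/
def numericalRange (B : H →ₗ.[ℂ] H) : Set ℂ :=
  {z | ∃ x : B.domain, ‖(x : H)‖ = 1 ∧ z = inner ℂ (x : H) (B x)}

/-- `R` is the bounded two-sided inverse `(B - z)⁻¹` of `B - z : dom B → H`. -/
structure IsResolventAt (B : H →ₗ.[ℂ] H) (z : ℂ) (R : H →L[ℂ] H) : Prop where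
  right_inv : ∀ f : H, ∃ h : R f ∈ B.domain, B ⟨R f, h⟩ - z • R f = f
  left_inv : ∀ x : B.domain, R (B x - z • (x : H)) = x

/-- The resolvent set `ρ(B)`. -/
def operatorResolventSet (B : H →ₗ.[ℂ] H) : Set ℂ := {z | ∃ R, IsResolventAt B z R}

/-- The spectrum `σ(B) = ℂ \ ρ(B)`. -/
def operatorSpectrum (B : H →ₗ.[ℂ] H) : Set ℂ := (operatorResolventSet B)ᶜ

/-- `m`-`θ`-accretive operators, `θ ∈ [0, π/2]`: closed, accretive (numerical range in the closed
right half plane `Σ_{π/2}`), with `-1` in the resolvent set, and with numerical range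
in `Σ_θ`. -/
structure IsMAccretiveOfAngle (B : H →ₗ.[ℂ] H) (θ : ℝ) : Prop where
  angle_nonneg : 0 ≤ θ
  angle_le : θ ≤ Real.pi / 2
  isClosed : B.IsClosed
  accretive : numericalRange B ⊆ sector (Real.pi / 2)
  neg_one_mem : (-1 : ℂ) ∈ operatorResolventSet B
  numericalRange_subset : numericalRange B ⊆ sector θ

/-- `B` is sectorial of angle `φ ∈ [0, π)`: the spectrum lies in `Σ_φ`, and `z (B - z)⁻¹` is
uniformly bounded outside every larger sector `Σ_θ`, `θ ∈ (φ, π)`. -/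
structure IsSectorialOfAngle (B : H →ₗ.[ℂ] H) (φ : ℝ) : Prop where
  angle_nonneg : 0 ≤ φ
  angle_lt : φ < Real.pi
  spectrum_subset : operatorSpectrum B ⊆ sector φ
  bounded : ∀ θ : ℝ, φ < θ → θ < Real.pi →
    ∃ C : ℝ, ∀ z ∉ sector θ, ∀ R, IsResolventAt B z R → ‖z • R‖ ≤ C

/-- The spectral angle `φ(B)`, the infimum of the angles of which `B` is sectorial. -/
def spectralAngle (B : H →ₗ.[ℂ] H) : ℝ := sInf {φ : ℝ | IsSectorialOfAngle B φ}

/-! ### Semigroups -/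

/-- Strongly continuous semigroups; only the values of `T` on `[0, ∞)` matter. -/
structure IsStronglyContinuousSemigroup (T : ℝ → H →L[ℂ] H) : Prop where
  zero : T 0 = 1
  add : ∀ s t : ℝ, 0 ≤ s → 0 ≤ t → T (s + t) = T s * T t
  continuous : ∀ x : H, ContinuousOn (fun t => T t x) (Ici 0)

/-- `G` is the generator of `T`: `x ∈ dom G` with `G x = y` if and only if
`(T(t) x - x) / t → y` as `t ↓ 0`. -/
def IsGeneratorOf (G : H →ₗ.[ℂ] H) (T : ℝ → H →L[ℂ] H) : Prop :=
  ∀ x y : H, (x, y) ∈ G.graph ↔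
    Tendsto (fun t : ℝ => ((t : ℂ)⁻¹) • (T t x - x)) (𝓝[>] 0) (𝓝 y)

/-- `T` is a holomorphic semigroup of angle `ϑ > 0`, with holomorphic extension `S`. -/
structure IsHolomorphicSemigroup (T : ℝ → H →L[ℂ] H) (S : ℂ → H →L[ℂ] H) (ϑ : ℝ) : Prop where
  isSemigroup : IsStronglyContinuousSemigroup T
  angle_pos : 0 < ϑ
  extends_real : ∀ t : ℝ, 0 ≤ t → S t = T t
  holomorphic : DifferentiableOn ℂ S (interior (sector ϑ))
  locally_bounded : ∀ θ : ℝ, 0 < θ → θ < ϑ →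
    ∃ C : ℝ, ∀ z ∈ sector θ, ‖z‖ ≤ 1 → ‖S z‖ ≤ C

/-- `T` is a holomorphic semigroup of contractions of angle `ϑ`: its extension `S` consists of
contractions on the whole closed sector `Σ_ϑ`, on which it is strongly continuous and satisfies
the semigroup law. -/
structure IsHolomorphicContractionSemigroup (T : ℝ → H →L[ℂ] H) (S : ℂ → H →L[ℂ] H) (ϑ : ℝ) :
    Prop extends IsHolomorphicSemigroup T S ϑ where
  contraction : ∀ z ∈ sector ϑ, ‖S z‖ ≤ 1
  add_sector : ∀ z ∈ sector ϑ, ∀ w ∈ sector ϑ, S (z + w) = S z * S w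
  continuous_sector : ∀ x : H, ContinuousOn (fun z => S z x) (sector ϑ)

/-! ### Maximal parabolic regularity -/

/-- The interval `(0, τ)` for `τ ∈ (0, ∞]`. -/
def timeInterval (τ : ℝ≥0∞) : Set ℝ := {t | 0 < t ∧ ENNReal.ofReal t < τ}

/-- The mild solution `u(t) = ∫₀ᵗ T(t - s) f(s) ds` of `u' + Bu = f`, `u(0) = 0`. -/
def mildSolution (T : ℝ → H →L[ℂ] H) (f : ℝ → H) (t : ℝ) : H :=
  ∫ s in (0 : ℝ)..t, T (t - s) (f s)

/-- Maximal parabolic regularity on `(0, τ)` with exponent `q`, for the negative generator `B` of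
a holomorphic semigroup `T`: for every `f ∈ L^q(0, τ; H)` the mild solution `u` lies in `dom B`
almost everywhere, it is absolutely continuous, and both `u'` (here `du`) and `Bu` (here `g`)
belong to `L^q(0, τ; H)`; moreover `u' + Bu = f` almost everywhere. -/
def HasMaximalParabolicRegularity (B : H →ₗ.[ℂ] H) (τ q : ℝ≥0∞) : Prop :=
  ∃ T : ℝ → H →L[ℂ] H, IsStronglyContinuousSemigroup T ∧ IsGeneratorOf (-B) T ∧
    (∃ S ϑ, IsHolomorphicSemigroup T S ϑ) ∧
    ∀ f : ℝ → H, MemLp f q (volume.restrict (timeInterval τ)) →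
      ∃ du g : ℝ → H,
        MemLp du q (volume.restrict (timeInterval τ)) ∧
        MemLp g q (volume.restrict (timeInterval τ)) ∧
        (∀ t ∈ timeInterval τ, mildSolution T f t = ∫ s in (0 : ℝ)..t, du s) ∧
        ∀ᵐ t ∂(volume.restrict (timeInterval τ)),
          (mildSolution T f t, g t) ∈ B.graph ∧ du t + g t = f t

end Operators

/-! ### The Sobolev space, the Dirichlet form, and the induced operator -/

section Form

variable {d : ℕ}

/-- `L²(Ω; ℂ)`. -/
abbrev L2Space (Ω : Opens (EuclideanSpace ℝ (Fin d))) : Type :=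
  Lp ℂ 2 (volume.restrict (Ω : Set (EuclideanSpace ℝ (Fin d))))

/-- `L²(Ω; ℂᵈ)`. -/
abbrev L2VectorSpace (Ω : Opens (EuclideanSpace ℝ (Fin d))) : Type :=
  Lp (EuclideanSpace ℂ (Fin d)) 2 (volume.restrict (Ω : Set (EuclideanSpace ℝ (Fin d))))

/-- `g` is the weak gradient of `u` on `Ω`: `∫ (∂ᵢφ) u = - ∫ φ gᵢ` for all test functions `φ`. -/
def IsWeakGradient (Ω : Opens (EuclideanSpace ℝ (Fin d)))
    (u : EuclideanSpace ℝ (Fin d) → ℂ)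
    (g : EuclideanSpace ℝ (Fin d) → EuclideanSpace ℂ (Fin d)) : Prop :=
  ∀ (φ : 𝓓(Ω, ℝ)) (i : Fin d),
    ∫ x in (Ω : Set (EuclideanSpace ℝ (Fin d))),
        (fderiv ℝ φ x (EuclideanSpace.single i 1)) • u x =
      - ∫ x in (Ω : Set (EuclideanSpace ℝ (Fin d))), φ x • g x i

theorem TestFunction.memLp_two {Ω : Opens (EuclideanSpace ℝ (Fin d))} (φ : 𝓓(Ω, ℝ)) :
    MemLp φ 2 (volume.restrict (Ω : Set (EuclideanSpace ℝ (Fin d)))) :=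
  (φ.contDiff.continuous.memLp_of_hasCompactSupport φ.hasCompactSupport).restrict _

theorem TestFunction.memLp_two_fderiv {Ω : Opens (EuclideanSpace ℝ (Fin d))} (φ : 𝓓(Ω, ℝ))
    (v : EuclideanSpace ℝ (Fin d)) :
    MemLp (fun x => fderiv ℝ φ x v) 2
      (volume.restrict (Ω : Set (EuclideanSpace ℝ (Fin d)))) := by
  have h : Continuous (fun x => fderiv ℝ φ x v) :=
    (φ.contDiff.continuous_fderiv (by simp)).clm_apply continuous_const
  exact (h.memLp_of_hasCompactSupport (φ.hasCompactSupport.fderiv_apply ℝ v)).restrict _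

theorem memLp_two_coord {Ω : Opens (EuclideanSpace ℝ (Fin d))} (g : L2VectorSpace Ω)
    (i : Fin d) :
    MemLp (fun x => g x i) 2 (volume.restrict (Ω : Set (EuclideanSpace ℝ (Fin d)))) :=
  (EuclideanSpace.proj (𝕜 := ℂ) i : EuclideanSpace ℂ (Fin d) →L[ℂ] ℂ).comp_memLp' (Lp.memLp g)

/-- The Sobolev space `W^{1,2}(Ω)`, realized as the space of pairs `(u, ∇u)` in
`L²(Ω) × L²(Ω; ℂᵈ)`, with the Hilbert norm `(‖u‖² + ‖∇u‖²)^{1/2}`. The weak gradient is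
determined by the function, so a pair is the same as its first component. -/
def sobolevW12 (Ω : Opens (EuclideanSpace ℝ (Fin d))) :
    Submodule ℂ (WithLp 2 (L2Space Ω × L2VectorSpace Ω)) where
  carrier := {p | IsWeakGradient Ω p.fst p.snd}
  zero_mem' := by
    intro φ i
    have h1 := Lp.coeFn_zero ℂ 2 (volume.restrict (Ω : Set (EuclideanSpace ℝ (Fin d))))
    have h2 := Lp.coeFn_zero (EuclideanSpace ℂ (Fin d)) 2
      (volume.restrict (Ω : Set (EuclideanSpace ℝ (Fin d))))
    rw [integral_eq_zero_of_ae, integral_eq_zero_of_ae, neg_zero]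
    · filter_upwards [h2] with x hx
      rw [WithLp.zero_snd, hx]
      simp
    · filter_upwards [h1] with x hx
      rw [WithLp.zero_fst, hx]
      simp
  add_mem' := by
    intro p q hp hq φ i
    have h1 := Lp.coeFn_add p.fst q.fst
    have h2 := Lp.coeFn_add p.snd q.snd
    have e1 : ∀ u : L2Space Ω, Integrable
        (fun x => (fderiv ℝ φ x (EuclideanSpace.single i 1)) • u x)
        (volume.restrict (Ω : Set (EuclideanSpace ℝ (Fin d)))) := fun u =>
      memLp_one_iff_integrable.1 ((Lp.memLp u).smul (φ.memLp_two_fderiv _))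
    have e2 : ∀ g : L2VectorSpace Ω, Integrable (fun x => φ x • g x i)
        (volume.restrict (Ω : Set (EuclideanSpace ℝ (Fin d)))) := fun g =>
      memLp_one_iff_integrable.1 ((memLp_two_coord g i).smul φ.memLp_two)
    have k1 := integral_add (e1 p.fst) (e1 q.fst)
    have k2 := integral_add (e2 p.snd) (e2 q.snd)
    rw [hp φ i, hq φ i, ← neg_add, ← k2] at k1
    refine Eq.trans (integral_congr_ae ?_) (k1.trans (congrArg Neg.neg (integral_congr_ae ?_)))
    · filter_upwards [h1] with x hx
      rw [WithLp.add_fst, hx, Pi.add_apply, smul_add]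
    · filter_upwards [h2] with x hx
      rw [WithLp.add_snd, hx, Pi.add_apply, PiLp.add_apply, smul_add]
  smul_mem' := by
    intro c p hp φ i
    have h1 := Lp.coeFn_smul c p.fst
    have h2 := Lp.coeFn_smul c p.snd
    have k := congrArg (fun z => c • z) (hp φ i)
    simp only [smul_neg, ← integral_smul] at k
    refine Eq.trans (integral_congr_ae ?_) (k.trans (congrArg Neg.neg (integral_congr_ae ?_)))
    · filter_upwards [h1] with x hx
      rw [WithLp.smul_fst, hx, Pi.smul_apply, smul_comm]
    · filter_upwards [h2] with x hx
      rw [WithLp.smul_snd, hx, Pi.smul_apply, PiLp.smul_apply, smul_comm]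

variable {Ω : Opens (EuclideanSpace ℝ (Fin d))}

/-- The element of `L²(Ω)` underlying an element of `W^{1,2}(Ω)`. -/
def sobolevToL2 : sobolevW12 Ω →L[ℂ] L2Space Ω :=
  (WithLp.fstL 2 ℂ (L2Space Ω) (L2VectorSpace Ω)).comp (sobolevW12 Ω).subtypeL

/-- The weak gradient of an element of `W^{1,2}(Ω)`. -/
def sobolevGrad : sobolevW12 Ω →L[ℂ] L2VectorSpace Ω :=
  (WithLp.sndL 2 ℂ (L2Space Ω) (L2VectorSpace Ω)).comp (sobolevW12 Ω).subtypeL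

/-- An element of `W^{1,2}(Ω)` is determined by its underlying function. -/
theorem sobolevGrad_eq_zero {u : sobolevW12 Ω} (hu : sobolevToL2 u = 0) : sobolevGrad u = 0 := by
  have hw : IsWeakGradient Ω (sobolevToL2 u) (sobolevGrad u) := u.2
  rw [hu] at hw
  have h0 := Lp.coeFn_zero ℂ 2 (volume.restrict (Ω : Set (EuclideanSpace ℝ (Fin d))))
  have key : ∀ i : Fin d, ∀ᵐ x ∂(volume.restrict (Ω : Set (EuclideanSpace ℝ (Fin d)))),
      (sobolevGrad u) x i = 0 := by
    intro i
    have h := Ω.isOpen.ae_eq_zero_of_integral_contDiff_smul_eq_zero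
      (μ := volume.restrict (Ω : Set (EuclideanSpace ℝ (Fin d))))
      (f := fun x => (sobolevGrad u) x i)
      (((memLp_two_coord (sobolevGrad u) i).locallyIntegrable (by norm_num)).locallyIntegrableOn _)
      (by
        intro φ h1 h2 h3
        have h4 := hw ⟨φ, h1, h2, h3⟩ i
        rw [integral_eq_zero_of_ae] at h4
        · exact neg_eq_zero.1 h4.symm
        · filter_upwards [h0] with x hx
          rw [hx]
          simp)
    filter_upwards [h, ae_restrict_mem Ω.isOpen.measurableSet] with x h1 h2
    exact h1 h2
  refine Lp.ext ?_
  filter_upwards [ae_all_iff.2 key,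
    Lp.coeFn_zero (EuclideanSpace ℂ (Fin d)) 2
      (volume.restrict (Ω : Set (EuclideanSpace ℝ (Fin d))))] with x h1 h2
  rw [h2]
  ext i
  simpa using h1 i

/-- Bounded, Lebesgue measurable coefficient functions `μ : Ω → 𝓛(ℂᵈ)`. -/
structure IsBoundedCoefficient (Ω : Opens (EuclideanSpace ℝ (Fin d)))
    (μ : EuclideanSpace ℝ (Fin d) →
      EuclideanSpace ℂ (Fin d) →L[ℂ] EuclideanSpace ℂ (Fin d)) : Prop where
  measurable : AEStronglyMeasurable μ (volume.restrict (Ω : Set (EuclideanSpace ℝ (Fin d))))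
  bounded : ∃ M : ℝ, ∀ᵐ x ∂(volume.restrict (Ω : Set (EuclideanSpace ℝ (Fin d)))), ‖μ x‖ ≤ M

variable {μ : EuclideanSpace ℝ (Fin d) →
  EuclideanSpace ℂ (Fin d) →L[ℂ] EuclideanSpace ℂ (Fin d)}

theorem IsBoundedCoefficient.integrable (hμ : IsBoundedCoefficient Ω μ) (u v : sobolevW12 Ω) :
    Integrable (fun x => (inner ℂ (sobolevGrad v x) (μ x (sobolevGrad u x)) : ℂ))
      (volume.restrict (Ω : Set (EuclideanSpace ℝ (Fin d)))) := by
  obtain ⟨M, hM⟩ := hμ.bounded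
  have hm : MemLp (fun x => μ x (sobolevGrad u x)) 2
      (volume.restrict (Ω : Set (EuclideanSpace ℝ (Fin d)))) := by
    refine MemLp.of_le_mul (c := M) (Lp.memLp (sobolevGrad u)) ?_ ?_
    · exact (ContinuousLinearMap.apply ℂ (EuclideanSpace ℂ (Fin d))).aestronglyMeasurable_comp₂
        (Lp.aestronglyMeasurable _) hμ.measurable
    · filter_upwards [hM] with x hx
      exact (μ x).le_of_opNorm_le hx _
  refine (L2.integrable_inner (𝕜 := ℂ) (sobolevGrad v) (hm.toLp _)).congr ?_
  filter_upwards [hm.coeFn_toLp] with x hx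
  rw [hx]

/-- The Dirichlet form `𝔱(u, v) = ∫_Ω (μ ∇u, ∇v) dx`, linear in `u` and antilinear in `v`. -/
def dirichletForm (μ : EuclideanSpace ℝ (Fin d) →
      EuclideanSpace ℂ (Fin d) →L[ℂ] EuclideanSpace ℂ (Fin d))
    (u v : sobolevW12 Ω) : ℂ :=
  ∫ x in (Ω : Set (EuclideanSpace ℝ (Fin d))),
    inner ℂ (sobolevGrad v x) (μ x (sobolevGrad u x))

theorem dirichletForm_add (hμ : IsBoundedCoefficient Ω μ) (u w v : sobolevW12 Ω) :
    dirichletForm μ (u + w) v = dirichletForm μ u v + dirichletForm μ w v := by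
  unfold dirichletForm
  rw [← integral_add (hμ.integrable u v) (hμ.integrable w v)]
  refine integral_congr_ae ?_
  rw [map_add]
  filter_upwards [Lp.coeFn_add (sobolevGrad u) (sobolevGrad w)] with x hx
  rw [hx, Pi.add_apply, map_add, inner_add_right]

theorem dirichletForm_smul (c : ℂ) (u v : sobolevW12 Ω) :
    dirichletForm μ (c • u) v = c * dirichletForm μ u v := by
  unfold dirichletForm
  rw [← integral_const_mul]
  refine integral_congr_ae ?_
  rw [map_smul]
  filter_upwards [Lp.coeFn_smul c (sobolevGrad u)] with x hx
  rw [hx, Pi.smul_apply, map_smul, inner_smul_right]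

/-- The numerical range of the restriction `𝔱_V` of the form to `V`, with the normalization
in `L²(Ω)`. -/
def formNumericalRange (μ : EuclideanSpace ℝ (Fin d) →
      EuclideanSpace ℂ (Fin d) →L[ℂ] EuclideanSpace ℂ (Fin d))
    (V : Submodule ℂ (sobolevW12 Ω)) : Set ℂ :=
  {z | ∃ u ∈ V, ‖sobolevToL2 u‖ = 1 ∧ z = dirichletForm μ u u}

/-- The graph of the operator induced by `𝔱_V`: all pairs `(u, f)` with `u ∈ V`, `f ∈ L²(Ω)` and
`𝔱(u, v) = (f, v)` for all `v ∈ V`. -/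
def formOperatorGraph (hμ : IsBoundedCoefficient Ω μ) (V : Submodule ℂ (sobolevW12 Ω)) :
    Submodule ℂ (L2Space Ω × L2Space Ω) where
  carrier := {p | ∃ u ∈ V, sobolevToL2 u = p.1 ∧
    ∀ v ∈ V, dirichletForm μ u v = inner ℂ (sobolevToL2 v) p.2}
  zero_mem' := ⟨0, V.zero_mem, map_zero _, fun v _ => by
    simpa using dirichletForm_smul (μ := μ) 0 (0 : sobolevW12 Ω) v⟩
  add_mem' := by
    rintro p q ⟨u, hu, hup, h⟩ ⟨w, hw, hwq, k⟩
    refine ⟨u + w, V.add_mem hu hw, by rw [map_add, hup, hwq, Prod.fst_add], fun v hv => ?_⟩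
    rw [dirichletForm_add hμ, h v hv, k v hv, Prod.snd_add, inner_add_right]
  smul_mem' := by
    rintro c p ⟨u, hu, hup, h⟩
    refine ⟨c • u, V.smul_mem c hu, by rw [map_smul, hup, Prod.smul_fst], fun v hv => ?_⟩
    rw [dirichletForm_smul, h v hv, Prod.smul_snd, inner_smul_right]

/-- The operator `A` on `L²(Ω)` induced by `𝔱_V`: `dom A` consists of the `u ∈ V` for which there is
`f ∈ L²(Ω)` with `𝔱(u, v) = (f, v)` for all `v ∈ V`, and `A u = f`. The element `f` is unique when
`V` is dense in `L²(Ω)`; see `graph_formOperator`. -/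
def formOperator (hμ : IsBoundedCoefficient Ω μ) (V : Submodule ℂ (sobolevW12 Ω)) :
    L2Space Ω →ₗ.[ℂ] L2Space Ω :=
  (formOperatorGraph hμ V).toLinearPMap

theorem graph_formOperator (hμ : IsBoundedCoefficient Ω μ) (V : Submodule ℂ (sobolevW12 Ω))
    (hV : Dense (sobolevToL2 '' (V : Set (sobolevW12 Ω)))) :
    (formOperator hμ V).graph = formOperatorGraph hμ V := by
  refine Submodule.toLinearPMap_graph_eq _ ?_
  rintro p ⟨u, -, hup, h⟩ hp
  have hg : sobolevGrad u = 0 := sobolevGrad_eq_zero (hup.trans hp)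
  have h0 : ∀ v, dirichletForm μ u v = 0 := by
    intro v
    refine integral_eq_zero_of_ae ?_
    filter_upwards [Lp.coeFn_zero (EuclideanSpace ℂ (Fin d)) 2
      (volume.restrict (Ω : Set (EuclideanSpace ℝ (Fin d))))] with x hx
    rw [hg, hx]
    simp
  refine hV.eq_zero_of_inner_left ℂ ?_
  rintro _ ⟨v, hv, rfl⟩
  rw [← inner_conj_symm, ← h v hv, h0, map_zero]

end Form

end

/-! ### Sectors -/

/-! The proof has three layers: the form, the semigroup, and maximal regularity.

Form. A pair `(u, ∇u)` lives in the Hilbert space `L² × L²`, where `V` is closed, and the form is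
`(u, v) ↦ (M ∇u, ∇v)` with `M` the bounded coercive multiplication by `μ`. Boundedness and
coercivity put its values in a sector of angle less than `π/2`. Lax–Milgram for the form plus the
`L²` inner product gives `(A + 1)⁻¹` (`exists_form_solution`). Its range is dense in `V` for the
form norm, so `A` and the form have their numerical ranges in the same closed sectors
(`form_operator_abstract`), and the optimal angles agree. For `z` outside `Σ_θ`, some rotation `a`
of modulus one keeps `Σ_ω` in the right half plane and moves `z` to real part at most `-|z| sin(θ -
ω)` (`exists_rotation`). Pairing `(A - z)x` with `x` then bounds `A - z` from below, and a
continuation along segments from near `-1` makes `z` a point of the resolvent set. This gives the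
sharp resolvent estimate and sectoriality.

Semigroup. The Yosida approximations `A_n` are bounded, commute, and have numerical range in the
same `Σ_ω` (`IsMSectorial.inner_yosida_mem`), so `exp(-z A_n)` is a contraction for `z ∈ Σ_{π/2-ω}`.
Commutation gives `‖exp(-z A_n)x - exp(-z A_m)x‖ ≤ |z| ‖A_n x - A_m x‖`. Hence the exponentials
converge strongly, uniformly on bounded parts of the closed sector, and the limit inherits
contractivity, the semigroup law, continuity and holomorphy.

Maximal regularity. It suffices to bound `f ↦ ∫₀ᵗ B exp(-(t-s)B) f(s) ds` on `L^q` for bounded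
sectorial `B`, with a constant depending only on `q` and the angle. Write `E(x) = Re(Bx, x)`.
Splitting the time `r = t - s` into two halves and moving one half to the adjoint bounds `|(g, B
exp(-rB) f)|` by the product of the square roots of the energies of `exp(-rB/2) f` and `exp(-rB*/2)
g`. The energy of an orbit is integrable in time with total at most `‖x‖²`, and it is
quasi-decreasing (`energy_expSemigroup_le`). Integrated against a weight it is therefore controlled
by the Hardy–Littlewood maximal function of the weight. Cauchy–Schwarz with the weight `‖g‖^{2-q'}`,
Hölder and the maximal inequality give the bilinear `L^q`–`L^{q'}` estimate for `q ≥ 2`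
(`lintegral_mul_le_of_two_le`), and exchanging the two factors gives `q ≤ 2`. Duality turns this
into an `L^q` bound, Fatou carries it from `A_n` to `A`, and density of domain-valued data with
closedness of `A` finishes. -/

theorem mem_sector_iff {θ : ℝ} (h0 : 0 ≤ θ) (hπ : θ ≤ Real.pi) (z : ℂ) :
    z ∈ sector θ ↔ ‖z‖ * Real.cos θ ≤ z.re := by
  by_cases hz : z = 0
  · simp [sector, hz]
  have hpos : 0 < ‖z‖ := norm_pos_iff.2 hz
  have h1 : z ∈ sector θ ↔ |z.arg| ≤ θ := by simp [sector, hz]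
  -- The cosine is strictly decreasing on `[0, π]`, so comparing angles is comparing cosines. The
  -- resulting condition is continuous in `z` and in `θ`, unlike `arg`.
  rw [h1, ← Real.strictAntiOn_cos.le_iff_ge (a := θ) (b := |z.arg|) ⟨h0, hπ⟩
    ⟨abs_nonneg _, Complex.abs_arg_le_pi z⟩, Real.cos_abs, Complex.cos_arg hz, le_div_iff₀ hpos,
    mul_comm]

theorem sector_mono {θ φ : ℝ} (h : θ ≤ φ) : sector θ ⊆ sector φ :=
  union_subset_union_left _ fun _ hz => le_trans hz h

theorem isClosed_sector {θ : ℝ} (h0 : 0 ≤ θ) (hπ : θ ≤ Real.pi) : IsClosed (sector θ) := by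
  have : sector θ = {z : ℂ | ‖z‖ * Real.cos θ ≤ z.re} := by
    ext z; exact mem_sector_iff h0 hπ z
  rw [this]
  exact isClosed_le (by fun_prop) (by fun_prop)

theorem smul_mem_sector {θ : ℝ} (h0 : 0 ≤ θ) (hπ : θ ≤ Real.pi) {z : ℂ} (hz : z ∈ sector θ) {r : ℝ}
    (hr : 0 ≤ r) : (r : ℂ) * z ∈ sector θ := by
  rw [mem_sector_iff h0 hπ] at hz ⊢
  rw [norm_mul, Complex.norm_real, Real.norm_of_nonneg hr, Complex.re_ofReal_mul, mul_assoc]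
  exact mul_le_mul_of_nonneg_left hz hr

theorem ofReal_mem_sector {θ : ℝ} (h0 : 0 ≤ θ) {t : ℝ} (ht : 0 ≤ t) : (t : ℂ) ∈ sector θ := by
  left
  simpa [Complex.arg_ofReal_of_nonneg ht] using h0

theorem Complex.mul_re_eq_cos_arg (z w : ℂ) :
    (z * w).re = ‖z‖ * ‖w‖ * Real.cos (z.arg + w.arg) := by
  conv_lhs => rw [← Complex.norm_mul_exp_arg_mul_I z, ← Complex.norm_mul_exp_arg_mul_I w]
  rw [mul_mul_mul_comm, ← Complex.exp_add, ← add_mul, ← Complex.ofReal_mul, ← Complex.ofReal_add,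
    Complex.re_ofReal_mul, Complex.exp_ofReal_mul_I_re]

/-- The two arguments add up to at most `π/2` in modulus. This duality between `Σ_{π/2-ω}` and `Σ_ω`
yields both the separating half planes and the contractions at complex times. -/
theorem re_mul_nonneg_of_mem_sector {ω : ℝ} {z w : ℂ}
    (hz : z ∈ sector (Real.pi / 2 - ω)) (hw : w ∈ sector ω) : 0 ≤ (z * w).re := by
  rcases hz with hz | hz
  · rcases hw with hw | hw
    · rw [Complex.mul_re_eq_cos_arg]
      have h1 := abs_le.1 (show |z.arg| ≤ _ from hz)
      have h2 := abs_le.1 (show |w.arg| ≤ _ from hw)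
      exact mul_nonneg (by positivity)
        (Real.cos_nonneg_of_mem_Icc ⟨by linarith [h1.1, h2.1], by linarith [h1.2, h2.2]⟩)
    · rw [mem_singleton_iff.1 hw]; simp
  · rw [mem_singleton_iff.1 hz]; simp

theorem one_mem_sector {θ : ℝ} (h0 : 0 ≤ θ) : (1 : ℂ) ∈ sector θ := by
  simpa using ofReal_mem_sector h0 zero_le_one

/-- By the triangle inequality; the sign `cos θ ≥ 0`, hence `θ ≤ π/2`, is essential, since larger
sectors are not convex. -/
theorem sector_add_mem {θ : ℝ} (h0 : 0 ≤ θ) (h : θ ≤ Real.pi / 2) {z w : ℂ} (hz : z ∈ sector θ)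
    (hw : w ∈ sector θ) : z + w ∈ sector θ := by
  have hπ : θ ≤ Real.pi := by linarith [Real.pi_pos]
  have hc : 0 ≤ Real.cos θ := Real.cos_nonneg_of_mem_Icc ⟨by linarith [Real.pi_pos], h⟩
  rw [mem_sector_iff h0 hπ] at *
  rw [Complex.add_re]
  nlinarith [norm_add_le z w]

/-- A point outside a sector is separated from every smaller sector by a half plane. -/
theorem exists_rotation {ω θ : ℝ} (hω : 0 ≤ ω) (h : ω < θ) (hθ : θ ≤ Real.pi / 2) {z : ℂ}
    (hz : z ∉ sector θ) :
    ∃ a : ℂ, ‖a‖ = 1 ∧ 0 ≤ a.re ∧ (∀ w ∈ sector ω, 0 ≤ (a * w).re) ∧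
      (a * z).re ≤ -(‖z‖ * Real.sin (θ - ω)) := by
  have hz' : θ < |z.arg| := by
    by_contra hcon
    exact hz (Or.inl (not_lt.1 hcon))
  have hpi := Complex.abs_arg_le_pi z
  -- `β` is the amount of rotation. At most `π/2 - ω` is allowed, so that `Σ_ω` stays in the right
  -- half plane; if that would carry `z` past the negative axis, the rotation stops there.
  obtain ⟨β, hβ0, hβ1, h1, h2⟩ : ∃ β : ℝ, 0 ≤ β ∧ β ≤ Real.pi / 2 - ω ∧
      θ - ω + Real.pi / 2 ≤ |z.arg| + β ∧ |z.arg| + β ≤ Real.pi := by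
    rcases le_total |z.arg| (ω + Real.pi / 2) with hle | hle
    · exact ⟨Real.pi / 2 - ω, by linarith, le_rfl, by linarith, by linarith⟩
    · exact ⟨Real.pi - |z.arg|, by linarith, by linarith, by linarith, by linarith⟩
  -- The rotation takes the sign of `arg z`, so that it moves `z` away from the positive axis.
  obtain ⟨α, hα, hsum⟩ : ∃ α : ℝ, |α| ≤ β ∧ Real.cos (α + z.arg) = Real.cos (|z.arg| + β) := by
    rcases le_total 0 z.arg with hs | hs
    · exact ⟨β, by rw [abs_of_nonneg hβ0], by rw [abs_of_nonneg hs, add_comm]⟩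
    · refine ⟨-β, by rw [abs_neg, abs_of_nonneg hβ0], ?_⟩
      rw [abs_of_nonpos hs, ← Real.cos_neg]
      congr 1; ring
  have hpp := Real.pi_pos
  have hαb := abs_le.1 hα
  set a : ℂ := Complex.exp (α * Complex.I) with ha
  have hna : ‖a‖ = 1 := Complex.norm_exp_ofReal_mul_I α
  have harg : a.arg = α := by
    have := Complex.arg_mul_cos_add_sin_mul_I (r := 1) one_pos (θ := α)
      ⟨by linarith [hαb.1], by linarith [hαb.2]⟩
    rw [Complex.ofReal_one, one_mul] at this
    rw [ha, Complex.exp_mul_I, this]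
  have hasec : a ∈ sector (Real.pi / 2 - ω) := Or.inl (by
    change |a.arg| ≤ _
    rw [harg]; linarith)
  have hw : ∀ w ∈ sector ω, 0 ≤ (a * w).re := fun w hw => re_mul_nonneg_of_mem_sector hasec hw
  refine ⟨a, hna, by simpa using hw 1 (one_mem_sector hω), hw, ?_⟩
  -- The rotated angle lies between `θ - ω + π/2` and `π`, where the cosine is at most `cos(θ - ω +
  -- π/2) = -sin(θ - ω)`.
  rw [Complex.mul_re_eq_cos_arg, hna, one_mul, harg, hsum, ← mul_neg, ← Real.cos_add_pi_div_two]
  exact mul_le_mul_of_nonneg_left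
    (Real.cos_le_cos_of_nonneg_of_le_pi (by linarith) h2 h1) (norm_nonneg _)

/-- The resolvent bound needs an angle strictly above `ω`; this room to spare yields the inclusion
of the spectrum in `Σ_ω` itself. -/
theorem exists_larger_sector_notMem {ω : ℝ} (h : ω < Real.pi / 2) {z : ℂ} (hz : z ∉ sector ω) :
    ∃ θ, ω < θ ∧ θ ≤ Real.pi / 2 ∧ z ∉ sector θ := by
  have hz' : ω < |z.arg| := by
    by_contra hcon
    exact hz (Or.inl (not_lt.1 hcon))
  have hz0 : z ≠ 0 := fun h0 => hz (Or.inr h0)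
  have hmin : ω < min |z.arg| (Real.pi / 2) := lt_min hz' h
  refine ⟨(ω + min |z.arg| (Real.pi / 2)) / 2, by linarith, ?_, ?_⟩
  · linarith [min_le_right |z.arg| (Real.pi / 2)]
  · rintro (hc | hc)
    · have : |z.arg| ≤ _ := hc
      linarith [min_le_left |z.arg| (Real.pi / 2)]
    · exact hz0 hc

/-- The infimum is attained: for fixed `z` the condition `|z| cos θ ≤ Re z` is closed in `θ`. -/
theorem optimalAngle_spec {N : Set ℂ} {θ₀ : ℝ} (h0 : 0 ≤ θ₀) (h1 : θ₀ < Real.pi / 2)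
    (hN : N ⊆ sector θ₀) :
    0 ≤ optimalAngle N ∧ optimalAngle N < Real.pi / 2 ∧ N ⊆ sector (optimalAngle N) := by
  set s := {θ : ℝ | 0 ≤ θ ∧ θ < Real.pi ∧ N ⊆ sector θ} with hs
  have hbdd : BddBelow s := ⟨0, fun θ hθ => hθ.1⟩
  have hmem : θ₀ ∈ s := ⟨h0, by linarith [Real.pi_pos], hN⟩
  have hnn : 0 ≤ sInf s := le_csInf ⟨_, hmem⟩ fun θ hθ => hθ.1
  have hlt : sInf s < Real.pi / 2 := (csInf_le hbdd hmem).trans_lt h1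
  refine ⟨hnn, hlt, fun z hz => ?_⟩
  change z ∈ sector (sInf s)
  rw [mem_sector_iff hnn (by linarith [Real.pi_pos])]
  have hcl : IsClosed {θ : ℝ | ‖z‖ * Real.cos θ ≤ z.re} :=
    isClosed_le (by fun_prop) (by fun_prop)
  refine closure_minimal (s := s) (fun θ hθ => ?_) hcl (csInf_mem_closure ⟨_, hmem⟩ hbdd)
  exact (mem_sector_iff hθ.1 hθ.2.1.le z).1 (hθ.2.2 hz)

/-! ### Resolvents of operators with numerical range in a sector -/

section Resolvents

variable {H : Type*} [NormedAddCommGroup H] [InnerProductSpace ℂ H]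

theorem inner_mem_sector_of_numericalRange {B : H →ₗ.[ℂ] H} {ω : ℝ} (h0 : 0 ≤ ω)
    (hπ : ω ≤ Real.pi) (hB : numericalRange B ⊆ sector ω) (x : B.domain) :
    inner ℂ (x : H) (B x) ∈ sector ω := by
  by_cases hx : (x : H) = 0
  · rw [hx, inner_zero_left]; exact Or.inr rfl
  have hn : ‖(x : H)‖ ≠ 0 := norm_ne_zero_iff.2 hx
  have key : inner ℂ (((‖(x : H)‖⁻¹ : ℝ) : ℂ) • x : H)
      (B (((‖(x : H)‖⁻¹ : ℝ) : ℂ) • x)) ∈ sector ω := by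
    refine hB ⟨((‖(x : H)‖⁻¹ : ℝ) : ℂ) • x, ?_, rfl⟩
    rw [Submodule.coe_smul, norm_smul, Complex.norm_real, norm_inv, norm_norm, inv_mul_cancel₀ hn]
  have := smul_mem_sector h0 hπ key (sq_nonneg ‖(x : H)‖)
  rw [LinearPMap.map_smul, inner_smul_left, inner_smul_right, Complex.conj_ofReal] at this
  convert this using 1
  have hn' : ((‖(x : H)‖ : ℝ) : ℂ) ≠ 0 := Complex.ofReal_ne_zero.2 hn
  push_cast
  field_simp

theorem IsResolventAt.norm_le {B : H →ₗ.[ℂ] H} {z : ℂ} {R : H →L[ℂ] H} (hR : IsResolventAt B z R)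
    {δ : ℝ} (hδ : 0 < δ) (h : ∀ x : B.domain, δ * ‖(x : H)‖ ≤ ‖B x - z • (x : H)‖) :
    ‖R‖ ≤ δ⁻¹ := by
  refine R.opNorm_le_bound (inv_nonneg.2 hδ.le) fun f => ?_
  obtain ⟨hd, he⟩ := hR.right_inv f
  have := h ⟨R f, hd⟩
  rw [he] at this
  rwa [inv_mul_eq_div, le_div_iff₀ hδ, mul_comm]

/-- The resolvent set is open, with the usual Neumann series bound. -/
theorem IsResolventAt.exists_of_near [CompleteSpace H] {B : H →ₗ.[ℂ] H} {z z' : ℂ}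
    {R : H →L[ℂ] H} (hR : IsResolventAt B z R) (h : ‖z' - z‖ * ‖R‖ < 1) :
    ∃ R', IsResolventAt B z' R' := by
  have hn : ‖(z' - z) • R‖ < 1 := by rwa [norm_smul]
  -- On the domain, `B - z' = (1 - (z' - z)R)(B - z)`, so the new resolvent is `R (1 - (z' -
  -- z)R)⁻¹`.
  set U := Units.oneSub ((z' - z) • R) hn with hU
  have hUv : (U : H →L[ℂ] H) = 1 - (z' - z) • R := rfl
  have hcomm : R * (U : H →L[ℂ] H) = U * R := by
    rw [hUv, mul_sub, sub_mul, mul_one, one_mul, mul_smul_comm, smul_mul_assoc]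
  have hcomm' : R * (↑U⁻¹ : H →L[ℂ] H) = ↑U⁻¹ * R := by
    rw [Units.eq_inv_mul_iff_mul_eq, ← mul_assoc, ← hcomm, mul_assoc, Units.mul_inv, mul_one]
  refine ⟨R * ↑U⁻¹, ⟨fun f => ?_, fun x => ?_⟩⟩
  · obtain ⟨hd, he⟩ := hR.right_inv ((↑U⁻¹ : H →L[ℂ] H) f)
    refine ⟨hd, ?_⟩
    have h2 : (U : H →L[ℂ] H) ((↑U⁻¹ : H →L[ℂ] H) f) = f := by
      rw [← mul_apply_eq_comp, Units.mul_inv]; rfl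
    conv_rhs => rw [← h2, hUv]
    simp only [mul_apply_eq_comp, sub_apply,
      one_apply_eq_self, smul_apply]
    rw [sub_eq_iff_eq_add] at he
    rw [he]
    module
  · rw [hcomm', mul_apply_eq_comp]
    have h1 : B x - z' • (x : H) = (B x - z • (x : H)) - (z' - z) • (x : H) := by module
    rw [h1, map_sub, hR.left_inv, map_smul]
    have h2 : (x : H) - (z' - z) • R x = (U : H →L[ℂ] H) x := by
      rw [hUv]; simp
    rw [h2, ← mul_apply_eq_comp, Units.inv_mul]; rfl

/-- Pair `(B - z)x` with `x`, multiply by `a` and take the real part: the term from `B` is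
nonnegative, and Cauchy–Schwarz bounds the whole by `‖x‖ ‖(B - z)x‖`. -/
theorem lower_bound_of_rotation {B : H →ₗ.[ℂ] H} {a z : ℂ} (ha : ‖a‖ = 1)
    (h : ∀ x : B.domain, 0 ≤ (a * inner ℂ (x : H) (B x)).re) (x : B.domain) :
    -(a * z).re * ‖(x : H)‖ ≤ ‖B x - z • (x : H)‖ := by
  by_cases hx : (x : H) = 0
  · rw [hx]; simp
  have hpos : 0 < ‖(x : H)‖ := norm_pos_iff.2 hx
  have h1 : (a * inner ℂ (x : H) (B x - z • (x : H))).re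
      = (a * inner ℂ (x : H) (B x)).re - (a * z).re * ‖(x : H)‖ ^ 2 := by
    rw [inner_sub_right, inner_smul_right, inner_self_eq_norm_sq_to_K, mul_sub, Complex.sub_re,
      ← mul_assoc]
    congr 1
    rw [← Complex.re_mul_ofReal]
    push_cast; rfl
  have h2 : (a * inner ℂ (x : H) (B x - z • (x : H))).re ≤ ‖(x : H)‖ * ‖B x - z • (x : H)‖ := by
    refine (Complex.re_le_norm _).trans ?_
    rw [norm_mul, ha, one_mul]
    exact norm_inner_le_norm _ _
  have h3 := h x
  refine le_of_mul_le_mul_left ?_ hpos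
  nlinarith

/-- The resolvent set contains every half plane on which the numerical range gives a lower bound,
once it contains one of its points. -/
theorem exists_resolvent_of_halfPlane [CompleteSpace H] {B : H →ₗ.[ℂ] H} {a z z₀ : ℂ}
    (ha : ‖a‖ = 1) (h : ∀ x : B.domain, 0 ≤ (a * inner ℂ (x : H) (B x)).re)
    (hz₀ : z₀ ∈ operatorResolventSet B) (h₀ : (a * z₀).re < 0) (hz : (a * z).re < 0) :
    z ∈ operatorResolventSet B := by
  -- The real part of `a * ·` is affine, so it is at most `-δ` on the whole segment from `z₀` to
  -- `z`. Every resolvent there has norm at most `1/δ`, and `N` steps shorter than `δ` reach `z` by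
  -- Neumann series.
  set δ := min (-(a * z₀).re) (-(a * z).re) with hδ
  have hδ0 : 0 < δ := lt_min (by linarith) (by linarith)
  obtain ⟨N, hN⟩ := exists_nat_gt (‖z - z₀‖ / δ)
  have hN0 : 0 < (N : ℝ) := (div_nonneg (norm_nonneg _) hδ0.le).trans_lt hN
  have step : ∀ k : ℕ, k ≤ N → z₀ + ((k / N : ℝ) : ℂ) * (z - z₀) ∈ operatorResolventSet B := by
    intro k
    induction k with
    | zero => intro _; simpa using hz₀
    | succ k ih =>
      intro hk
      obtain ⟨R, hR⟩ := ih (by omega)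
      have hre : δ ≤ -(a * (z₀ + ((k / N : ℝ) : ℂ) * (z - z₀))).re := by
        have e : (a * (z₀ + ((k / N : ℝ) : ℂ) * (z - z₀))).re
            = (1 - k / N : ℝ) * (a * z₀).re + (k / N : ℝ) * (a * z).re := by
          rw [show a * (z₀ + ((k / N : ℝ) : ℂ) * (z - z₀))
            = ((1 - k / N : ℝ) : ℂ) * (a * z₀) + ((k / N : ℝ) : ℂ) * (a * z) by push_cast; ring,
            Complex.add_re, Complex.re_ofReal_mul, Complex.re_ofReal_mul]
        rw [e]
        have h1 : (k / N : ℝ) ≤ 1 := by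
          rw [div_le_one hN0]; exact_mod_cast (by omega : k ≤ N)
        have h2 : (0 : ℝ) ≤ k / N := by positivity
        have h3 : δ ≤ -(a * z₀).re := min_le_left _ _
        have h4 : δ ≤ -(a * z).re := min_le_right _ _
        nlinarith
      have hb : ‖R‖ ≤ δ⁻¹ := hR.norm_le hδ0 fun x =>
        (mul_le_mul_of_nonneg_right hre (norm_nonneg _)).trans (lower_bound_of_rotation ha h x)
      refine hR.exists_of_near ?_
      have hd : z₀ + (((k + 1 : ℕ) / N : ℝ) : ℂ) * (z - z₀) - (z₀ + ((k / N : ℝ) : ℂ) * (z - z₀))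
          = ((1 / N : ℝ) : ℂ) * (z - z₀) := by push_cast; ring
      rw [hd, norm_mul, Complex.norm_real, Real.norm_of_nonneg (by positivity)]
      calc 1 / (N : ℝ) * ‖z - z₀‖ * ‖R‖ ≤ 1 / (N : ℝ) * ‖z - z₀‖ * δ⁻¹ := by gcongr
        _ = (‖z - z₀‖ / δ) / N := by field_simp
        _ < 1 := by rwa [div_lt_one hN0]
  have := step N le_rfl
  rw [div_self hN0.ne'] at this
  simpa using this

variable {A : H →ₗ.[ℂ] H} {ω : ℝ}

theorem resolvent_norm_le_of_rotation {z a : ℂ} {δ : ℝ} (ha : ‖a‖ = 1)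
    (h : ∀ x : A.domain, 0 ≤ (a * inner ℂ (x : H) (A x)).re) (hδ : 0 < δ)
    (hz : (a * z).re ≤ -δ) {R : H →L[ℂ] H} (hR : IsResolventAt A z R) : ‖R‖ ≤ δ⁻¹ :=
  hR.norm_le hδ fun x =>
    (mul_le_mul_of_nonneg_right (by linarith) (norm_nonneg _)).trans
      (lower_bound_of_rotation ha h x)

theorem resolvent_norm_neg_le (h : ∀ x : A.domain, 0 ≤ (inner ℂ (x : H) (A x)).re) {r : ℝ}
    (hr : 0 < r) {R : H →L[ℂ] H} (hR : IsResolventAt A (-r) R) : ‖R‖ ≤ r⁻¹ :=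
  resolvent_norm_le_of_rotation (a := 1) (by simp) (by simpa using h) hr (by simp) hR

theorem exists_resolvent_of_rotation [CompleteSpace H]
    (hneg : (-1 : ℂ) ∈ operatorResolventSet A) {a z : ℂ}
    (hre : ∀ x : A.domain, 0 ≤ (inner ℂ (x : H) (A x)).re) (ha : ‖a‖ = 1) (ha0 : 0 ≤ a.re)
    (h : ∀ x : A.domain, 0 ≤ (a * inner ℂ (x : H) (A x)).re) (hz : (a * z).re < 0) :
    z ∈ operatorResolventSet A := by
  obtain ⟨R, hR⟩ := hneg
  have hb : ‖R‖ ≤ 1 := by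
    simpa using resolvent_norm_neg_le hre one_pos (R := R) (by simpa using hR)
  -- When `Re a = 0`, the point `-1` lies on the boundary of the half plane `Re(a z) < 0`. Moving by
  -- `-ā/2` changes `a z` by `-1/2` and so enters the half plane, while staying in the Neumann disc
  -- about `-1`, whose radius is at least `1`.
  have h1 : (-1 - (1 / 2 : ℝ) * (starRingEnd ℂ) a : ℂ) ∈ operatorResolventSet A := by
    refine hR.exists_of_near ?_
    have : (-1 - (1 / 2 : ℝ) * (starRingEnd ℂ) a : ℂ) - -1
        = -((1 / 2 : ℝ) * (starRingEnd ℂ) a : ℂ) := by ring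
    rw [this, norm_neg, norm_mul, Complex.norm_real, RCLike.norm_conj, ha]
    norm_num
    linarith
  refine exists_resolvent_of_halfPlane ha h h1 ?_ hz
  have : a * (-1 - (1 / 2 : ℝ) * (starRingEnd ℂ) a) = -a - ((1 / 2 : ℝ) : ℂ) := by
    rw [mul_sub, mul_left_comm, Complex.mul_conj, Complex.normSq_eq_norm_sq, ha]
    push_cast; ring
  rw [this, Complex.sub_re, Complex.neg_re, Complex.ofReal_re]
  linarith

theorem exists_resolvent_notMem_sector [CompleteSpace H] (h0 : 0 ≤ ω)
    (hN : numericalRange A ⊆ sector ω) (hneg : (-1 : ℂ) ∈ operatorResolventSet A) {θ : ℝ}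
    (hθ : ω < θ) (hθ' : θ ≤ Real.pi / 2) {z : ℂ} (hz : z ∉ sector θ) :
    z ∈ operatorResolventSet A ∧
      ∀ R, IsResolventAt A z R → ‖z • R‖ ≤ 1 / Real.sin (θ - ω) := by
  have hpp := Real.pi_pos
  have hmem := inner_mem_sector_of_numericalRange h0 (by linarith) hN
  have hsin : 0 < Real.sin (θ - ω) := Real.sin_pos_of_pos_of_lt_pi (by linarith) (by linarith)
  have hz0 : 0 < ‖z‖ := norm_pos_iff.2 fun hz0 => hz (Or.inr hz0)
  obtain ⟨a, ha, ha0, hw, haz⟩ := exists_rotation h0 hθ hθ' hz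
  have hmul : 0 < ‖z‖ * Real.sin (θ - ω) := mul_pos hz0 hsin
  refine ⟨exists_resolvent_of_rotation hneg (fun x => ?_) ha ha0 (fun x => hw _ (hmem x))
    (by linarith), fun R hR => ?_⟩
  · have := re_mul_nonneg_of_mem_sector (one_mem_sector (θ := Real.pi / 2 - ω) (by linarith))
      (hmem x)
    rwa [one_mul] at this
  · have := resolvent_norm_le_of_rotation ha (fun x => hw _ (hmem x)) hmul haz hR
    rw [norm_smul]
    calc ‖z‖ * ‖R‖ ≤ ‖z‖ * (‖z‖ * Real.sin (θ - ω))⁻¹ := by gcongr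
      _ = 1 / Real.sin (θ - ω) := by field_simp

theorem isSectorialOfAngle_of_numericalRange [CompleteSpace H] (h0 : 0 ≤ ω) (h1 : ω < Real.pi / 2)
    (hN : numericalRange A ⊆ sector ω) (hneg : (-1 : ℂ) ∈ operatorResolventSet A) :
    IsSectorialOfAngle A ω where
  angle_nonneg := h0
  angle_lt := by linarith [Real.pi_pos]
  spectrum_subset z hz := by
    by_contra hcon
    obtain ⟨θ, hθ, hθ', hzθ⟩ := exists_larger_sector_notMem h1 hcon
    exact hz (exists_resolvent_notMem_sector h0 hN hneg hθ hθ' hzθ).1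
  bounded θ hθ _ := by
    -- Angles above `π/2` need no separate estimate: the complement of a larger sector is smaller.
    have hm : ω < min θ (Real.pi / 2) := lt_min hθ h1
    refine ⟨1 / Real.sin (min θ (Real.pi / 2) - ω), fun z hz R hR => ?_⟩
    exact (exists_resolvent_notMem_sector h0 hN hneg hm (min_le_right _ _)
      (fun hc => hz (sector_mono (min_le_left _ _) hc))).2 R hR

/-- Replaces the quantifier over the domain by one equation with a bounded operator, from which
closedness of the graph and the Yosida identities follow by algebra. -/
theorem IsResolventAt.mem_graph_iff {B : H →ₗ.[ℂ] H} {z : ℂ} {R : H →L[ℂ] H}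
    (hR : IsResolventAt B z R) (x y : H) : (x, y) ∈ B.graph ↔ R (y - z • x) = x := by
  rw [LinearPMap.mem_graph_iff]
  constructor
  · rintro ⟨w, rfl, rfl⟩
    exact hR.left_inv w
  · intro h
    obtain ⟨hd, he⟩ := hR.right_inv (y - z • x)
    refine ⟨⟨_, hd⟩, h, ?_⟩
    have h3 : z • R (y - z • x) = z • x := by rw [h]
    rw [sub_eq_iff_eq_add, h3, sub_add_cancel] at he
    exact he

theorem isClosed_of_mem_resolventSet {B : H →ₗ.[ℂ] H} {z : ℂ} (hz : z ∈ operatorResolventSet B) :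
    B.IsClosed := by
  obtain ⟨R, hR⟩ := hz
  have : (B.graph : Set (H × H)) = {p | R (p.2 - z • p.1) = p.1} := by
    ext ⟨x, y⟩
    exact hR.mem_graph_iff x y
  rw [LinearPMap.IsClosed, this]
  exact isClosed_eq (by fun_prop) (by fun_prop)

theorem isMAccretiveOfAngle_of_numericalRange (h0 : 0 ≤ ω) (h1 : ω < Real.pi / 2)
    (hN : numericalRange A ⊆ sector ω) (hneg : (-1 : ℂ) ∈ operatorResolventSet A) :
    IsMAccretiveOfAngle A ω where
  angle_nonneg := h0
  angle_le := h1.le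
  isClosed := isClosed_of_mem_resolventSet hneg
  accretive := hN.trans (sector_mono h1.le)
  neg_one_mem := hneg
  numericalRange_subset := hN

end Resolvents

/-! ### Coercive forms and the induced operator -/

section AbstractForm

variable {H K W : Type*} [NormedAddCommGroup H] [InnerProductSpace ℂ H] [CompleteSpace H]
  [NormedAddCommGroup K] [InnerProductSpace ℂ K]
  [NormedAddCommGroup W] [InnerProductSpace ℂ W] [CompleteSpace W]
  {j : W →L[ℂ] H} {G : W →L[ℂ] K} {M : K →L[ℂ] K} {m : ℝ}

/-- Lax--Milgram for the form `(u, v) ↦ (M G u, G v) + (j u, j v)`: its solution operator has dense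
range, the range being the domain of the induced operator in the form norm. -/
theorem exists_form_solution [CompleteSpace K] (hm : 0 < m)
    (hM : ∀ k, m * ‖k‖ ^ 2 ≤ (inner ℂ k (M k)).re)
    (hW : ∀ w, ‖w‖ ^ 2 = ‖j w‖ ^ 2 + ‖G w‖ ^ 2) (hj : Function.Injective j) :
    ∃ E : H →L[ℂ] W, DenseRange E ∧
      (∀ f v, inner ℂ (G v) (M (G (E f))) + inner ℂ (j v) (j (E f)) = inner ℂ (j v) f) ∧
      ∀ u f, (∀ v, inner ℂ (G v) (M (G u)) + inner ℂ (j v) (j u) = inner ℂ (j v) f) → u = E f := by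
  set L : W →L[ℂ] W := (ContinuousLinearMap.adjoint G) ∘L M ∘L G +
    (ContinuousLinearMap.adjoint j) ∘L j with hL
  have hin : ∀ u v, inner ℂ v (L u) = inner ℂ (G v) (M (G u)) + inner ℂ (j v) (j u) := by
    intro u v
    simp [hL, ContinuousLinearMap.adjoint_inner_right]
  set δ : NNReal := ⟨min m 1, (lt_min hm one_pos).le⟩ with hδ
  have hδ0 : 0 < δ := lt_min hm one_pos
  have hunit : IsUnit L := by
    refine L.isUnit_of_forall_le_norm_inner_map hδ0 fun x => ?_
    rw [norm_inner_symm, hin]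
    refine le_trans ?_ (Complex.re_le_norm _)
    rw [Complex.add_re, inner_self_eq_norm_sq_to_K]
    have h1 := hM (G x)
    have h2 : ((‖j x‖ : ℂ) ^ 2).re = ‖j x‖ ^ 2 := by rw [← Complex.ofReal_pow, Complex.ofReal_re]
    have h3 : (δ : ℝ) ≤ m := min_le_left _ _
    have h4 : (δ : ℝ) ≤ 1 := min_le_right _ _
    change _ ≤ _ + ((‖j x‖ : ℂ) ^ 2).re
    rw [h2, hW x]
    nlinarith [sq_nonneg ‖j x‖, sq_nonneg ‖G x‖]
  obtain ⟨U, hU⟩ := hunit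
  have hLU : ∀ w, L ((↑U⁻¹ : W →L[ℂ] W) w) = w := fun w => by
    rw [← hU, ← mul_apply_eq_comp, Units.mul_inv]; rfl
  have hUL : ∀ w, (↑U⁻¹ : W →L[ℂ] W) (L w) = w := fun w => by
    rw [← hU, ← mul_apply_eq_comp, Units.inv_mul]; rfl
  refine ⟨(↑U⁻¹ : W →L[ℂ] W) ∘L ContinuousLinearMap.adjoint j, ?_, fun f v => ?_, fun u f h => ?_⟩
  · set E := (↑U⁻¹ : W →L[ℂ] W) ∘L ContinuousLinearMap.adjoint j with hE
    -- If `w` is orthogonal to the range and `w' = (L⁻¹)* w`, testing against `E (j w')` gives `‖j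
    -- w'‖² = 0`. Injectivity of `j` gives `w' = 0`, and then `w = 0`.
    have htop : E.range.topologicalClosure = ⊤ := by
      rw [Submodule.topologicalClosure_eq_top_iff, Submodule.eq_bot_iff]
      intro w hw
      set w' := ContinuousLinearMap.adjoint (↑U⁻¹ : W →L[ℂ] W) w with hw'
      have h0 : j w' = 0 := by
        have := (Submodule.mem_orthogonal' _ _).1 hw (E (j w')) ⟨_, rfl⟩
        rw [hE, ContinuousLinearMap.comp_apply, ← ContinuousLinearMap.adjoint_inner_left,
          ContinuousLinearMap.adjoint_inner_right, ← hw'] at this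
        exact inner_self_eq_zero.1 this
      have h1 : w' = 0 := hj (by rw [h0, map_zero])
      refine inner_self_eq_zero (𝕜 := ℂ).1 ?_
      nth_rw 2 [← hUL w]
      rw [← ContinuousLinearMap.adjoint_inner_left, ← hw', h1, inner_zero_left]
    have hd := Submodule.dense_iff_topologicalClosure_eq_top.2 htop
    exact hd
  · rw [← hin, ContinuousLinearMap.comp_apply, hLU, ContinuousLinearMap.adjoint_inner_right]
  · have : L u = ContinuousLinearMap.adjoint j f := by
      refine ext_inner_left ℂ fun v => ?_
      rw [hin, h v, ContinuousLinearMap.adjoint_inner_right]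
    rw [ContinuousLinearMap.comp_apply, ← this, hUL]

/-- The ratio of real part to modulus is at least `m / ‖M‖`, which is the cosine of an angle below
`π/2`. Taking `max m ‖M‖` keeps the ratio in `(0, 1]` even when `K` is trivial. -/
theorem form_mem_sector (hm : 0 < m) (hM : ∀ k, m * ‖k‖ ^ 2 ≤ (inner ℂ k (M k)).re) :
    ∃ θ, 0 ≤ θ ∧ θ < Real.pi / 2 ∧ ∀ k, inner ℂ k (M k) ∈ sector θ := by
  set r := m / max m ‖M‖ with hr
  have hmax : 0 < max m ‖M‖ := lt_max_of_lt_left hm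
  have hr0 : 0 < r := div_pos hm hmax
  have hr1 : r ≤ 1 := (div_le_one hmax).2 (le_max_left _ _)
  refine ⟨Real.arccos r, Real.arccos_nonneg _, Real.arccos_lt_pi_div_two.2 hr0, fun k => ?_⟩
  rw [mem_sector_iff (Real.arccos_nonneg _) (Real.arccos_le_pi _),
    Real.cos_arccos (by linarith) hr1]
  have h1 : ‖inner ℂ k (M k)‖ ≤ max m ‖M‖ * ‖k‖ ^ 2 := by
    calc ‖inner ℂ k (M k)‖ ≤ ‖k‖ * ‖M k‖ := norm_inner_le_norm _ _
      _ ≤ ‖k‖ * (max m ‖M‖ * ‖k‖) := by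
        gcongr
        exact M.le_of_opNorm_le (le_max_right _ _) k
      _ = _ := by ring
  calc ‖inner ℂ k (M k)‖ * r ≤ max m ‖M‖ * ‖k‖ ^ 2 * r := by gcongr
    _ = m * ‖k‖ ^ 2 := by rw [hr]; field_simp
    _ ≤ _ := hM k

/-- Numerical range and resolvent of the operator induced by a form. -/
theorem form_operator_abstract [CompleteSpace K] (hm : 0 < m)
    (hM : ∀ k, m * ‖k‖ ^ 2 ≤ (inner ℂ k (M k)).re)
    (hW : ∀ w, ‖w‖ ^ 2 = ‖j w‖ ^ 2 + ‖G w‖ ^ 2) (hj : Function.Injective j) {A : H →ₗ.[ℂ] H}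
    (hA : ∀ x f, (x, f) ∈ A.graph ↔ ∃ u, j u = x ∧
      ∀ v, inner ℂ (G v) (M (G u)) = inner ℂ (j v) f) :
    (∀ θ, 0 ≤ θ → θ < Real.pi → numericalRange A ⊆ sector θ →
      ∀ u, inner ℂ (G u) (M (G u)) ∈ sector θ) ∧
    (∀ x : A.domain, ∃ u, j u = x ∧ inner ℂ (x : H) (A x) = inner ℂ (G u) (M (G u))) ∧
    (-1 : ℂ) ∈ operatorResolventSet A := by
  obtain ⟨E, hE, hE1, hE2⟩ := exists_form_solution hm hM hW hj
  have hEgr : ∀ f, (j (E f), f - j (E f)) ∈ A.graph := by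
    intro f
    refine (hA _ _).2 ⟨E f, rfl, fun v => ?_⟩
    rw [inner_sub_right, ← hE1, add_sub_cancel_right]
  refine ⟨fun θ h0 hπ hN u => ?_, fun x => ?_, j ∘L E, fun f => ?_, fun x => ?_⟩
  · have hcl : IsClosed {u | inner ℂ (G u) (M (G u)) ∈ sector θ} :=
      (isClosed_sector h0 hπ.le).preimage (by fun_prop)
    -- The sector condition is closed in the form norm, so it suffices to check it on the dense
    -- range of `E`. There the form value is `(x, A x)` for a vector `x` of the domain.
    refine hE.induction_on (p := fun u => inner ℂ (G u) (M (G u)) ∈ sector θ) u hcl fun f => ?_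
    obtain ⟨y, hy1, hy2⟩ := (LinearPMap.mem_graph_iff _).1 (hEgr f)
    have := inner_mem_sector_of_numericalRange h0 hπ.le hN y
    rw [hy2, hy1] at this
    convert this using 1
    rw [inner_sub_right, ← hE1, add_sub_cancel_right]
  · obtain ⟨u, hu, h⟩ := (hA _ _).1 (LinearPMap.mem_graph _ x)
    exact ⟨u, hu, by rw [h u, hu]⟩
  · obtain ⟨y, hy1, hy2⟩ := (LinearPMap.mem_graph_iff _).1 (hEgr f)
    have hd : (j ∘L E) f ∈ A.domain := by
      have := y.2
      rwa [hy1] at this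
    refine ⟨hd, ?_⟩
    have : (⟨(j ∘L E) f, hd⟩ : A.domain) = y := Subtype.ext hy1.symm
    rw [this, hy2]
    simp
  · obtain ⟨u, hu, h⟩ := (hA _ _).1 (LinearPMap.mem_graph _ x)
    rw [← hu]
    -- The equation `(A + 1)x = f` is the variational problem solved by `E`, whose solution is
    -- unique.
    have := hE2 u (A x - (-1 : ℂ) • j u) fun v => by
      rw [inner_sub_right, ← h v, inner_smul_right]; ring
    rw [ContinuousLinearMap.comp_apply, ← this]

theorem form_operator_of_submodule [CompleteSpace K] (hm : 0 < m)
    (hM : ∀ k, m * ‖k‖ ^ 2 ≤ (inner ℂ k (M k)).re)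
    (hW : ∀ w, ‖w‖ ^ 2 = ‖j w‖ ^ 2 + ‖G w‖ ^ 2) (V : Submodule ℂ W)
    (hV : IsClosed (V : Set W)) (hinj : ∀ u ∈ V, j u = 0 → G u = 0) {A : H →ₗ.[ℂ] H}
    (hA : ∀ x f, (x, f) ∈ A.graph ↔ ∃ u ∈ V, j u = x ∧
      ∀ v ∈ V, inner ℂ (G v) (M (G u)) = inner ℂ (j v) f) :
    (∀ θ, 0 ≤ θ → θ < Real.pi → numericalRange A ⊆ sector θ →
      ∀ u ∈ V, inner ℂ (G u) (M (G u)) ∈ sector θ) ∧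
    (∀ x : A.domain, ∃ u ∈ V, j u = x ∧ inner ℂ (x : H) (A x) = inner ℂ (G u) (M (G u))) ∧
    (-1 : ℂ) ∈ operatorResolventSet A := by
  have : CompleteSpace V := hV.completeSpace_coe
  -- Two pairs with the same function have the same gradient, so the norm identity forces their
  -- difference to vanish.
  have hinj' : Function.Injective (j ∘L V.subtypeL) := by
    refine (injective_iff_map_eq_zero _).2 fun u hu => ?_
    have hu1 : j u = 0 := hu
    have h := hW u
    rw [hu1, hinj u u.2 hu1, norm_zero] at h
    simpa using h
  obtain ⟨h1, h2, h3⟩ := form_operator_abstract (j := j ∘L V.subtypeL) (G := G ∘L V.subtypeL)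
    hm hM (fun w => hW w) hinj' (A := A) (by
    intro x f
    rw [hA]
    exact ⟨fun ⟨u, hu, hux, h⟩ => ⟨⟨u, hu⟩, hux, fun v => h v v.2⟩,
      fun ⟨u, hux, h⟩ => ⟨u, u.2, hux, fun v hv => h ⟨v, hv⟩⟩⟩)
  refine ⟨fun θ h0 hπ hN u hu => h1 θ h0 hπ hN ⟨u, hu⟩, fun x => ?_, h3⟩
  obtain ⟨u, hu, h⟩ := h2 x
  exact ⟨u, u.2, hu, h⟩

theorem form_operator_of_graphNorm [CompleteSpace K] (hm : 0 < m)
    (hM : ∀ k, m * ‖k‖ ^ 2 ≤ (inner ℂ k (M k)).re) (V : Submodule ℂ (WithLp 2 (H × K)))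
    (hV : IsClosed (V : Set (WithLp 2 (H × K)))) (hinj : ∀ u ∈ V, u.fst = 0 → u.snd = 0)
    {A : H →ₗ.[ℂ] H}
    (hA : ∀ x f, (x, f) ∈ A.graph ↔ ∃ u ∈ V, u.fst = x ∧
      ∀ v ∈ V, inner ℂ v.snd (M u.snd) = inner ℂ v.fst f) :
    (∀ θ, 0 ≤ θ → θ < Real.pi → numericalRange A ⊆ sector θ →
      ∀ u ∈ V, inner ℂ u.snd (M u.snd) ∈ sector θ) ∧
    (∀ x : A.domain, ∃ u ∈ V, u.fst = x ∧ inner ℂ (x : H) (A x) = inner ℂ u.snd (M u.snd)) ∧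
    (-1 : ℂ) ∈ operatorResolventSet A :=
  form_operator_of_submodule (W := WithLp 2 (H × K)) (j := WithLp.fstL 2 ℂ H K)
    (G := WithLp.sndL 2 ℂ H K) hm hM (fun w => WithLp.prod_norm_sq_eq_of_L2 w) V hV hinj hA

end AbstractForm

/-! ### The multiplication operator, closedness of the Sobolev space, and the Dirichlet form -/

section Form

variable {d : ℕ} {Ω : Opens (EuclideanSpace ℝ (Fin d))}
  {μ : EuclideanSpace ℝ (Fin d) → EuclideanSpace ℂ (Fin d) →L[ℂ] EuclideanSpace ℂ (Fin d)}

/-- The operator of multiplication by a bounded coefficient function. -/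
theorem exists_multiplication (hμ : IsBoundedCoefficient Ω μ) :
    ∃ M : L2VectorSpace Ω →L[ℂ] L2VectorSpace Ω, ∀ g : L2VectorSpace Ω,
      ∀ᵐ x ∂(volume.restrict (Ω : Set (EuclideanSpace ℝ (Fin d)))), M g x = μ x (g x) := by
  obtain ⟨C, hC⟩ := hμ.bounded
  have hmem : MemLp μ ∞ (volume.restrict (Ω : Set (EuclideanSpace ℝ (Fin d)))) :=
    memLp_top_of_bound hμ.measurable C hC
  refine ⟨(ContinuousLinearMap.id ℂ (EuclideanSpace ℂ (Fin d) →L[ℂ]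
    EuclideanSpace ℂ (Fin d))).holderL (volume.restrict (Ω : Set (EuclideanSpace ℝ (Fin d))))
    ∞ 2 2 (hmem.toLp μ), fun g => ?_⟩
  have h := ContinuousLinearMap.coeFn_holder (ContinuousLinearMap.id ℂ (EuclideanSpace ℂ (Fin d)
    →L[ℂ] EuclideanSpace ℂ (Fin d))) (r := 2) (hmem.toLp μ) g
  filter_upwards [h, hmem.coeFn_toLp] with x h1 h2
  rw [← h2]
  exact h1

/-- The integral is an `L²` inner product with the complexified `ψ`. Both sides of the weak gradient
identity are of this kind, so the identity is a closed condition. -/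
theorem continuous_integral_smul {ψ : EuclideanSpace ℝ (Fin d) → ℝ}
    (hψ : MemLp ψ 2 (volume.restrict (Ω : Set (EuclideanSpace ℝ (Fin d))))) :
    Continuous fun u : L2Space Ω =>
      ∫ x in (Ω : Set (EuclideanSpace ℝ (Fin d))), ψ x • u x := by
  have hψ' : MemLp (fun x => (ψ x : ℂ)) 2
      (volume.restrict (Ω : Set (EuclideanSpace ℝ (Fin d)))) := hψ.ofReal
  have : (fun u : L2Space Ω => ∫ x in (Ω : Set (EuclideanSpace ℝ (Fin d))), ψ x • u x)
      = fun u : L2Space Ω => inner ℂ (hψ'.toLp _) u := by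
    ext u
    rw [L2.inner_def]
    refine integral_congr_ae ?_
    filter_upwards [hψ'.coeFn_toLp] with x hx
    rw [hx]
    simp [mul_comm]
  rw [this]
  fun_prop

theorem isClosed_sobolevW12 :
    IsClosed (sobolevW12 Ω : Set (WithLp 2 (L2Space Ω × L2VectorSpace Ω))) := by
  have : (sobolevW12 Ω : Set (WithLp 2 (L2Space Ω × L2VectorSpace Ω)))
      = ⋂ (φ : 𝓓(Ω, ℝ)) (i : Fin d), {p | ∫ x in (Ω : Set (EuclideanSpace ℝ (Fin d))),
        (fderiv ℝ φ x (EuclideanSpace.single i 1)) • p.fst x =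
      - ∫ x in (Ω : Set (EuclideanSpace ℝ (Fin d))), φ x • p.snd x i} := by
    ext p
    simp only [mem_iInter]
    rfl
  rw [this]
  refine isClosed_iInter fun φ => isClosed_iInter fun i => ?_
  refine isClosed_eq ?_ (Continuous.neg ?_)
  · exact (continuous_integral_smul (φ.memLp_two_fderiv _)).comp
      (WithLp.fstL 2 ℂ (L2Space Ω) (L2VectorSpace Ω)).continuous
  · set P : L2VectorSpace Ω →L[ℂ] L2Space Ω :=
      (EuclideanSpace.proj (𝕜 := ℂ) i : EuclideanSpace ℂ (Fin d) →L[ℂ] ℂ).compLpL 2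
        (volume.restrict (Ω : Set (EuclideanSpace ℝ (Fin d)))) with hP
    have h := (continuous_integral_smul φ.memLp_two).comp (P.continuous.comp
      (WithLp.sndL 2 ℂ (L2Space Ω) (L2VectorSpace Ω)).continuous)
    refine h.congr fun p => integral_congr_ae ?_
    filter_upwards [(EuclideanSpace.proj (𝕜 := ℂ) i : EuclideanSpace ℂ (Fin d) →L[ℂ]
      ℂ).coeFn_compLpL (p := 2) (μ := volume.restrict (Ω : Set (EuclideanSpace ℝ (Fin d))))
      p.snd] with x hx
    change φ x • (P p.snd) x = _
    rw [hP, hx]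
    rfl

theorem Complex.integral_re {α : Type*} [MeasurableSpace α] {ν : Measure α} {f : α → ℂ}
    (hf : Integrable f ν) : (∫ x, f x ∂ν).re = ∫ x, (f x).re ∂ν :=
  (_root_.integral_re hf).symm

theorem L2.norm_sq_eq_integral (k : L2VectorSpace Ω) :
    ‖k‖ ^ 2 = ∫ x in (Ω : Set (EuclideanSpace ℝ (Fin d))), ‖k x‖ ^ 2 := by
  have h1 : ((‖k‖ ^ 2 : ℝ) : ℂ) = inner ℂ k k := by
    rw [inner_self_eq_norm_sq_to_K]; push_cast; rfl
  rw [← Complex.ofReal_re (‖k‖ ^ 2), h1, L2.inner_def,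
    Complex.integral_re (L2.integrable_inner (𝕜 := ℂ) k k)]
  exact integral_congr_ae (Eventually.of_forall fun x => inner_self_eq_norm_sq (𝕜 := ℂ) (k x))

theorem multiplication_coercive {M : L2VectorSpace Ω →L[ℂ] L2VectorSpace Ω} {m : ℝ}
    (hM : ∀ g : L2VectorSpace Ω,
      ∀ᵐ x ∂(volume.restrict (Ω : Set (EuclideanSpace ℝ (Fin d)))), M g x = μ x (g x))
    (hell : ∀ᵐ x ∂(volume.restrict (Ω : Set (EuclideanSpace ℝ (Fin d)))),
        ∀ ξ : EuclideanSpace ℂ (Fin d), m * ‖ξ‖ ^ 2 ≤ (inner ℂ ξ (μ x ξ)).re)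
    (k : L2VectorSpace Ω) : m * ‖k‖ ^ 2 ≤ (inner ℂ k (M k)).re := by
  rw [L2.norm_sq_eq_integral, L2.inner_def,
    Complex.integral_re (L2.integrable_inner (𝕜 := ℂ) k (M k)), ← integral_const_mul]
  refine integral_mono_ae ?_ (L2.integrable_inner (𝕜 := ℂ) k (M k)).re ?_
  · exact ((Lp.memLp k).integrable_norm_pow (by norm_num)).const_mul m
  · filter_upwards [hM k, hell] with x hx1 hx2
    rw [hx1]
    exact hx2 _

theorem dirichletForm_eq_inner {M : L2VectorSpace Ω →L[ℂ] L2VectorSpace Ω}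
    (hM : ∀ g : L2VectorSpace Ω,
      ∀ᵐ x ∂(volume.restrict (Ω : Set (EuclideanSpace ℝ (Fin d)))), M g x = μ x (g x))
    (u v : sobolevW12 Ω) :
    dirichletForm μ u v = inner ℂ (sobolevGrad v) (M (sobolevGrad u)) := by
  rw [L2.inner_def]
  refine integral_congr_ae ?_
  filter_upwards [hM (sobolevGrad u)] with x hx
  rw [hx]

/-- The operator induced by the Dirichlet form: numerical range and resolvent at `-1`. -/
theorem formOperator_properties (hμ : IsBoundedCoefficient Ω μ)
    (hell : ∃ m : ℝ, 0 < m ∧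
      ∀ᵐ x ∂(volume.restrict (Ω : Set (EuclideanSpace ℝ (Fin d)))),
        ∀ ξ : EuclideanSpace ℂ (Fin d), m * ‖ξ‖ ^ 2 ≤ (inner ℂ ξ (μ x ξ)).re)
    (V : Submodule ℂ (sobolevW12 Ω)) (hVclosed : IsClosed (V : Set (sobolevW12 Ω)))
    (hVdense : Dense (sobolevToL2 '' (V : Set (sobolevW12 Ω)))) :
    (∃ θ, 0 ≤ θ ∧ θ < Real.pi / 2 ∧ formNumericalRange μ V ⊆ sector θ) ∧
    (∀ θ, 0 ≤ θ → θ < Real.pi →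
      (numericalRange (formOperator hμ V) ⊆ sector θ ↔ formNumericalRange μ V ⊆ sector θ)) ∧
    (-1 : ℂ) ∈ operatorResolventSet (formOperator hμ V) := by
  obtain ⟨M, hM⟩ := exists_multiplication hμ
  obtain ⟨m, hm, hell⟩ := hell
  have hMell := multiplication_coercive hM hell
  have hform := dirichletForm_eq_inner hM
  -- A closed subspace of `W^{1,2}` stays closed in `L² × L²` because `W^{1,2}` is itself closed
  -- there; this supplies the completeness needed for Lax–Milgram.
  have hV : IsClosed (V.map (sobolevW12 Ω).subtype :
      Set (WithLp 2 (L2Space Ω × L2VectorSpace Ω))) :=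
    isClosed_sobolevW12.isClosedEmbedding_subtypeVal.isClosedMap _ hVclosed
  have hmem : ∀ u ∈ V, (u : WithLp 2 (L2Space Ω × L2VectorSpace Ω)) ∈
      V.map (sobolevW12 Ω).subtype := fun u hu => ⟨u, hu, rfl⟩
  obtain ⟨h1, h2, h3⟩ := form_operator_of_graphNorm hm hMell _ hV
    (by
      rintro _ ⟨u, -, rfl⟩ hu
      exact sobolevGrad_eq_zero (u := u) hu) (A := formOperator hμ V) (by
      intro x f
      rw [graph_formOperator hμ V hVdense]
      constructor
      · rintro ⟨u, hu, hux, h⟩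
        refine ⟨u, hmem u hu, hux, ?_⟩
        rintro _ ⟨v, hv, rfl⟩
        exact (hform u v).symm.trans (h v hv)
      · rintro ⟨_, ⟨u, hu, rfl⟩, hux, h⟩
        exact ⟨u, hu, hux, fun v hv => (hform u v).trans (h v (hmem v hv))⟩)
  refine ⟨?_, fun θ h0 hπ => ⟨fun hN => ?_, fun hN => ?_⟩, h3⟩
  · obtain ⟨θ, h0, h1, h⟩ := form_mem_sector hm hMell
    refine ⟨θ, h0, h1, ?_⟩
    rintro _ ⟨u, -, -, rfl⟩
    rw [hform]
    exact h _
  · rintro _ ⟨u, hu, -, rfl⟩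
    rw [hform]
    exact h1 θ h0 hπ hN u (hmem u hu)
  · rintro _ ⟨x, hx, rfl⟩
    obtain ⟨_, ⟨u, hu, rfl⟩, hux, h⟩ := h2 x
    refine hN ⟨u, hu, ?_, ?_⟩
    · rw [← hx, ← hux]; rfl
    · rw [h, hform]; rfl

end Form

/-! ### Strongly holomorphic operator families -/

section StronglyHolomorphic

variable {E F : Type*} [NormedAddCommGroup E] [NormedSpace ℂ E] [NormedAddCommGroup F]
  [NormedSpace ℂ F] [CompleteSpace F]

/-- A bounded, strongly holomorphic family of operators is holomorphic in operator norm. -/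
theorem differentiableOn_of_strongly {f : ℂ → E →L[ℂ] F} {U : Set ℂ} (hU : IsOpen U) {C : ℝ}
    (hC : ∀ z ∈ U, ‖f z‖ ≤ C) (hf : ∀ x, DifferentiableOn ℂ (fun z => f z x) U) :
    DifferentiableOn ℂ f U := by
  intro c hc
  obtain ⟨ε, hε, hball⟩ := Metric.isOpen_iff.1 hU c hc
  have hC0 : 0 ≤ C := (norm_nonneg _).trans (hC c hc)
  -- Small enough that a closed ball of radius `r` centred in another such ball about `c` remains in
  -- `U`.
  set r := ε / 4 with hr
  have hr0 : 0 < r := by positivity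
  have hsub : ∀ z ∈ Metric.closedBall c r, Metric.closedBall z r ⊆ U := fun z hz w hw =>
    hball (by
      rw [Metric.mem_closedBall] at hz hw
      rw [Metric.mem_ball]
      linarith [dist_triangle w z c])
  have hsubU : Metric.closedBall c r ⊆ U := hsub c (Metric.mem_closedBall_self hr0.le)
  have hderiv : ∀ x, ∀ z ∈ Metric.closedBall c r, ‖deriv (fun z => f z x) z‖ ≤ C * ‖x‖ / r := by
    intro x z hz
    refine Complex.norm_deriv_le_of_forall_mem_sphere_norm_le hr0 ?_ fun w hw => ?_
    · exact ((hf x).mono (hsub z hz)).diffContOnCl_ball subset_rfl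
    · exact (f w).le_of_opNorm_le (hC w (hsub z hz (Metric.sphere_subset_closedBall hw))) x
  -- Cauchy's estimate bounds all orbit derivatives by `C ‖x‖ / r`. Uniformity in `x` makes `f`
  -- Lipschitz in operator norm, so its operator-valued Cauchy integral exists and is analytic;
  -- evaluated at each `x`, it returns `f`.
  have hlip : LipschitzOnWith (Real.toNNReal (C / r)) f (Metric.closedBall c r) := by
    refine LipschitzOnWith.of_dist_le_mul fun z hz w hw => ?_
    rw [dist_eq_norm, dist_eq_norm, Real.coe_toNNReal _ (by positivity)]
    refine ContinuousLinearMap.opNorm_le_bound _ (by positivity) fun x => ?_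
    have := (convex_closedBall c r).norm_image_sub_le_of_norm_deriv_le (f := fun z => f z x)
      (fun y hy => (hf x).differentiableAt (hU.mem_nhds (hsubU hy))) (hderiv x) hw hz
    calc ‖(f z - f w) x‖ = ‖f z x - f w x‖ := rfl
      _ ≤ C * ‖x‖ / r * ‖z - w‖ := this
      _ = C / r * ‖z - w‖ * ‖x‖ := by ring
  have hcont : ContinuousOn f (Metric.sphere c r) :=
    hlip.continuousOn.mono Metric.sphere_subset_closedBall
  have hci : CircleIntegrable f c r := hcont.circleIntegrable hr0.le
  have hps := hasFPowerSeriesOn_cauchy_integral (R := Real.toNNReal r) (f := f) (c := c)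
    (by rwa [Real.coe_toNNReal _ hr0.le]) (by simpa using hr0)
  rw [Real.coe_toNNReal _ hr0.le] at hps
  refine (hps.analyticAt.differentiableAt.congr_of_eventuallyEq ?_).differentiableWithinAt
  filter_upwards [Metric.ball_mem_nhds c hr0] with w hw
  refine ContinuousLinearMap.ext fun x => ?_
  have h1 := ((hf x).mono hsubU).diffContOnCl_ball
    (subset_rfl)|>.two_pi_i_inv_smul_circleIntegral_sub_inv_smul hw
  have hci' : CircleIntegrable (fun z => (z - w)⁻¹ • f z) c r := by
    refine ContinuousOn.circleIntegrable hr0.le ?_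
    have hsub : ContinuousOn (fun z : ℂ => z - w) (Metric.sphere c r) := by fun_prop
    refine ContinuousOn.smul (hsub.inv₀ fun z hz => ?_) hcont
    rw [sub_ne_zero]
    rintro rfl
    rw [Metric.mem_sphere] at hz
    rw [Metric.mem_ball] at hw
    linarith
  have h2 : (∮ z in C(c, r), (z - w)⁻¹ • f z) x = ∮ z in C(c, r), (z - w)⁻¹ • f z x := by
    have := ((ContinuousLinearMap.apply ℂ F x).intervalIntegral_comp_comm hci'.out)
    exact this.symm
  rw [smul_apply, h2, h1]

end StronglyHolomorphic

/-! ### Exponentials of bounded accretive operators -/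

section BoundedSemigroup

variable {H : Type*} [NormedAddCommGroup H] [InnerProductSpace ℂ H] [CompleteSpace H]

/-- The semigroup `exp(-z B)` generated by a bounded operator `-B`. -/
noncomputable def expSemigroup (B : H →L[ℂ] H) (z : ℂ) : H →L[ℂ] H := NormedSpace.exp ((-z) • B)

theorem expSemigroup_zero (B : H →L[ℂ] H) : expSemigroup B 0 = 1 := by
  simp [expSemigroup]

theorem expSemigroup_add (B : H →L[ℂ] H) (z w : ℂ) :
    expSemigroup B (z + w) = expSemigroup B z * expSemigroup B w := by
  let _ : NormedAlgebra ℚ (H →L[ℂ] H) := NormedAlgebra.restrictScalars ℚ ℂ (H →L[ℂ] H)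
  rw [expSemigroup, neg_add, add_smul, NormedSpace.exp_add_of_commute]
  · rfl
  · exact ((Commute.refl B).smul_left _).smul_right _

theorem Commute.expSemigroup_right {B C : H →L[ℂ] H} (h : Commute B C) (z : ℂ) :
    Commute B (expSemigroup C z) :=
  (h.smul_right _).exp_right

theorem expSemigroup_comm (B : H →L[ℂ] H) (z : ℂ) (x : H) :
    expSemigroup B z (B x) = B (expSemigroup B z x) := by
  have h := ((Commute.refl B).expSemigroup_right z).eq
  exact (DFunLike.congr_fun h x).symm

theorem hasDerivAt_expSemigroup (B : H →L[ℂ] H) (z : ℂ) :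
    HasDerivAt (expSemigroup B) (-(expSemigroup B z * B)) z := by
  have h := (hasDerivAt_exp_smul_const B (-z)).scomp z (hasDerivAt_neg z)
  rw [neg_one_smul] at h
  exact h

theorem hasDerivAt_expSemigroup_real (B : H →L[ℂ] H) (t : ℝ) :
    HasDerivAt (fun t : ℝ => expSemigroup B t) (-(expSemigroup B t * B)) t := by
  have h := (hasDerivAt_expSemigroup B t).scomp t Complex.ofRealCLM.hasDerivAt
  exact h.congr_deriv (by simp)

theorem hasDerivAt_expSemigroup_ofReal (B : H →L[ℂ] H) (x : H) (t : ℝ) :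
    HasDerivAt (fun t : ℝ => expSemigroup B t x) (-(expSemigroup B t (B x))) t := by
  have h1 := hasDerivAt_expSemigroup_real B t
  have h2 := (ContinuousLinearMap.apply ℂ H x).hasFDerivAt.restrictScalars ℝ |>.comp_hasDerivAt t h1
  exact h2

theorem continuous_expSemigroup (B : H →L[ℂ] H) : Continuous (expSemigroup B) :=
  continuous_iff_continuousAt.2 fun z => (hasDerivAt_expSemigroup B z).continuousAt

/-- The energy identity. Its sign gives contractivity, and its integral gives the square function
bound `lintegral_energy_le`. -/
theorem hasDerivAt_norm_sq_expSemigroup (B : H →L[ℂ] H) (x : H) (t : ℝ) :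
    HasDerivAt (fun t : ℝ => ‖expSemigroup B t x‖ ^ 2)
      (-(2 * (inner ℂ (expSemigroup B t x) (B (expSemigroup B t x))).re)) t := by
  have h := hasDerivAt_expSemigroup_ofReal B x t
  have h2 := (h.inner ℂ h)
  have h3 := Complex.reCLM.hasFDerivAt.comp_hasDerivAt t h2
  refine (h3.congr_deriv ?_).congr_of_eventuallyEq (Eventually.of_forall fun s => ?_)
  · have hs : (inner ℂ (B (expSemigroup B t x)) (expSemigroup B t x)).re
        = (inner ℂ (expSemigroup B t x) (B (expSemigroup B t x))).re :=
      inner_re_symm (𝕜 := ℂ) _ _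
    rw [expSemigroup_comm, inner_neg_left, inner_neg_right, Complex.reCLM_apply, Complex.add_re,
      Complex.neg_re, Complex.neg_re, hs]
    ring
  · exact (inner_self_eq_norm_sq (𝕜 := ℂ) (expSemigroup B s x)).symm

theorem norm_expSemigroup_ofReal_le {B : H →L[ℂ] H} (hB : ∀ x, 0 ≤ (inner ℂ x (B x)).re) {t : ℝ}
    (ht : 0 ≤ t) (x : H) : ‖expSemigroup B t x‖ ≤ ‖x‖ := by
  have hanti : Antitone fun t : ℝ => ‖expSemigroup B t x‖ ^ 2 :=
    antitone_of_hasDerivAt_nonpos (fun t => hasDerivAt_norm_sq_expSemigroup B x t) fun t => by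
      have := hB (expSemigroup B t x)
      simp only [Pi.zero_apply]
      linarith
  have := hanti ht
  simp only [Complex.ofReal_zero, expSemigroup_zero, one_apply_eq_self] at this
  exact (sq_le_sq₀ (norm_nonneg _) (norm_nonneg _)).1 this

theorem expSemigroup_smul (B : H →L[ℂ] H) (z w : ℂ) :
    expSemigroup (z • B) w = expSemigroup B (w * z) := by
  rw [expSemigroup, expSemigroup, smul_smul, neg_mul]

/-- Complex time `z` for `B` is real time `1` for `z • B`, which is accretive by hypothesis. -/
theorem norm_expSemigroup_le {B : H →L[ℂ] H} {z : ℂ}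
    (hB : ∀ x, 0 ≤ (z * inner ℂ x (B x)).re) : ‖expSemigroup B z‖ ≤ 1 := by
  refine ContinuousLinearMap.opNorm_le_bound _ zero_le_one fun x => ?_
  have := norm_expSemigroup_ofReal_le (B := z • B)
    (fun x => by rw [smul_apply, inner_smul_right]; exact hB x) zero_le_one x
  rw [expSemigroup_smul] at this
  simpa using this

/-- Exponentials of commuting accretive operators are compared through their generators. -/
theorem norm_expSemigroup_sub_le {B C : H →L[ℂ] H} (hBC : Commute B C) {z : ℂ}
    (hB : ∀ x, 0 ≤ (z * inner ℂ x (B x)).re) (hC : ∀ x, 0 ≤ (z * inner ℂ x (C x)).re) (x : H) :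
    ‖expSemigroup B z x - expSemigroup C z x‖ ≤ ‖z‖ * ‖B x - C x‖ := by
  set B' := z • B with hB'
  set C' := z • C with hC'
  have hcomm : Commute B' C' := (hBC.smul_left z).smul_right z
  -- The path `s ↦ exp(-s z B) exp(-(1 - s) z C)` joins the two exponentials. Because the operators
  -- commute, the difference of generators can be moved next to `x`, behind two contractions.
  have e1 : ∀ s : ℝ, HasDerivAt (fun s : ℝ => expSemigroup B' s * expSemigroup C' ((1 - s : ℝ) : ℂ))
      (expSemigroup B' s * expSemigroup C' ((1 - s : ℝ) : ℂ) * (C' - B')) s := by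
    intro s
    have h1 := hasDerivAt_expSemigroup_real B' s
    have h2 : HasDerivAt (fun s : ℝ => expSemigroup C' ((1 - s : ℝ) : ℂ))
        (expSemigroup C' ((1 - s : ℝ) : ℂ) * C') s := by
      have := (hasDerivAt_expSemigroup_real C' (1 - s)).scomp s ((hasDerivAt_id s).const_sub 1)
      exact this.congr_deriv (by simp)
    refine (h1.mul h2).congr_deriv ?_
    have h3 := (hcomm.expSemigroup_right ((1 - s : ℝ) : ℂ)).eq
    rw [mul_sub, neg_mul, mul_assoc _ B', h3, mul_assoc, mul_assoc, neg_add_eq_sub]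
  have h0 : ∀ w : ℂ, ∀ D : H →L[ℂ] H, expSemigroup (z • D) w = expSemigroup D (w * z) :=
    fun w D => expSemigroup_smul D z w
  have hb : ∀ s ∈ Ico (0 : ℝ) 1,
      ‖(expSemigroup B' s * expSemigroup C' ((1 - s : ℝ) : ℂ) * (C' - B')) x‖
        ≤ ‖z‖ * ‖B x - C x‖ := by
    intro s hs
    have hacc : ∀ {D : H →L[ℂ] H}, (∀ x, 0 ≤ (z * inner ℂ x (D x)).re) → ∀ s : ℝ, 0 ≤ s → ∀ y,
        ‖expSemigroup (z • D) s y‖ ≤ ‖y‖ := fun hD s hs y =>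
      norm_expSemigroup_ofReal_le
        (fun x => by rw [smul_apply, inner_smul_right]; exact hD x) hs y
    calc _ ≤ ‖expSemigroup C' ((1 - s : ℝ) : ℂ) ((C' - B') x)‖ := hacc hB s hs.1 _
      _ ≤ ‖(C' - B') x‖ := hacc hC _ (by linarith [hs.2]) _
      _ = ‖z‖ * ‖B x - C x‖ := by
        rw [hB', hC', ← smul_sub, smul_apply, norm_smul, sub_apply, norm_sub_rev]
  have key := norm_image_sub_le_of_norm_deriv_le_segment_01'
    (f := fun s : ℝ => (expSemigroup B' s * expSemigroup C' ((1 - s : ℝ) : ℂ)) x)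
    (fun s _ => (((ContinuousLinearMap.apply ℂ H x).hasFDerivAt.restrictScalars ℝ).comp_hasDerivAt s
      (e1 s)).hasDerivWithinAt) hb
  simpa [hB', hC', h0, expSemigroup_zero] using key

end BoundedSemigroup

/-! ### Yosida approximation -/

section Yosida

variable {H : Type*} [NormedAddCommGroup H] [InnerProductSpace ℂ H]

/-- Densely defined operators with numerical range in a sector of angle less than `π / 2` and with
`-1` in the resolvent set. -/
structure IsMSectorial (A : H →ₗ.[ℂ] H) (ω : ℝ) : Prop where
  angle_nonneg : 0 ≤ ω
  angle_lt : ω < Real.pi / 2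
  numericalRange_subset : numericalRange A ⊆ sector ω
  neg_one_mem : (-1 : ℂ) ∈ operatorResolventSet A

/-- The Yosida approximation `r - r² (A + r)⁻¹`, where `R = (A + r)⁻¹`. -/
noncomputable def yosida (r : ℝ) (R : H →L[ℂ] H) : H →L[ℂ] H := (r : ℂ) • 1 - ((r : ℂ) ^ 2) • R

theorem yosida_apply (r : ℝ) (R : H →L[ℂ] H) (x : H) :
    yosida r R x = (r : ℂ) • x - ((r : ℂ) ^ 2) • R x := rfl

variable {A : H →ₗ.[ℂ] H} {ω r : ℝ} {R : H →L[ℂ] H}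

theorem IsResolventAt.yosida_mem_graph (hR : IsResolventAt A (-(r : ℂ)) R) (x : H) :
    ((r : ℂ) • R x, yosida r R x) ∈ A.graph := by
  rw [hR.mem_graph_iff, yosida_apply]
  have : (r : ℂ) • x - (r : ℂ) ^ 2 • R x - -(r : ℂ) • (r : ℂ) • R x = (r : ℂ) • x := by module
  rw [this, map_smul]

theorem IsResolventAt.yosida_eq_of_mem_graph (hR : IsResolventAt A (-(r : ℂ)) R) {x y : H}
    (h : (x, y) ∈ A.graph) : yosida r R x = (r : ℂ) • R y := by
  rw [hR.mem_graph_iff, map_sub, map_smul] at h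
  rw [yosida_apply]
  nth_rw 1 [← h]
  module

theorem IsMSectorial.inner_mem (hA : IsMSectorial A ω) {x y : H} (h : (x, y) ∈ A.graph) :
    inner ℂ x y ∈ sector ω := by
  obtain ⟨w, rfl, rfl⟩ := (LinearPMap.mem_graph_iff _).1 h
  exact inner_mem_sector_of_numericalRange hA.angle_nonneg
    (by linarith [hA.angle_lt, Real.pi_pos]) hA.numericalRange_subset w

theorem re_nonneg_of_mem_sector {z : ℂ} (hω : ω ≤ Real.pi / 2) (hz : z ∈ sector ω) :
    0 ≤ z.re := by
  simpa using re_mul_nonneg_of_mem_sector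
    (one_mem_sector (θ := Real.pi / 2 - ω) (by linarith)) hz

theorem IsMSectorial.inner_re_nonneg (hA : IsMSectorial A ω) {x y : H} (h : (x, y) ∈ A.graph) :
    0 ≤ (inner ℂ x y).re :=
  re_nonneg_of_mem_sector hA.angle_lt.le (hA.inner_mem h)

/-- With `A_r` the Yosida approximation, `x = r R x + r⁻¹ A_r x` and `A_r x = A (r R x)`. Hence
`(A_r x, x)` is a value of the form of `A` plus `r⁻¹ ‖A_r x‖²`, and `Σ_ω` is a convex cone
containing both. -/
theorem IsMSectorial.inner_yosida_mem (hA : IsMSectorial A ω) (hr : 0 < r)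
    (hR : IsResolventAt A (-(r : ℂ)) R) (x : H) : inner ℂ x (yosida r R x) ∈ sector ω := by
  have h1 := hA.inner_mem (hR.yosida_mem_graph x)
  have h2 : x = (r : ℂ) • R x + ((r⁻¹ : ℝ) : ℂ) • yosida r R x := by
    have hr' : (r : ℂ) ≠ 0 := Complex.ofReal_ne_zero.2 hr.ne'
    rw [yosida_apply, smul_sub, smul_smul, smul_smul]
    push_cast
    rw [inv_mul_cancel₀ hr', pow_two, ← mul_assoc, inv_mul_cancel₀ hr', one_mul]
    module
  have h3 : inner ℂ x (yosida r R x) = inner ℂ ((r : ℂ) • R x) (yosida r R x)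
      + ((r⁻¹ * ‖yosida r R x‖ ^ 2 : ℝ) : ℂ) := by
    nth_rw 1 [h2]
    rw [inner_add_left, inner_smul_left (yosida r R x), inner_self_eq_norm_sq_to_K,
      Complex.conj_ofReal]
    push_cast; rfl
  rw [h3]
  exact sector_add_mem hA.angle_nonneg hA.angle_lt.le h1
    (ofReal_mem_sector hA.angle_nonneg (by positivity))

theorem IsMSectorial.norm_smul_resolvent_le (hA : IsMSectorial A ω) (hr : 0 < r)
    (hR : IsResolventAt A (-(r : ℂ)) R) : ‖(r : ℂ) • R‖ ≤ 1 := by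
  have := resolvent_norm_neg_le (fun x => hA.inner_re_nonneg (LinearPMap.mem_graph A x)) hr hR
  rw [norm_smul, Complex.norm_real, Real.norm_of_nonneg hr.le]
  calc r * ‖R‖ ≤ r * r⁻¹ := by gcongr
    _ = 1 := mul_inv_cancel₀ hr.ne'

theorem IsResolventAt.unique {B : H →ₗ.[ℂ] H} {z : ℂ} {R R' : H →L[ℂ] H}
    (hR : IsResolventAt B z R) (hR' : IsResolventAt B z R') : R = R' := by
  ext f
  obtain ⟨hd, he⟩ := hR'.right_inv f
  have := hR.left_inv ⟨_, hd⟩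
  rwa [he] at this

/-- The resolvent identity holds in both orders, and `z - z'` can be cancelled unless it vanishes;
in that case the resolvents coincide. -/
theorem IsResolventAt.commute {B : H →ₗ.[ℂ] H} {z z' : ℂ} {R R' : H →L[ℂ] H}
    (hR : IsResolventAt B z R) (hR' : IsResolventAt B z' R') : Commute R R' := by
  by_cases hz : z = z'
  · subst hz
    rw [hR.unique hR']
  have key : ∀ {z z' : ℂ} {R R' : H →L[ℂ] H}, IsResolventAt B z R → IsResolventAt B z' R' →
      ∀ y, R y = R' y + (z - z') • R (R' y) := by
    intro z z' R R' hR hR' y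
    obtain ⟨hd, he⟩ := hR'.right_inv y
    have h1 := hR.left_inv ⟨_, hd⟩
    have h2 : B ⟨R' y, hd⟩ - z • R' y = y - (z - z') • R' y := by
      rw [sub_eq_iff_eq_add] at he
      rw [he]; module
    rw [h2, map_sub, map_smul, sub_eq_iff_eq_add] at h1
    exact h1
  refine ContinuousLinearMap.ext fun y => ?_
  have h1 := key hR hR' y
  have h2 := key hR' hR y
  have hz0 : z - z' ≠ 0 := sub_ne_zero.2 hz
  refine smul_right_injective H hz0 ?_
  change (z - z') • R (R' y) = (z - z') • R' (R y)
  have h3 : (z - z') • R (R' y) = R y - R' y := by rw [h1]; module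
  have h4 : (z - z') • R' (R y) = R y - R' y := by
    have : (z - z') • R' (R y) = -((z' - z) • R' (R y)) := by module
    rw [this, neg_eq_iff_add_eq_zero]
    have h5 : (z' - z) • R' (R y) = R' y - R y := by
      rw [h2]; module
    rw [h5]; module
  rw [h3, h4]

theorem IsMSectorial.exists_resolvent_neg [CompleteSpace H] (hA : IsMSectorial A ω) (hr : 0 < r) :
    ∃ R, IsResolventAt A (-(r : ℂ)) R :=
  exists_resolvent_of_rotation (a := 1) hA.neg_one_mem
    (fun x => hA.inner_re_nonneg (LinearPMap.mem_graph A x)) (by simp) (by simp)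
    (fun x => by simpa using hA.inner_re_nonneg (LinearPMap.mem_graph A x)) (by simpa using hr)

/-- Density follows from accretivity and surjectivity of `A + 1`. If `y` is orthogonal to the domain
and `x = (A + 1)⁻¹ y`, then `0 = Re(y, x) = Re(A x, x) + ‖x‖²`, so `x = 0` and `y = 0`. -/
theorem IsMSectorial.dense_domain [CompleteSpace H] (hA : IsMSectorial A ω) :
    Dense (A.domain : Set H) := by
  rw [Submodule.dense_iff_topologicalClosure_eq_top, Submodule.topologicalClosure_eq_top_iff,
    Submodule.eq_bot_iff]
  intro y hy
  obtain ⟨R, hR⟩ := hA.neg_one_mem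
  obtain ⟨hd, he⟩ := hR.right_inv y
  have h1 : inner ℂ (R y) y = 0 := hy _ hd
  have h2 := hA.inner_re_nonneg (LinearPMap.mem_graph A ⟨R y, hd⟩)
  have h3 : y = A ⟨R y, hd⟩ + R y := by
    conv_lhs => rw [← he]
    module
  have h4 : (inner ℂ (R y) (A ⟨R y, hd⟩)).re + ‖R y‖ ^ 2 = 0 := by
    have h1' : inner ℂ (R y) (A ⟨R y, hd⟩ + R y) = 0 := by rw [← h3]; exact h1
    have := congrArg Complex.re h1'
    rw [inner_add_right, Complex.add_re, Complex.zero_re] at this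
    rw [← this]
    congr 1
    exact (inner_self_eq_norm_sq (𝕜 := ℂ) (R y)).symm
  have h5 : R y = 0 := by
    have : ‖R y‖ ^ 2 ≤ 0 := by
      change 0 ≤ (inner ℂ (R y) (A ⟨R y, hd⟩)).re at h2
      linarith
    simpa using le_antisymm this (sq_nonneg _)
  have h6 : A ⟨R y, hd⟩ = 0 := by
    have : (⟨R y, hd⟩ : A.domain) = 0 := Subtype.ext h5
    rw [this, LinearPMap.map_zero]
  rw [h3, h6, h5, add_zero]

/-- Uniform strong convergence of contractions extends from a dense set. -/
theorem tendstoUniformlyOn_of_dense {ι : Type*} {K : Set ι} {F : ℕ → ι → H →L[ℂ] H}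
    {G : ι → H →L[ℂ] H} (hF : ∀ n, ∀ z ∈ K, ‖F n z‖ ≤ 1) (hG : ∀ z ∈ K, ‖G z‖ ≤ 1) {D : Set H}
    (hD : Dense D)
    (h : ∀ x ∈ D, TendstoUniformlyOn (fun n z => F n z x) (fun z => G z x) atTop K) (x : H) :
    TendstoUniformlyOn (fun n z => F n z x) (fun z => G z x) atTop K := by
  rw [Metric.tendstoUniformlyOn_iff]
  intro ε hε
  obtain ⟨y, hy, hxy⟩ := Metric.dense_iff.1 hD x (ε / 3) (by positivity)
  rw [Metric.mem_ball, dist_comm, dist_eq_norm] at hy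
  filter_upwards [Metric.tendstoUniformlyOn_iff.1 (h y hxy) (ε / 3) (by positivity)] with n hn z hz
  have h1 := hn z hz
  rw [dist_eq_norm] at h1 ⊢
  have h2 : ‖G z (x - y)‖ ≤ ‖x - y‖ := by simpa using (G z).le_of_opNorm_le (hG z hz) (x - y)
  have h3 : ‖F n z (x - y)‖ ≤ ‖x - y‖ := by
    simpa using (F n z).le_of_opNorm_le (hF n z hz) (x - y)
  have h4 : G z x - F n z x = G z (x - y) + (G z y - F n z y) - F n z (x - y) := by
    rw [map_sub, map_sub]; abel
  rw [h4]
  linarith [norm_sub_le (G z (x - y) + (G z y - F n z y)) (F n z (x - y)),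
    norm_add_le (G z (x - y)) (G z y - F n z y)]

variable {Rn : ℕ → H →L[ℂ] H}

/-- For `x` in the domain, `x - r R x = R A x` has norm at most `‖A x‖ / r`. The `r R` are
contractions, so convergence extends by density. The shift `n + 1` keeps `r` positive. -/
theorem IsMSectorial.tendsto_smul_resolvent [CompleteSpace H] (hA : IsMSectorial A ω)
    (hR : ∀ n : ℕ, IsResolventAt A (-((n + 1 : ℝ) : ℂ)) (Rn n)) (x : H) :
    Tendsto (fun n : ℕ => ((n + 1 : ℝ) : ℂ) • Rn n x) atTop (𝓝 x) := by
  have hpos : ∀ n : ℕ, (0 : ℝ) < n + 1 := fun n => by positivity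
  have := tendstoUniformlyOn_of_dense (ι := Unit) (K := univ)
    (F := fun n _ => ((n + 1 : ℝ) : ℂ) • Rn n) (G := fun _ => 1)
    (fun n _ _ => hA.norm_smul_resolvent_le (hpos n) (hR n))
    (fun _ _ => ContinuousLinearMap.norm_id_le) hA.dense_domain (fun x hx => ?_) x
  · exact this.tendsto_at (mem_univ ())
  · set y := A ⟨x, hx⟩
    have hxy : (x, y) ∈ A.graph := LinearPMap.mem_graph A ⟨x, hx⟩
    rw [Metric.tendstoUniformlyOn_iff]
    intro ε hε
    have h0 : Tendsto (fun n : ℕ => 1 / ((n : ℝ) + 1) * ‖y‖) atTop (𝓝 (0 * ‖y‖)) :=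
      tendsto_one_div_add_atTop_nhds_zero_nat.mul_const _
    rw [zero_mul] at h0
    filter_upwards [h0.eventually (gt_mem_nhds hε)] with n hn _ _
    refine lt_of_le_of_lt ?_ hn
    have h1 : yosida (n + 1) (Rn n) x = ((n + 1 : ℝ) : ℂ) • (x - ((n + 1 : ℝ) : ℂ) • Rn n x) := by
      rw [yosida_apply]; module
    rw [(hR n).yosida_eq_of_mem_graph hxy] at h1
    have h2 := (((n + 1 : ℝ) : ℂ) • Rn n).le_of_opNorm_le
      (hA.norm_smul_resolvent_le (hpos n) (hR n)) y
    rw [smul_apply, h1, norm_smul, Complex.norm_real, Real.norm_of_nonneg (hpos n).le,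
      one_mul] at h2
    rw [dist_eq_norm, one_div_mul_eq_div, le_div_iff₀ (hpos n), mul_comm]
    exact h2

theorem IsMSectorial.tendsto_yosida [CompleteSpace H] (hA : IsMSectorial A ω)
    (hR : ∀ n : ℕ, IsResolventAt A (-((n + 1 : ℝ) : ℂ)) (Rn n)) {x y : H}
    (hxy : (x, y) ∈ A.graph) :
    Tendsto (fun n : ℕ => yosida (n + 1) (Rn n) x) atTop (𝓝 y) := by
  refine (hA.tendsto_smul_resolvent hR y).congr fun n => ?_
  rw [(hR n).yosida_eq_of_mem_graph hxy]

theorem IsResolventAt.commute_yosida {r s : ℝ} {R R' : H →L[ℂ] H}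
    (hR : IsResolventAt A (-(r : ℂ)) R) (hR' : IsResolventAt A (-(s : ℂ)) R') :
    Commute (yosida r R) (yosida s R') := by
  have h := hR.commute hR'
  unfold yosida
  refine Commute.sub_left (Commute.smul_left (Commute.one_left _) _) (Commute.smul_left ?_ _)
  exact Commute.sub_right (Commute.smul_right (Commute.one_right _) _) (Commute.smul_right h _)

end Yosida

/-! ### Generation of contraction semigroups -/

section Generation

variable {H : Type*} [NormedAddCommGroup H] [InnerProductSpace ℂ H]
  {A : H →ₗ.[ℂ] H} {ω : ℝ} {Rn : ℕ → H →L[ℂ] H}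

theorem IsMSectorial.re_mul_yosida_nonneg (hA : IsMSectorial A ω)
    (hR : ∀ n : ℕ, IsResolventAt A (-((n + 1 : ℝ) : ℂ)) (Rn n)) {z : ℂ}
    (hz : z ∈ sector (Real.pi / 2 - ω)) (n : ℕ) (x : H) :
    0 ≤ (z * inner ℂ x (yosida (n + 1) (Rn n) x)).re :=
  re_mul_nonneg_of_mem_sector hz (hA.inner_yosida_mem (by positivity) (hR n) x)

variable [CompleteSpace H]

/-- The semigroup generated by the negative of the `n`-th Yosida approximation. -/
noncomputable def yosidaSemigroup (Rn : ℕ → H →L[ℂ] H) (n : ℕ) (z : ℂ) : H →L[ℂ] H :=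
  expSemigroup (yosida (n + 1) (Rn n)) z

theorem IsMSectorial.norm_yosidaSemigroup_le (hA : IsMSectorial A ω)
    (hR : ∀ n : ℕ, IsResolventAt A (-((n + 1 : ℝ) : ℂ)) (Rn n)) {z : ℂ}
    (hz : z ∈ sector (Real.pi / 2 - ω)) (n : ℕ) : ‖yosidaSemigroup Rn n z‖ ≤ 1 :=
  norm_expSemigroup_le (hA.re_mul_yosida_nonneg hR hz n)

theorem IsMSectorial.cauchySeq_yosidaSemigroup (hA : IsMSectorial A ω)
    (hR : ∀ n : ℕ, IsResolventAt A (-((n + 1 : ℝ) : ℂ)) (Rn n)) {z : ℂ}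
    (hz : z ∈ sector (Real.pi / 2 - ω)) (x : H) :
    CauchySeq fun n => yosidaSemigroup Rn n z x := by
  rw [Metric.cauchySeq_iff]
  intro ε hε
  obtain ⟨w, hw, hwd⟩ := Metric.dense_iff.1 hA.dense_domain x (ε / 3) (by positivity)
  rw [Metric.mem_ball, dist_comm, dist_eq_norm] at hw
  have hY := (hA.tendsto_yosida hR (LinearPMap.mem_graph A ⟨w, hwd⟩)).cauchySeq
  -- On the domain the exponentials differ by at most `‖z‖` times the difference of the generators;
  -- adding `1` to `‖z‖` avoids dividing by zero.
  obtain ⟨N, hN⟩ := Metric.cauchySeq_iff.1 hY (ε / 3 / (‖z‖ + 1)) (by positivity)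
  refine ⟨N, fun m hm n hn => ?_⟩
  have h1 := hN m hm n hn
  rw [dist_eq_norm] at h1 ⊢
  have h2 : ‖yosidaSemigroup Rn m z w - yosidaSemigroup Rn n z w‖ ≤ ε / 3 := by
    refine (norm_expSemigroup_sub_le ((hR m).commute_yosida (hR n))
      (hA.re_mul_yosida_nonneg hR hz m) (hA.re_mul_yosida_nonneg hR hz n) w).trans ?_
    rw [lt_div_iff₀ (by positivity)] at h1
    nlinarith [norm_nonneg (yosida (m + 1) (Rn m) w - yosida (n + 1) (Rn n) w), norm_nonneg z]
  have h3 : ∀ k, ‖yosidaSemigroup Rn k z (x - w)‖ ≤ ‖x - w‖ := fun k => by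
    simpa using (yosidaSemigroup Rn k z).le_of_opNorm_le
      (hA.norm_yosidaSemigroup_le hR hz k) (x - w)
  have h4 : yosidaSemigroup Rn m z x - yosidaSemigroup Rn n z x
      = yosidaSemigroup Rn m z (x - w) + (yosidaSemigroup Rn m z w - yosidaSemigroup Rn n z w)
        - yosidaSemigroup Rn n z (x - w) := by rw [map_sub, map_sub]; abel
  rw [h4]
  linarith [norm_sub_le (yosidaSemigroup Rn m z (x - w) + (yosidaSemigroup Rn m z w -
    yosidaSemigroup Rn n z w)) (yosidaSemigroup Rn n z (x - w)), h3 m, h3 n,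
    norm_add_le (yosidaSemigroup Rn m z (x - w))
      (yosidaSemigroup Rn m z w - yosidaSemigroup Rn n z w)]

theorem IsMSectorial.exists_limit (hA : IsMSectorial A ω)
    (hR : ∀ n : ℕ, IsResolventAt A (-((n + 1 : ℝ) : ℂ)) (Rn n)) :
    ∃ S : ℂ → H →L[ℂ] H, ∀ z ∈ sector (Real.pi / 2 - ω), ∀ x,
      Tendsto (fun n => yosidaSemigroup Rn n z x) atTop (𝓝 (S z x)) := by
  have : ∀ z, ∃ T : H →L[ℂ] H, z ∈ sector (Real.pi / 2 - ω) → ∀ x,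
      Tendsto (fun n => yosidaSemigroup Rn n z x) atTop (𝓝 (T x)) := by
    intro z
    by_cases hz : z ∈ sector (Real.pi / 2 - ω)
    · choose f hf using fun x => cauchySeq_tendsto_of_complete
        (hA.cauchySeq_yosidaSemigroup hR hz x)
      exact ⟨continuousLinearMapOfTendsto (fun n => yosidaSemigroup Rn n z)
        (tendsto_pi_nhds.2 hf), fun _ => hf⟩
    -- Outside the sector there need be no limit, and the value `0` is immaterial.
    · exact ⟨0, fun h => (hz h).elim⟩
  choose S hS using this
  exact ⟨S, hS⟩

/-- `S` is the strong limit of the Yosida semigroups on the sector `Σ_{π/2 - ω}`. -/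
structure IsYosidaLimit (A : H →ₗ.[ℂ] H) (ω : ℝ) (Rn : ℕ → H →L[ℂ] H) (S : ℂ → H →L[ℂ] H) :
    Prop where
  sectorial : IsMSectorial A ω
  resolvent : ∀ n : ℕ, IsResolventAt A (-((n + 1 : ℝ) : ℂ)) (Rn n)
  tendsto : ∀ z ∈ sector (Real.pi / 2 - ω), ∀ x,
    Tendsto (fun n => yosidaSemigroup Rn n z x) atTop (𝓝 (S z x))

theorem IsMSectorial.exists_yosidaLimit (hA : IsMSectorial A ω) :
    ∃ Rn S, IsYosidaLimit A ω Rn S := by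
  choose Rn hR using fun n : ℕ => hA.exists_resolvent_neg (r := (n + 1 : ℝ)) (by positivity)
  obtain ⟨S, hS⟩ := hA.exists_limit hR
  exact ⟨Rn, S, hA, hR, hS⟩

namespace IsYosidaLimit

variable {S : ℂ → H →L[ℂ] H}

theorem norm_approx_le (h : IsYosidaLimit A ω Rn S) {z : ℂ} (hz : z ∈ sector (Real.pi / 2 - ω))
    (n : ℕ) (x : H) : ‖yosidaSemigroup Rn n z x‖ ≤ ‖x‖ := by
  simpa using (yosidaSemigroup Rn n z).le_of_opNorm_le
    (h.sectorial.norm_yosidaSemigroup_le h.resolvent hz n) x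

theorem norm_apply_le (h : IsYosidaLimit A ω Rn S) {z : ℂ} (hz : z ∈ sector (Real.pi / 2 - ω))
    (x : H) : ‖S z x‖ ≤ ‖x‖ :=
  le_of_tendsto (h.tendsto z hz x).norm (Eventually.of_forall fun n => h.norm_approx_le hz n x)

theorem norm_le (h : IsYosidaLimit A ω Rn S) {z : ℂ} (hz : z ∈ sector (Real.pi / 2 - ω)) :
    ‖S z‖ ≤ 1 :=
  ContinuousLinearMap.opNorm_le_bound _ zero_le_one fun x => by
    simpa using h.norm_apply_le hz x

theorem tendstoUniformlyOn (h : IsYosidaLimit A ω Rn S) (ρ : ℝ) (x : H) :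
    TendstoUniformlyOn (fun n z => yosidaSemigroup Rn n z x) (fun z => S z x) atTop
      (sector (Real.pi / 2 - ω) ∩ Metric.closedBall 0 ρ) := by
  refine tendstoUniformlyOn_of_dense
    (fun n z hz => h.sectorial.norm_yosidaSemigroup_le h.resolvent hz.1 n)
    (fun z hz => h.norm_le hz.1) h.sectorial.dense_domain (fun x hx => ?_) x
  set y := A ⟨x, hx⟩
  have hxy : (x, y) ∈ A.graph := LinearPMap.mem_graph A ⟨x, hx⟩
  have hY := h.sectorial.tendsto_yosida h.resolvent hxy
  -- Letting one index of the commuting comparison tend to infinity leaves an error that depends on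
  -- `z` only through its modulus.
  have hbound : ∀ n, ∀ z ∈ sector (Real.pi / 2 - ω) ∩ Metric.closedBall 0 ρ,
      ‖S z x - yosidaSemigroup Rn n z x‖ ≤ |ρ| * ‖y - yosida (n + 1) (Rn n) x‖ := by
    intro n z hz
    have hzρ : ‖z‖ ≤ |ρ| := (by simpa using hz.2 : ‖z‖ ≤ ρ).trans (le_abs_self ρ)
    refine le_of_tendsto_of_tendsto ((h.tendsto z hz.1 x).sub_const _).norm
      ((hY.sub_const (yosida (n + 1) (Rn n) x)).norm.const_mul |ρ|)
      (Eventually.of_forall fun m => ?_)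
    refine (norm_expSemigroup_sub_le ((h.resolvent m).commute_yosida (h.resolvent n))
      (h.sectorial.re_mul_yosida_nonneg h.resolvent hz.1 m)
      (h.sectorial.re_mul_yosida_nonneg h.resolvent hz.1 n) x).trans ?_
    exact mul_le_mul_of_nonneg_right hzρ (norm_nonneg _)
  rw [Metric.tendstoUniformlyOn_iff]
  intro ε hε
  have h0 : Tendsto (fun n : ℕ => |ρ| * ‖y - yosida (n + 1) (Rn n) x‖) atTop (𝓝 0) := by
    simpa using ((tendsto_const_nhds (x := y)).sub hY).norm.const_mul |ρ|
  filter_upwards [h0.eventually (gt_mem_nhds hε)] with n hn z hz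
  rw [dist_eq_norm]
  exact (hbound n z hz).trans_lt hn

theorem tendstoLocallyUniformlyOn (h : IsYosidaLimit A ω Rn S) (x : H) :
    TendstoLocallyUniformlyOn (fun n z => yosidaSemigroup Rn n z x) (fun z => S z x) atTop
      (sector (Real.pi / 2 - ω)) := by
  intro u hu z hz
  refine ⟨sector (Real.pi / 2 - ω) ∩ Metric.closedBall 0 (‖z‖ + 1), ?_,
    h.tendstoUniformlyOn (‖z‖ + 1) x u hu⟩
  refine inter_mem_nhdsWithin _ (Filter.mem_of_superset (Metric.closedBall_mem_nhds z one_pos) ?_)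
  intro w hw
  rw [Metric.mem_closedBall, dist_eq_norm] at hw
  rw [mem_closedBall_zero_iff]
  calc ‖w‖ = ‖z + (w - z)‖ := by congr 1; ring
    _ ≤ ‖z‖ + 1 := (norm_add_le _ _).trans (by linarith)

theorem continuousOn (h : IsYosidaLimit A ω Rn S) (x : H) :
    ContinuousOn (fun z => S z x) (sector (Real.pi / 2 - ω)) :=
  (h.tendstoLocallyUniformlyOn x).continuousOn (Frequently.of_forall fun n =>
    ((continuous_expSemigroup (yosida (n + 1) (Rn n))).clm_apply continuous_const).continuousOn)

theorem differentiableOn (h : IsYosidaLimit A ω Rn S) :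
    DifferentiableOn ℂ S (interior (sector (Real.pi / 2 - ω))) := by
  refine differentiableOn_of_strongly isOpen_interior
    (fun z hz => h.norm_le (interior_subset hz)) fun x => ?_
  refine ((h.tendstoLocallyUniformlyOn x).mono interior_subset).differentiableOn
    (Eventually.of_forall fun n z _ => ?_) isOpen_interior
  exact ((hasDerivAt_expSemigroup (yosida (n + 1) (Rn n)) z).differentiableAt.clm_apply
    (differentiableAt_const x)).differentiableWithinAt

theorem map_zero (h : IsYosidaLimit A ω Rn S) : S 0 = 1 := by
  refine ContinuousLinearMap.ext fun x => tendsto_nhds_unique (h.tendsto 0 (Or.inr rfl) x) ?_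
  simp [yosidaSemigroup, expSemigroup_zero]

theorem map_add (h : IsYosidaLimit A ω Rn S) {z w : ℂ} (hz : z ∈ sector (Real.pi / 2 - ω))
    (hw : w ∈ sector (Real.pi / 2 - ω)) : S (z + w) = S z * S w := by
  refine ContinuousLinearMap.ext fun x => ?_
  have hω := h.sectorial.angle_lt
  have hω0 := h.sectorial.angle_nonneg
  refine tendsto_nhds_unique (h.tendsto (z + w)
    (sector_add_mem (by linarith) (by linarith) hz hw) x) ?_
  have h1 : Tendsto (fun n => yosidaSemigroup Rn n z (yosidaSemigroup Rn n w x - S w x)) atTop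
      (𝓝 0) := by
    refine squeeze_zero_norm (fun n => h.norm_approx_le hz n _) ?_
    simpa using ((h.tendsto w hw x).sub_const (S w x)).norm
  have h2 := h1.add (h.tendsto z hz (S w x))
  rw [zero_add] at h2
  refine h2.congr fun n => ?_
  rw [← _root_.map_add, sub_add_cancel]
  exact (DFunLike.congr_fun (expSemigroup_add (yosida (n + 1) (Rn n)) z w) x).symm

theorem ofReal_mem (h : IsYosidaLimit A ω Rn S) {t : ℝ} (ht : 0 ≤ t) :
    (t : ℂ) ∈ sector (Real.pi / 2 - ω) :=
  ofReal_mem_sector (by linarith [h.sectorial.angle_lt]) ht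

theorem continuousOn_real (h : IsYosidaLimit A ω Rn S) (x : H) :
    ContinuousOn (fun t : ℝ => S t x) (Ici 0) :=
  (h.continuousOn x).comp Complex.continuous_ofReal.continuousOn fun _ ht => h.ofReal_mem ht

theorem isHolomorphicContractionSemigroup (h : IsYosidaLimit A ω Rn S) :
    IsHolomorphicContractionSemigroup (fun t : ℝ => S t) S (Real.pi / 2 - ω) where
  isSemigroup :=
    { zero := by simpa using h.map_zero
      add := fun s t hs ht => by
        rw [Complex.ofReal_add]
        exact h.map_add (h.ofReal_mem hs) (h.ofReal_mem ht)
      continuous := h.continuousOn_real }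
  angle_pos := by linarith [h.sectorial.angle_lt]
  extends_real _ _ := rfl
  holomorphic := h.differentiableOn
  locally_bounded θ _ hθ := ⟨1, fun _ hz _ => h.norm_le (sector_mono hθ.le hz)⟩
  contraction _ hz := h.norm_le hz
  add_sector _ hz _ hw := h.map_add hz hw
  continuous_sector := h.continuousOn

/-- The identity holds for each `A_n` and passes to the limit by dominated convergence: `A_n x`
converges, hence is bounded, and the exponentials are contractions. -/
theorem sub_eq_integral (h : IsYosidaLimit A ω Rn S) {x y : H} (hxy : (x, y) ∈ A.graph) {t : ℝ}
    (ht : 0 ≤ t) : S t x - x = -∫ s in (0 : ℝ)..t, S s y := by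
  have hY := h.sectorial.tendsto_yosida h.resolvent hxy
  have hn : ∀ n, yosidaSemigroup Rn n t x - x
      = -∫ s in (0 : ℝ)..t, yosidaSemigroup Rn n s (yosida (n + 1) (Rn n) x) := by
    intro n
    have hc : Continuous fun s : ℝ => -(yosidaSemigroup Rn n s (yosida (n + 1) (Rn n) x)) :=
      (((continuous_expSemigroup _).comp Complex.continuous_ofReal).clm_apply
        continuous_const).neg
    have := intervalIntegral.integral_eq_sub_of_hasDerivAt
      (fun s _ => hasDerivAt_expSemigroup_ofReal (yosida (n + 1) (Rn n)) x s)
      (hc.intervalIntegrable 0 t)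
    rw [Complex.ofReal_zero, expSemigroup_zero, one_apply_eq_self,
      intervalIntegral.integral_neg] at this
    exact this.symm
  have h1 : Tendsto (fun n => yosidaSemigroup Rn n t x - x) atTop (𝓝 (S t x - x)) :=
    (h.tendsto t (h.ofReal_mem ht) x).sub_const x
  refine tendsto_nhds_unique h1 ?_
  simp_rw [hn]
  refine Tendsto.neg ?_
  obtain ⟨C, hC⟩ := hY.norm.bddAbove_range
  refine intervalIntegral.tendsto_integral_filter_of_dominated_convergence (fun _ => C) ?_ ?_ ?_ ?_
  · refine Eventually.of_forall fun n => Continuous.aestronglyMeasurable ?_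
    exact ((continuous_expSemigroup _).comp Complex.continuous_ofReal).clm_apply continuous_const
  · refine Eventually.of_forall fun n => Eventually.of_forall fun s hs => ?_
    rw [uIoc_of_le ht] at hs
    exact (h.norm_approx_le (h.ofReal_mem hs.1.le) n _).trans (hC ⟨n, rfl⟩)
  · exact intervalIntegrable_const
  · refine Eventually.of_forall fun s hs => ?_
    rw [uIoc_of_le ht] at hs
    have hs' := h.ofReal_mem hs.1.le
    have h2 : Tendsto (fun n => yosidaSemigroup Rn n s (yosida (n + 1) (Rn n) x - y)) atTop
        (𝓝 0) := by
      refine squeeze_zero_norm (fun n => h.norm_approx_le hs' n _) ?_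
      simpa using (hY.sub_const y).norm
    have h3 := h2.add (h.tendsto s hs' y)
    rw [zero_add] at h3
    refine h3.congr fun n => ?_
    rw [← _root_.map_add, sub_add_cancel]

theorem tendsto_quotient (h : IsYosidaLimit A ω Rn S) {x y : H} (hxy : (x, y) ∈ A.graph) :
    Tendsto (fun t : ℝ => ((t : ℂ)⁻¹) • (S t x - x)) (𝓝[>] 0) (𝓝 (-y)) := by
  have hcont := h.continuousOn_real y
  have hd : HasDerivWithinAt (fun t => ∫ s in (0 : ℝ)..t, S s y) (S ((0 : ℝ) : ℂ) y) (Ici 0) 0 := by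
    refine intervalIntegral.integral_hasDerivWithinAt_right (t := Ioi 0)
      (by simp) ?_ ?_
    · exact ⟨Ioi 0, self_mem_nhdsWithin,
        (hcont.mono Ioi_subset_Ici_self).aestronglyMeasurable measurableSet_Ioi⟩
    · exact (hcont 0 self_mem_Ici).mono Ioi_subset_Ici_self
  rw [Complex.ofReal_zero, h.map_zero, one_apply_eq_self] at hd
  have h1 := (hasDerivWithinAt_iff_tendsto_slope' (by simp)).1 (hd.mono Ioi_subset_Ici_self)
  refine h1.neg.congr' ?_
  filter_upwards [self_mem_nhdsWithin] with t ht
  rw [h.sub_eq_integral hxy (le_of_lt ht), slope_def_module, intervalIntegral.integral_same,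
    sub_zero, sub_zero, smul_neg, ← Complex.ofReal_inv, Complex.coe_smul]

/-- The generator extends `-A` and is dissipative because the semigroup is contractive. As `A + 1`
is already onto, the extension cannot be proper. -/
theorem isGeneratorOf (h : IsYosidaLimit A ω Rn S) : IsGeneratorOf (-A) (fun t : ℝ => S t) := by
  have hgr : ∀ x y, (x, y) ∈ (-A).graph ↔ (x, -y) ∈ A.graph := by
    intro x y
    rw [LinearPMap.mem_graph_iff, LinearPMap.mem_graph_iff]
    constructor
    · rintro ⟨w, hw, hy⟩
      refine ⟨w, hw, ?_⟩
      change A w = -y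
      change (-A) w = y at hy
      rw [← hy, LinearPMap.neg_apply, neg_neg]
    · rintro ⟨w, hw, hy⟩
      refine ⟨w, hw, ?_⟩
      change A w = -y at hy
      change (-A) w = y
      rw [LinearPMap.neg_apply, hy, neg_neg]
  intro x y
  rw [hgr]
  refine ⟨fun hxy => by simpa using h.tendsto_quotient hxy, fun hlim => ?_⟩
  obtain ⟨R, hR⟩ := h.sectorial.neg_one_mem
  obtain ⟨hd, he⟩ := hR.right_inv (x - y)
  -- If `y` is the generator's value at `x`, then `u` solves `(A + 1)u = x - y`. The generator maps
  -- `x - u` to itself, and dissipativity forces `x - u = 0`.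
  set u := R (x - y) with hu
  have huv : (u, x - y - u) ∈ A.graph := by
    refine (LinearPMap.mem_graph_iff _).2 ⟨⟨u, hd⟩, rfl, ?_⟩
    change A ⟨u, hd⟩ = x - y - u
    rw [sub_eq_iff_eq_add] at he
    rw [he]; module
  have h1 := hlim.sub (h.tendsto_quotient huv)
  have h2 : y - -(x - y - u) = x - u := by abel
  rw [h2] at h1
  have h3 : Tendsto (fun t : ℝ => (inner ℂ (x - u) (((t : ℂ)⁻¹) • (S t (x - u) - (x - u)))).re)
      (𝓝[>] 0) (𝓝 (inner ℂ (x - u) (x - u)).re) := by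
    refine (Complex.continuous_re.tendsto _).comp (Tendsto.inner tendsto_const_nhds (h1.congr ?_))
    intro t
    rw [map_sub]
    module
  have h4 : (inner ℂ (x - u) (x - u)).re ≤ 0 := by
    refine le_of_tendsto h3 ?_
    filter_upwards [self_mem_nhdsWithin] with t ht
    have ht0 : (0 : ℝ) < t := ht
    rw [inner_smul_right, ← Complex.ofReal_inv, Complex.re_ofReal_mul, inner_sub_right,
      Complex.sub_re]
    refine mul_nonpos_of_nonneg_of_nonpos (by positivity) ?_
    have e1 : (inner ℂ (x - u) (x - u)).re = ‖x - u‖ ^ 2 := inner_self_eq_norm_sq (𝕜 := ℂ) _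
    have e2 : (inner ℂ (x - u) (S t (x - u))).re ≤ ‖x - u‖ * ‖S t (x - u)‖ :=
      (Complex.re_le_norm _).trans (norm_inner_le_norm _ _)
    have e3 := h.norm_apply_le (h.ofReal_mem ht0.le) (x - u)
    rw [e1]
    nlinarith [norm_nonneg (x - u)]
  have h5 : x - u = 0 := by
    have e1 : (inner ℂ (x - u) (x - u)).re = ‖x - u‖ ^ 2 := inner_self_eq_norm_sq (𝕜 := ℂ) _
    rw [e1] at h4
    simpa using le_antisymm h4 (sq_nonneg _)
  have h6 : u = x := (sub_eq_zero.1 h5).symm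
  rw [h6] at huv
  simpa using huv

end IsYosidaLimit

end Generation

/-! ### The Hardy--Littlewood maximal function on the line -/

section MaximalFunction

/-- Layer cake formula for powers of extended nonnegative numbers. -/
theorem ENNReal.rpow_eq_lintegral_indicator {p : ℝ} (hp : 0 < p) (a : ℝ≥0∞) :
    ∫⁻ l in Ioi (0 : ℝ), {l : ℝ | ENNReal.ofReal l < a}.indicator
      (fun l => ENNReal.ofReal (l ^ (p - 1))) l = a ^ p / ENNReal.ofReal p := by
  have hfin : ∀ b : ℝ, 0 ≤ b → ∫⁻ l in Ioo (0 : ℝ) b, ENNReal.ofReal (l ^ (p - 1))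
      = ENNReal.ofReal b ^ p / ENNReal.ofReal p := by
    intro b hb
    have hint : IntervalIntegrable (fun l : ℝ => l ^ (p - 1)) volume 0 b :=
      intervalIntegral.intervalIntegrable_rpow' (by linarith)
    rw [← ofReal_integral_eq_lintegral_ofReal, ← integral_Ioc_eq_integral_Ioo,
      ← intervalIntegral.integral_of_le hb, integral_rpow (Or.inl (by linarith)),
      sub_add_cancel, Real.zero_rpow hp.ne', sub_zero, ENNReal.ofReal_div_of_pos hp,
      ENNReal.ofReal_rpow_of_nonneg hb hp.le]
    · exact ((intervalIntegrable_iff_integrableOn_Ioc_of_le hb).1 hint).mono_set Ioo_subset_Ioc_self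
    · filter_upwards [ae_restrict_mem measurableSet_Ioo] with l hl
      exact Real.rpow_nonneg hl.1.le _
  have hmeas : MeasurableSet {l : ℝ | ENNReal.ofReal l < a} :=
    measurableSet_lt ENNReal.measurable_ofReal measurable_const
  rw [lintegral_indicator hmeas, Measure.restrict_restrict hmeas]
  by_cases ha : a = ∞
  · subst ha
    rw [ENNReal.top_rpow_of_pos hp, ENNReal.top_div_of_ne_top ENNReal.ofReal_ne_top, eq_top_iff]
    have hlim : Tendsto (fun n : ℕ => ENNReal.ofReal n ^ p / ENNReal.ofReal p) atTop (𝓝 ∞) := by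
      have h1 : Tendsto (fun n : ℕ => ((n : ℝ) ^ p) / p) atTop atTop :=
        ((tendsto_rpow_atTop hp).comp tendsto_natCast_atTop_atTop).atTop_div_const hp
      refine (ENNReal.tendsto_ofReal_atTop.comp h1).congr fun n => ?_
      rw [Function.comp_apply, ENNReal.ofReal_div_of_pos hp,
        ENNReal.ofReal_rpow_of_nonneg (Nat.cast_nonneg n) hp.le]
    refine le_of_tendsto hlim (Eventually.of_forall fun n => ?_)
    rw [← hfin n (Nat.cast_nonneg n)]
    refine lintegral_mono_set fun l hl => ⟨ENNReal.ofReal_lt_top, hl.1⟩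
  · rw [← ENNReal.ofReal_toReal ha, ← hfin _ ENNReal.toReal_nonneg, ENNReal.ofReal_toReal ha]
    congr 2
    ext l
    simp only [mem_inter_iff, mem_Ioi, mem_Ioo]
    constructor
    · rintro ⟨h1, h2⟩
      exact ⟨h2, (ENNReal.ofReal_lt_iff_lt_toReal h2.le ha).1 h1⟩
    · rintro ⟨h1, h2⟩
      exact ⟨(ENNReal.ofReal_lt_iff_lt_toReal h1.le ha).2 h2, h1⟩

theorem ENNReal.eq_lintegral_indicator (a : ℝ≥0∞) :
    a = ∫⁻ l in Ioi (0 : ℝ), {l : ℝ | ENNReal.ofReal l < a}.indicator 1 l := by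
  have h := ENNReal.rpow_eq_lintegral_indicator one_pos a
  rw [ENNReal.rpow_one, ENNReal.ofReal_one, div_one] at h
  refine h.symm.trans (lintegral_congr fun l => ?_)
  simp [Pi.one_def]

/-- The centred maximal function over dyadic radii. -/
noncomputable def maximalFunction (w : ℝ → ℝ≥0∞) (s : ℝ) : ℝ≥0∞ :=
  ⨆ k : ℤ, (∫⁻ r in Metric.closedBall s (2 ^ k), w r) / ENNReal.ofReal (2 * 2 ^ k)

theorem measurable_maximalFunction {w : ℝ → ℝ≥0∞} (hw : Measurable w) :
    Measurable (maximalFunction w) := by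
  refine Measurable.iSup fun k => Measurable.div_const ?_ _
  have hset : MeasurableSet {q : ℝ × ℝ | dist q.2 q.1 ≤ 2 ^ k} :=
    measurableSet_le (by fun_prop) measurable_const
  have h : Measurable fun q : ℝ × ℝ =>
      {q : ℝ × ℝ | dist q.2 q.1 ≤ 2 ^ k}.indicator (fun q => w q.2) q :=
    (hw.comp measurable_snd).indicator hset
  have h2 : (fun s => ∫⁻ r in Metric.closedBall s (2 ^ k), w r) = fun s => ∫⁻ r,
      {q : ℝ × ℝ | dist q.2 q.1 ≤ 2 ^ k}.indicator (fun q => w q.2) (s, r) := by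
    ext s
    rw [← lintegral_indicator Metric.isClosed_closedBall.measurableSet]
    rfl
  rw [h2]
  exact h.lintegral_prod_right'

/-- Rounding the radius up to a power of two at most doubles it. This is the price of a countable
supremum, which makes the maximal function measurable. -/
theorem lintegral_closedBall_le_maximalFunction (w : ℝ → ℝ≥0∞) (s : ℝ) {ρ : ℝ} (hρ : 0 < ρ) :
    ∫⁻ r in Metric.closedBall s ρ, w r ≤ ENNReal.ofReal ρ * (4 * maximalFunction w s) := by
  obtain ⟨k, hk1, hk2⟩ := exists_mem_Ioc_zpow (y := (2 : ℝ)) hρ (by norm_num)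
  have h1 : (2 : ℝ) ^ (k + 1) < 2 * ρ := by
    rw [zpow_add_one₀ (by norm_num)]; linarith
  have h2 : (∫⁻ r in Metric.closedBall s (2 ^ (k + 1)), w r) / ENNReal.ofReal (2 * 2 ^ (k + 1))
      ≤ maximalFunction w s :=
    le_iSup (fun k : ℤ => (∫⁻ r in Metric.closedBall s (2 ^ k), w r)
      / ENNReal.ofReal (2 * 2 ^ k)) (k + 1)
  have hpos : 0 < 2 * (2 : ℝ) ^ (k + 1) := by positivity
  rw [ENNReal.div_le_iff_le_mul (Or.inl (ENNReal.ofReal_pos.2 hpos).ne')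
    (Or.inl ENNReal.ofReal_ne_top)] at h2
  calc ∫⁻ r in Metric.closedBall s ρ, w r
      ≤ ∫⁻ r in Metric.closedBall s (2 ^ (k + 1)), w r :=
        lintegral_mono_set (Metric.closedBall_subset_closedBall hk2)
    _ ≤ maximalFunction w s * ENNReal.ofReal (2 * 2 ^ (k + 1)) := h2
    _ ≤ maximalFunction w s * ENNReal.ofReal (4 * ρ) := by
        exact mul_le_mul_right (ENNReal.ofReal_le_ofReal (by linarith)) _
    _ = _ := by
        rw [ENNReal.ofReal_mul (by norm_num), ENNReal.ofReal_ofNat]; ring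

/-- The weak type `(1, 1)` inequality. -/
theorem maximalFunction_weak_type {w : ℝ → ℝ≥0∞} {l : ℝ≥0∞} (hl0 : l ≠ 0) (hl : l ≠ ∞) :
    l * volume {s | l < maximalFunction w s} ≤ 5 * ∫⁻ r, w r := by
  by_cases hw : ∫⁻ r, w r = ∞
  · rw [hw, ENNReal.mul_top (by norm_num)]; exact le_top
  set t := {s | l < maximalFunction w s} with ht
  have hex : ∀ s ∈ t, ∃ k : ℤ, l * ENNReal.ofReal (2 * 2 ^ k)
      < ∫⁻ r in Metric.closedBall s (2 ^ k), w r := by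
    intro s hs
    obtain ⟨k, hk⟩ := lt_iSup_iff.1 (show l < maximalFunction w s from hs)
    refine ⟨k, ?_⟩
    rwa [ENNReal.lt_div_iff_mul_lt (Or.inl (ENNReal.ofReal_pos.2 (by positivity)).ne')
      (Or.inl ENNReal.ofReal_ne_top)] at hk
  choose! k hk using hex
  -- Vitali's covering lemma with enlargement factor `5`. The radii are bounded because each ball
  -- carries mass at least `l` times its length and the total mass is finite.
  obtain ⟨u, hut, hdisj, hcov⟩ := Vitali.exists_disjoint_subfamily_covering_enlargement_closedBall
    t id (fun s => (2 : ℝ) ^ k s) ((∫⁻ r, w r) / l).toReal (fun s hs => by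
      have h1 := (hk s hs).le.trans (setLIntegral_le_lintegral _ _)
      rw [mul_comm, ← ENNReal.le_div_iff_mul_le (Or.inl hl0) (Or.inl hl)] at h1
      have h2 := (ENNReal.ofReal_le_iff_le_toReal (ENNReal.div_lt_top hw hl0).ne).1 h1
      have h3 : (0 : ℝ) < 2 ^ k s := by positivity
      linarith) 5 (by norm_num)
  have hucount : u.Countable := by
    refine hdisj.countable_of_nonempty_interior fun s _ => ?_
    refine ⟨s, Metric.ball_subset_interior_closedBall (Metric.mem_ball_self (by positivity))⟩
  have hsub : t ⊆ ⋃ b ∈ u, Metric.closedBall b (5 * 2 ^ k b) := by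
    intro s hs
    obtain ⟨b, hb, hsb⟩ := hcov s hs
    exact mem_biUnion hb (hsb (Metric.mem_closedBall_self (by positivity)))
  calc l * volume t ≤ l * ∑' b : u, volume (Metric.closedBall (b : ℝ) (5 * 2 ^ k b)) := by
        gcongr
        exact (measure_mono hsub).trans (measure_biUnion_le _ hucount _)
    _ = ∑' b : u, l * volume (Metric.closedBall (b : ℝ) (5 * 2 ^ k b)) := ENNReal.tsum_mul_left.symm
    _ ≤ ∑' b : u, 5 * ∫⁻ r in Metric.closedBall (b : ℝ) (2 ^ k b), w r := by
        refine ENNReal.tsum_le_tsum fun b => ?_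
        rw [Real.volume_closedBall, show 2 * (5 * (2 : ℝ) ^ k b) = 5 * (2 * 2 ^ k b) by ring,
          ENNReal.ofReal_mul (by norm_num), ENNReal.ofReal_ofNat, mul_left_comm]
        gcongr
        exact (hk b (hut b.2)).le
    _ = 5 * ∑' b : u, ∫⁻ r in Metric.closedBall (b : ℝ) (2 ^ k b), w r := ENNReal.tsum_mul_left
    _ = 5 * ∫⁻ r in ⋃ b ∈ u, Metric.closedBall b (2 ^ k b), w r := by
        congr 1
        exact (lintegral_biUnion hucount
          (fun _ _ => Metric.isClosed_closedBall.measurableSet) hdisj _).symm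
    _ ≤ 5 * ∫⁻ r, w r := by
        gcongr
        exact Measure.restrict_le_self

theorem maximalFunction_le_add {w w₁ : ℝ → ℝ≥0∞} {c : ℝ≥0∞} (h : ∀ r, w r ≤ w₁ r + c) (s : ℝ) :
    maximalFunction w s ≤ maximalFunction w₁ s + c := by
  refine iSup_le fun k => ?_
  have hpos : (0 : ℝ) < 2 * 2 ^ k := by positivity
  have h1 : ∫⁻ r in Metric.closedBall s (2 ^ k), w r
      ≤ (∫⁻ r in Metric.closedBall s (2 ^ k), w₁ r) + c * ENNReal.ofReal (2 * 2 ^ k) := by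
    calc _ ≤ ∫⁻ r in Metric.closedBall s (2 ^ k), (w₁ r + c) := lintegral_mono h
      _ = _ := by
        rw [lintegral_add_right _ measurable_const, setLIntegral_const, Real.volume_closedBall]
  calc _ ≤ ((∫⁻ r in Metric.closedBall s (2 ^ k), w₁ r) + c * ENNReal.ofReal (2 * 2 ^ k))
        / ENNReal.ofReal (2 * 2 ^ k) := by gcongr
    _ = (∫⁻ r in Metric.closedBall s (2 ^ k), w₁ r) / ENNReal.ofReal (2 * 2 ^ k) + c := by
        rw [ENNReal.add_div, ENNReal.mul_div_cancel_right (ENNReal.ofReal_pos.2 hpos).ne'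
          ENNReal.ofReal_ne_top]
    _ ≤ _ := by
        gcongr
        exact le_iSup (fun k : ℤ => (∫⁻ r in Metric.closedBall s (2 ^ k), w₁ r)
          / ENNReal.ofReal (2 * 2 ^ k)) k

/-- Truncation: the part of `w` below `l/2` contributes at most `l/2` to the maximal function, so
only the part above counts at level `l/2`. The weak type constant `5` doubles to `10`. -/
theorem maximalFunction_level_le (w : ℝ → ℝ≥0∞) {l : ℝ} (hl : 0 < l) :
    ENNReal.ofReal l * volume {s | ENNReal.ofReal l < maximalFunction w s} ≤
      10 * ∫⁻ r, {r | ENNReal.ofReal l < 2 * w r}.indicator w r := by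
  set w₁ := {r | ENNReal.ofReal l < 2 * w r}.indicator w with hw₁
  have hl2 : ENNReal.ofReal l = 2 * ENNReal.ofReal (l / 2) := by
    rw [← ENNReal.ofReal_ofNat, ← ENNReal.ofReal_mul (by norm_num)]; congr 1; ring
  have hle : ∀ r, w r ≤ w₁ r + ENNReal.ofReal (l / 2) := by
    intro r
    by_cases hr : ENNReal.ofReal l < 2 * w r
    · rw [hw₁, indicator_of_mem (by exact hr)]; exact le_self_add
    · rw [hw₁, indicator_of_notMem (by exact hr), zero_add]
      rw [hl2, not_lt] at hr
      exact (ENNReal.mul_le_mul_iff_right (by norm_num) (by norm_num)).1 hr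
  have hsub : {s | ENNReal.ofReal l < maximalFunction w s}
      ⊆ {s | ENNReal.ofReal (l / 2) < maximalFunction w₁ s} := by
    intro s hs
    have h1 : ENNReal.ofReal l < _ := hs
    have h2 := h1.trans_le (maximalFunction_le_add hle s)
    rw [hl2, two_mul] at h2
    exact lt_of_add_lt_add_right h2
  calc _ ≤ ENNReal.ofReal l * volume {s | ENNReal.ofReal (l / 2) < maximalFunction w₁ s} := by
        gcongr
    _ = 2 * (ENNReal.ofReal (l / 2)
          * volume {s | ENNReal.ofReal (l / 2) < maximalFunction w₁ s}) := by
        rw [hl2, mul_assoc]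
    _ ≤ 2 * (5 * ∫⁻ r, w₁ r) := by
        refine mul_le_mul_right ?_ _
        exact maximalFunction_weak_type (ENNReal.ofReal_pos.2 (by positivity)).ne'
          ENNReal.ofReal_ne_top
    _ = _ := by rw [← mul_assoc]; norm_num

/-- The Hardy--Littlewood maximal inequality in `L^p`, `p > 1`. -/
theorem maximalFunction_strong_type {p : ℝ} (hp : 1 < p) :
    ∃ C : ℝ≥0∞, C ≠ ∞ ∧ ∀ w : ℝ → ℝ≥0∞, Measurable w →
      ∫⁻ s, maximalFunction w s ^ p ≤ C * ∫⁻ s, w s ^ p := by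
  have hp0 : 0 < p := by linarith
  have hp1 : 0 < p - 1 := by linarith
  set c := ENNReal.ofReal p with hc
  set c' := ENNReal.ofReal (p - 1) with hc'
  have hc0 : c ≠ 0 := (ENNReal.ofReal_pos.2 hp0).ne'
  have hc1 : c ≠ ∞ := ENNReal.ofReal_ne_top
  have hc'0 : c' ≠ 0 := (ENNReal.ofReal_pos.2 hp1).ne'
  refine ⟨c * (10 * (2 ^ (p - 1) / c')), ?_, fun w hw => ?_⟩
  · have : (2 : ℝ≥0∞) ^ (p - 1) ≠ ∞ := ENNReal.rpow_ne_top_of_nonneg hp1.le (by norm_num)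
    exact ENNReal.mul_ne_top hc1 (ENNReal.mul_ne_top (by norm_num) (ENNReal.div_ne_top this hc'0))
  have hM := measurable_maximalFunction hw
  have hmeas1 : Measurable fun q : ℝ × ℝ => {q : ℝ × ℝ | ENNReal.ofReal q.2
      < maximalFunction w q.1}.indicator (fun q => ENNReal.ofReal (q.2 ^ (p - 1))) q := by
    refine Measurable.indicator (by fun_prop) (measurableSet_lt (by fun_prop) ?_)
    exact hM.comp measurable_fst
  have hmeas2 : Measurable fun q : ℝ × ℝ => {q : ℝ × ℝ | ENNReal.ofReal q.1
      < 2 * w q.2}.indicator (fun q => ENNReal.ofReal (q.1 ^ (p - 1 - 1)) * w q.2) q := by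
    refine Measurable.indicator ?_ (measurableSet_lt (by fun_prop) ?_)
    · exact Measurable.mul (by fun_prop) (hw.comp measurable_snd)
    · exact (hw.comp measurable_snd).const_mul 2
  have hdiv : ∫⁻ s, maximalFunction w s ^ p = c * ∫⁻ s, maximalFunction w s ^ p / c := by
    rw [← lintegral_const_mul _ ((hM.pow_const p).div_const c)]
    refine lintegral_congr fun s => ?_
    rw [ENNReal.mul_div_cancel hc0 hc1]
  rw [hdiv, mul_assoc c]
  gcongr
  -- Layer cake, Tonelli, the truncated weak type bound at each level, and Tonelli back. The last
  -- inner integral is `∫₀^{2w} l^{p-2} dl = (2w)^{p-1}/(p-1)`, finite because `p > 1`.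
  calc ∫⁻ s, maximalFunction w s ^ p / c
      = ∫⁻ s, ∫⁻ l in Ioi (0 : ℝ), {l : ℝ | ENNReal.ofReal l < maximalFunction w s}.indicator
          (fun l => ENNReal.ofReal (l ^ (p - 1))) l :=
        lintegral_congr fun s => (ENNReal.rpow_eq_lintegral_indicator hp0 _).symm
    _ = ∫⁻ l in Ioi (0 : ℝ), ∫⁻ s, {l : ℝ | ENNReal.ofReal l < maximalFunction w s}.indicator
          (fun l => ENNReal.ofReal (l ^ (p - 1))) l :=
        lintegral_lintegral_swap hmeas1.aemeasurable
    _ = ∫⁻ l in Ioi (0 : ℝ), ENNReal.ofReal (l ^ (p - 1)) *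
          volume {s | ENNReal.ofReal l < maximalFunction w s} := by
        refine lintegral_congr fun l => ?_
        rw [← lintegral_indicator_const (measurableSet_lt measurable_const hM)]
        rfl
    _ ≤ ∫⁻ l in Ioi (0 : ℝ), 10 * ∫⁻ r, {q : ℝ × ℝ | ENNReal.ofReal q.1
          < 2 * w q.2}.indicator (fun q => ENNReal.ofReal (q.1 ^ (p - 1 - 1)) * w q.2) (l, r) := by
        refine setLIntegral_mono' measurableSet_Ioi fun l hl => ?_
        have hl0 : (0 : ℝ) < l := hl
        have h1 : l ^ (p - 1) = l ^ (p - 1 - 1) * l := by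
          rw [← Real.rpow_add_one hl0.ne', sub_add_cancel]
        have h2 : ∫⁻ r, {q : ℝ × ℝ | ENNReal.ofReal q.1 < 2 * w q.2}.indicator
            (fun q => ENNReal.ofReal (q.1 ^ (p - 1 - 1)) * w q.2) (l, r)
            = ENNReal.ofReal (l ^ (p - 1 - 1)) *
              ∫⁻ r, {r | ENNReal.ofReal l < 2 * w r}.indicator w r := by
          rw [← lintegral_const_mul _ (hw.indicator (measurableSet_lt measurable_const
            (hw.const_mul 2)))]
          refine lintegral_congr fun r => ?_
          simp only [indicator, mem_ofPred_eq]
          split_ifs <;> simp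
        rw [h1, h2, ENNReal.ofReal_mul (by positivity), mul_left_comm 10, mul_assoc]
        exact mul_le_mul_right (maximalFunction_level_le w hl0) _
    _ = 10 * ∫⁻ l in Ioi (0 : ℝ), ∫⁻ r, {q : ℝ × ℝ | ENNReal.ofReal q.1
          < 2 * w q.2}.indicator (fun q => ENNReal.ofReal (q.1 ^ (p - 1 - 1)) * w q.2) (l, r) :=
        lintegral_const_mul _ hmeas2.lintegral_prod_right'
    _ = 10 * ∫⁻ r, ∫⁻ l in Ioi (0 : ℝ), {q : ℝ × ℝ | ENNReal.ofReal q.1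
          < 2 * w q.2}.indicator (fun q => ENNReal.ofReal (q.1 ^ (p - 1 - 1)) * w q.2) (l, r) := by
        rw [lintegral_lintegral_swap hmeas2.aemeasurable]
    _ = 10 * ∫⁻ r, 2 ^ (p - 1) / c' * w r ^ p := by
        congr 1
        refine lintegral_congr fun r => ?_
        have h3 : ∀ l, {q : ℝ × ℝ | ENNReal.ofReal q.1 < 2 * w q.2}.indicator
            (fun q => ENNReal.ofReal (q.1 ^ (p - 1 - 1)) * w q.2) (l, r)
            = {l : ℝ | ENNReal.ofReal l < 2 * w r}.indicator
              (fun l => ENNReal.ofReal (l ^ (p - 1 - 1))) l * w r := by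
          intro l
          simp only [indicator, mem_ofPred_eq]
          split_ifs <;> simp
        simp_rw [h3]
        rw [lintegral_mul_const, ENNReal.rpow_eq_lintegral_indicator hp1,
          ENNReal.mul_rpow_of_nonneg _ _ hp1.le, ENNReal.mul_div_right_comm, mul_assoc]
        · congr 1
          nth_rw 2 [← ENNReal.rpow_one (w r)]
          rw [← ENNReal.rpow_add_of_nonneg _ _ hp1.le zero_le_one, sub_add_cancel]
        · exact Measurable.indicator (by fun_prop)
            (measurableSet_lt (by fun_prop) measurable_const)
    _ = 10 * (2 ^ (p - 1) / c') * ∫⁻ s, w s ^ p := by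
        rw [lintegral_const_mul _ (hw.pow_const p), mul_assoc]

/-- Integration of a weight against a quasi-decreasing density. -/
theorem lintegral_quasiDecreasing_mul_le {ν W : ℝ → ℝ≥0∞} {Q m : ℝ≥0∞} (hν : Measurable ν)
    (hW : Measurable W) (hmono : ∀ r r', 0 < r → r ≤ r' → ν r' ≤ Q * ν r)
    (hm : ∀ ρ : ℝ, 0 < ρ → ∫⁻ r in Ioc 0 ρ, W r ≤ ENNReal.ofReal ρ * m) :
    ∫⁻ r in Ioi (0 : ℝ), ν r * W r ≤ Q * (∫⁻ r in Ioi (0 : ℝ), ν r) * m := by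
  -- Needed only where a level set has infinite measure, since then the product with `m = 0` is `0`
  -- by convention.
  have hW0 : m = 0 → ∫⁻ r in Ioi (0 : ℝ), W r = 0 := by
    intro h0
    have hU : Ioi (0 : ℝ) = ⋃ n : ℕ, Ioc (0 : ℝ) (n + 1) := by
      ext r
      simp only [mem_Ioi, mem_iUnion, mem_Ioc]
      refine ⟨fun hr => ?_, fun ⟨n, hr⟩ => hr.1⟩
      obtain ⟨n, hn⟩ := exists_nat_ge r
      exact ⟨n, hr, by linarith⟩
    rw [hU, ← nonpos_iff_eq_zero]
    refine (lintegral_iUnion_le _ _).trans ?_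
    rw [nonpos_iff_eq_zero, ENNReal.tsum_eq_zero]
    intro n
    have := hm (n + 1) (by positivity)
    rw [h0, mul_zero] at this
    exact nonpos_iff_eq_zero.1 this
  have hlevel : ∀ l : ℝ, ∫⁻ r in Ioi (0 : ℝ), {r | ENNReal.ofReal l < ν r}.indicator W r
      ≤ (∫⁻ r in Ioi (0 : ℝ), {r | ENNReal.ofReal l < Q * ν r}.indicator 1 r) * m := by
    intro l
    have hF : MeasurableSet {r | ENNReal.ofReal l < Q * ν r} :=
      measurableSet_lt measurable_const (hν.const_mul Q)
    have hE : MeasurableSet {r | ENNReal.ofReal l < ν r} := measurableSet_lt measurable_const hν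
    rw [lintegral_indicator_one hF, lintegral_indicator hE, Measure.restrict_restrict hE,
      Measure.restrict_apply hF]
    set V := volume ({r | ENNReal.ofReal l < Q * ν r} ∩ Ioi 0) with hV
    -- If `ν r > l`, then `Q ν > l` on all of `(0, r]`, so `r` is at most the measure `V` of that
    -- set. Thus the level set of `ν` lies in `(0, V]`, where the hypothesis on `W` applies.
    have hr : ∀ r ∈ {r | ENNReal.ofReal l < ν r} ∩ Ioi 0, ENNReal.ofReal r ≤ V := by
      rintro r ⟨hr1, hr2⟩
      have hsub : Ioc 0 r ⊆ {r | ENNReal.ofReal l < Q * ν r} ∩ Ioi 0 := fun r' hr' =>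
        ⟨lt_of_lt_of_le hr1 (hmono r' r hr'.1 hr'.2), hr'.1⟩
      calc ENNReal.ofReal r = volume (Ioc 0 r) := by rw [Real.volume_Ioc, sub_zero]
        _ ≤ V := measure_mono hsub
    by_cases hVtop : V = ∞
    · rw [hVtop]
      by_cases h0 : m = 0
      · rw [h0, mul_zero, ← hW0 h0]
        exact lintegral_mono_set inter_subset_right
      · rw [ENNReal.top_mul h0]; exact le_top
    · by_cases hemp : ({r | ENNReal.ofReal l < ν r} ∩ Ioi 0) = ∅
      · rw [hemp]; simp
      obtain ⟨r₀, hr₀⟩ := nonempty_iff_ne_empty.2 hemp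
      have hVpos : 0 < V.toReal :=
        ENNReal.toReal_pos ((ENNReal.ofReal_pos.2 hr₀.2).trans_le (hr r₀ hr₀)).ne' hVtop
      calc _ ≤ ∫⁻ r in Ioc 0 V.toReal, W r := lintegral_mono_set fun r h =>
            ⟨h.2, (ENNReal.ofReal_le_iff_le_toReal hVtop).1 (hr r h)⟩
        _ ≤ ENNReal.ofReal V.toReal * m := hm _ hVpos
        _ = V * m := by rw [ENNReal.ofReal_toReal hVtop]
  have hmeas1 : Measurable fun q : ℝ × ℝ =>
      {q : ℝ × ℝ | ENNReal.ofReal q.2 < ν q.1}.indicator (fun q => W q.1) q :=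
    Measurable.indicator (hW.comp measurable_fst)
      (measurableSet_lt (by fun_prop) (hν.comp measurable_fst))
  have hmeas2 : Measurable fun q : ℝ × ℝ =>
      {q : ℝ × ℝ | ENNReal.ofReal q.1 < Q * ν q.2}.indicator (1 : ℝ × ℝ → ℝ≥0∞) q :=
    Measurable.indicator measurable_one
      (measurableSet_lt (by fun_prop) ((hν.comp measurable_snd).const_mul Q))
  have hdm : ∀ a : ℝ≥0∞, Measurable ({l : ℝ | ENNReal.ofReal l < a}.indicator (1 : ℝ → ℝ≥0∞)) :=
    fun a => measurable_one.indicator (measurableSet_lt (by fun_prop) measurable_const)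
  calc ∫⁻ r in Ioi (0 : ℝ), ν r * W r
      = ∫⁻ r in Ioi (0 : ℝ), ∫⁻ l in Ioi (0 : ℝ),
          {q : ℝ × ℝ | ENNReal.ofReal q.2 < ν q.1}.indicator (fun q => W q.1) (r, l) := by
        refine lintegral_congr fun r => ?_
        conv_lhs => rw [ENNReal.eq_lintegral_indicator (ν r)]
        rw [← lintegral_mul_const _ (hdm _)]
        refine lintegral_congr fun l => ?_
        simp only [indicator, mem_ofPred_eq]
        split_ifs <;> simp
    _ = ∫⁻ l in Ioi (0 : ℝ), ∫⁻ r in Ioi (0 : ℝ),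
          {q : ℝ × ℝ | ENNReal.ofReal q.2 < ν q.1}.indicator (fun q => W q.1) (r, l) :=
        lintegral_lintegral_swap hmeas1.aemeasurable
    _ ≤ ∫⁻ l in Ioi (0 : ℝ), (∫⁻ r in Ioi (0 : ℝ),
          {q : ℝ × ℝ | ENNReal.ofReal q.1 < Q * ν q.2}.indicator (1 : ℝ × ℝ → ℝ≥0∞) (l, r)) * m :=
        lintegral_mono fun l => hlevel l
    _ = (∫⁻ l in Ioi (0 : ℝ), ∫⁻ r in Ioi (0 : ℝ),
          {q : ℝ × ℝ | ENNReal.ofReal q.1 < Q * ν q.2}.indicator (1 : ℝ × ℝ → ℝ≥0∞) (l, r)) * m :=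
        lintegral_mul_const _ hmeas2.lintegral_prod_right'
    _ = (∫⁻ r in Ioi (0 : ℝ), Q * ν r) * m := by
        rw [lintegral_lintegral_swap hmeas2.aemeasurable]
        congr 1
        refine lintegral_congr fun r => ?_
        exact (ENNReal.eq_lintegral_indicator (Q * ν r)).symm
    _ = _ := by rw [lintegral_const_mul _ hν]

end MaximalFunction

/-! ### Energy estimates for bounded sectorial operators -/

section Energy

variable {H : Type*} [NormedAddCommGroup H] [InnerProductSpace ℂ H]

/-- Bounded operators with numerical range in a sector of angle `arccos c < π / 2`. -/
structure IsBoundedSectorial (B : H →L[ℂ] H) (c : ℝ) : Prop where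
  pos : 0 < c
  bound : ∀ x, c * ‖inner ℂ x (B x)‖ ≤ (inner ℂ x (B x)).re

/-- The energy `Re (B x, x)`. -/
noncomputable def energy (B : H →L[ℂ] H) (x : H) : ℝ := (inner ℂ x (B x)).re

theorem continuous_energy (B : H →L[ℂ] H) : Continuous (energy B) := by
  unfold energy; fun_prop

theorem energy_le_norm_mul (B : H →L[ℂ] H) (x : H) : energy B x ≤ ‖x‖ * ‖B x‖ :=
  (Complex.re_le_norm _).trans (norm_inner_le_norm _ _)

theorem energy_zero (B : H →L[ℂ] H) : energy B 0 = 0 := by simp [energy]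

theorem energy_smul (B : H →L[ℂ] H) (z : ℂ) (x : H) : energy B (z • x) = ‖z‖ ^ 2 * energy B x := by
  rw [energy, map_smul, inner_smul_left, inner_smul_right, ← mul_assoc, mul_comm (starRingEnd ℂ z),
    Complex.mul_conj, Complex.re_ofReal_mul, Complex.normSq_eq_norm_sq, energy]

theorem energy_parallelogram (B : H →L[ℂ] H) (x y : H) :
    energy B (x + y) + energy B (x - y) = 2 * energy B x + 2 * energy B y := by
  simp only [energy, map_add, map_sub, inner_add_left, inner_add_right, inner_sub_left,
    inner_sub_right, Complex.add_re, Complex.sub_re]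
  ring

/-- The optimal scaling is `b / a`; adding `ε` to both allows either to vanish. -/
theorem le_two_mul_of_forall_scaling {N a b : ℝ} (ha : 0 ≤ a) (hb : 0 ≤ b)
    (h : ∀ l : ℝ, 0 < l → N ≤ l * a ^ 2 + l⁻¹ * b ^ 2) : N ≤ 2 * a * b := by
  have key : ∀ ε : ℝ, 0 < ε → N ≤ 2 * a * b + ε * (a + b) := by
    intro ε hε
    have h1 := h ((b + ε) / (a + ε)) (by positivity)
    have h2 : (b + ε) / (a + ε) * a ^ 2 ≤ (b + ε) * a := by
      rw [div_mul_eq_mul_div, div_le_iff₀ (by positivity)]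
      nlinarith [mul_nonneg ha hε.le, mul_nonneg hb (mul_nonneg ha hε.le), mul_pos hε hε]
    have h3 : ((b + ε) / (a + ε))⁻¹ * b ^ 2 ≤ (a + ε) * b := by
      rw [inv_div, div_mul_eq_mul_div, div_le_iff₀ (by positivity)]
      nlinarith [mul_nonneg hb hε.le, mul_nonneg ha (mul_nonneg hb hε.le), mul_pos hε hε]
    linarith
  have hlim : Tendsto (fun ε : ℝ => 2 * a * b + ε * (a + b)) (𝓝[>] 0) (𝓝 (2 * a * b)) := by
    have : Tendsto (fun ε : ℝ => 2 * a * b + ε * (a + b)) (𝓝 0) (𝓝 (2 * a * b + 0 * (a + b))) :=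
      (Continuous.tendsto (by fun_prop) 0)
    rw [zero_mul, add_zero] at this
    exact this.mono_left nhdsWithin_le_nhds
  exact ge_of_tendsto hlim (by filter_upwards [self_mem_nhdsWithin] with ε hε using key ε hε)

namespace IsBoundedSectorial

variable {B : H →L[ℂ] H} {c : ℝ}

theorem energy_nonneg (hB : IsBoundedSectorial B c) (x : H) : 0 ≤ energy B x :=
  (mul_nonneg hB.pos.le (norm_nonneg _)).trans (hB.bound x)

theorem norm_inner_self_le (hB : IsBoundedSectorial B c) (x : H) :
    ‖inner ℂ (B x) x‖ ≤ energy B x / c := by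
  rw [le_div_iff₀ hB.pos, mul_comm, norm_inner_symm]
  exact hB.bound x

/-- Polarization writes the form through its values on the diagonal, each bounded by the energy over
`c`; the parallelogram law sums the four energies. -/
theorem norm_inner_le_add (hB : IsBoundedSectorial B c) (x y : H) :
    ‖inner ℂ (B y) x‖ ≤ (energy B x + energy B y) / c := by
  have hp := inner_map_polarization (B : H →ₗ[ℂ] H) x y
  simp only [ContinuousLinearMap.coe_coe] at hp
  have h1 := hB.norm_inner_self_le (x + y)
  have h2 := hB.norm_inner_self_le (x - y)
  have h3 := hB.norm_inner_self_le (x + Complex.I • y)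
  have h4 := hB.norm_inner_self_le (x - Complex.I • y)
  have e1 := energy_parallelogram B x y
  have e2 := energy_parallelogram B x (Complex.I • y)
  rw [energy_smul, Complex.norm_I, one_pow, one_mul] at e2
  rw [hp, norm_div]
  have h5 : ‖(4 : ℂ)‖ = 4 := by simp
  rw [h5, div_le_iff₀ (by norm_num)]
  have hI : ∀ z : ℂ, ‖Complex.I * z‖ = ‖z‖ := fun z => by rw [norm_mul, Complex.norm_I, one_mul]
  have htri : ∀ p q r s : ℂ, ‖p - q + Complex.I * r - Complex.I * s‖ ≤ ‖p‖ + ‖q‖ + ‖r‖ + ‖s‖ := by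
    intro p q r s
    calc _ ≤ ‖p - q + Complex.I * r‖ + ‖Complex.I * s‖ := norm_sub_le _ _
      _ ≤ ‖p - q‖ + ‖Complex.I * r‖ + ‖Complex.I * s‖ := by gcongr; exact norm_add_le _ _
      _ ≤ _ := by rw [hI, hI]; gcongr; exact norm_sub_le _ _
  refine (htri _ _ _ _).trans ?_
  have hsum : energy B (x + y) / c + energy B (x - y) / c + energy B (x + Complex.I • y) / c
      + energy B (x - Complex.I • y) / c = (energy B x + energy B y) / c * 4 := by
    rw [← add_div, ← add_div, ← add_div, add_assoc (_ + _) (energy B (x + Complex.I • y)), e1, e2]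
    ring
  linarith

/-- The generalized Cauchy--Schwarz inequality for a sectorial form. -/
theorem norm_inner_le (hB : IsBoundedSectorial B c) (x y : H) :
    ‖inner ℂ y (B x)‖ ≤ 2 / c * (√(energy B x) * √(energy B y)) := by
  have hc := hB.pos
  have h := le_two_mul_of_forall_scaling (N := c * ‖inner ℂ (B x) y‖)
    (Real.sqrt_nonneg (energy B x))
    -- Replacing `x` by `√l x` and `y` by `y/√l` leaves the pairing unchanged and rescales the two
    -- energies by `l` and `1/l`; the optimal `l` turns the sum into a product.
    (Real.sqrt_nonneg (energy B y)) (fun l hl => by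
      rw [Real.sq_sqrt (hB.energy_nonneg x), Real.sq_sqrt (hB.energy_nonneg y)]
      have h1 := hB.norm_inner_le_add (((√l)⁻¹ : ℝ) • y : H) ((√l : ℝ) • x : H)
      rw [← Complex.coe_smul, ← Complex.coe_smul, map_smul, inner_smul_left, inner_smul_right,
        ← mul_assoc, energy_smul, energy_smul, Complex.conj_ofReal, ← Complex.ofReal_mul,
        mul_inv_cancel₀ (Real.sqrt_pos.2 hl).ne', Complex.ofReal_one, one_mul, Complex.norm_real,
        Complex.norm_real, Real.norm_eq_abs, Real.norm_eq_abs, sq_abs, sq_abs, inv_pow,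
        Real.sq_sqrt hl.le, le_div_iff₀ hc] at h1
      linarith)
  rw [norm_inner_symm, div_mul_eq_mul_div, le_div_iff₀ hc]
  linarith

variable [CompleteSpace H]

theorem adjoint_inner_self (B : H →L[ℂ] H) (x : H) :
    inner ℂ x (ContinuousLinearMap.adjoint B x) = starRingEnd ℂ (inner ℂ x (B x)) := by
  rw [ContinuousLinearMap.adjoint_inner_right, inner_conj_symm]

theorem energy_adjoint (B : H →L[ℂ] H) (x : H) :
    energy (ContinuousLinearMap.adjoint B) x = energy B x := by
  rw [energy, adjoint_inner_self, Complex.conj_re, energy]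

theorem adjoint (hB : IsBoundedSectorial B c) :
    IsBoundedSectorial (ContinuousLinearMap.adjoint B) c where
  pos := hB.pos
  bound x := by
    rw [adjoint_inner_self, RCLike.norm_conj, Complex.conj_re]
    exact hB.bound x

theorem expSemigroup_adjoint (B : H →L[ℂ] H) (t : ℝ) :
    expSemigroup (ContinuousLinearMap.adjoint B) t
      = ContinuousLinearMap.adjoint (expSemigroup B t) := by
  rw [expSemigroup, expSemigroup, ← ContinuousLinearMap.star_eq_adjoint,
    ← ContinuousLinearMap.star_eq_adjoint, NormedSpace.star_exp, star_smul]
  simp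

theorem norm_expSemigroup_apply_le (hB : IsBoundedSectorial B c) {t : ℝ} (ht : 0 ≤ t) (x : H) :
    ‖expSemigroup B t x‖ ≤ ‖x‖ :=
  norm_expSemigroup_ofReal_le hB.energy_nonneg ht x

/-- The analyticity bound `‖B exp(-tB)‖ ≤ 1 / (c t)`. -/
theorem norm_expSemigroup_generator_le (hB : IsBoundedSectorial B c) {t : ℝ} (ht : 0 < t) (x : H) :
    ‖expSemigroup B t (B x)‖ ≤ ‖x‖ / (c * t) := by
  have hct : 0 < c * t := mul_pos hB.pos ht
  have hd : ∀ z, HasDerivAt (fun z => expSemigroup B z x) (-(expSemigroup B z (B x))) z := fun z =>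
    (ContinuousLinearMap.apply ℂ H x).hasFDerivAt.comp_hasDerivAt z (hasDerivAt_expSemigroup B z)
  have hdiff : Differentiable ℂ fun z => expSemigroup B z x := fun z => (hd z).differentiableAt
  -- Cauchy's estimate on the circle of radius `c t` about `t`. For such `z`, `Re(z p) ≥ t Re p - c
  -- t |p| ≥ 0` at every value `p` of the form, so `exp(-zB)` is a contraction there.
  have h := Complex.norm_deriv_le_of_forall_mem_sphere_norm_le (c := (t : ℂ)) (R := c * t)
    (C := ‖x‖) hct hdiff.diffContOnCl fun z hz => by
      have hacc : ∀ y, 0 ≤ (z * inner ℂ y (B y)).re := by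
        intro y
        rw [mem_sphere_iff_norm] at hz
        have e : z * inner ℂ y (B y) = (t : ℂ) * inner ℂ y (B y) + (z - t) * inner ℂ y (B y) := by
          ring
        have h1 : |((z - t) * inner ℂ y (B y)).re| ≤ c * t * ‖inner ℂ y (B y)‖ := by
          refine (Complex.abs_re_le_norm _).trans ?_
          rw [norm_mul, hz]
        rw [e, Complex.add_re, Complex.re_ofReal_mul]
        have h2 := mul_le_mul_of_nonneg_left (hB.bound y) ht.le
        have h3 := (abs_le.1 h1).1
        linarith
      simpa using (expSemigroup B z).le_of_opNorm_le (norm_expSemigroup_le hacc) x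
  rwa [(hd t).deriv, norm_neg] at h

theorem energy_expSemigroup_le_norm (hB : IsBoundedSectorial B c) {t : ℝ} (ht : 0 < t) (x : H) :
    energy B (expSemigroup B t x) ≤ ‖x‖ ^ 2 / (c * t) := by
  have hct : 0 < c * t := mul_pos hB.pos ht
  refine (energy_le_norm_mul _ _).trans ?_
  rw [← expSemigroup_comm]
  calc _ ≤ ‖x‖ * (‖x‖ / (c * t)) := by
        gcongr
        · exact hB.norm_expSemigroup_apply_le ht.le x
        · exact hB.norm_expSemigroup_generator_le ht x
    _ = _ := by ring

/-- Half-order smoothing without square roots of operators. For `z = exp(-tB)Bx`, `‖z‖²` is the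
pairing of `exp(-tB*)z` with `Bx`; the sectorial Cauchy–Schwarz inequality and the smoothing bound
for `B*` give one factor `‖z‖`, which cancels. -/
theorem norm_generator_le_energy (hB : IsBoundedSectorial B c) {t : ℝ} (ht : 0 < t) (x : H) :
    ‖expSemigroup B t (B x)‖ ≤ 2 / c * √(energy B x) / √(c * t) := by
  have hct : 0 < c * t := mul_pos hB.pos ht
  have hc := hB.pos
  set z := expSemigroup B t (B x) with hz
  by_cases hz0 : ‖z‖ = 0
  · rw [hz0]; positivity
  have hzpos : 0 < ‖z‖ := lt_of_le_of_ne (norm_nonneg _) (Ne.symm hz0)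
  have h1 : ‖z‖ ^ 2 = ‖inner ℂ (expSemigroup (ContinuousLinearMap.adjoint B) t z) (B x)‖ := by
    rw [expSemigroup_adjoint, ContinuousLinearMap.adjoint_inner_left, ← hz,
      inner_self_eq_norm_sq_to_K]
    simp
  have h2 := hB.norm_inner_le x (expSemigroup (ContinuousLinearMap.adjoint B) t z)
  have h3 := hB.adjoint.energy_expSemigroup_le_norm ht z
  rw [energy_adjoint] at h3
  have h4 : √(energy B (expSemigroup (ContinuousLinearMap.adjoint B) t z)) ≤ ‖z‖ / √(c * t) := by
    rw [← Real.sqrt_sq hzpos.le, ← Real.sqrt_div (sq_nonneg _)]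
    exact Real.sqrt_le_sqrt h3
  refine le_of_mul_le_mul_right ?_ hzpos
  calc ‖z‖ * ‖z‖ = ‖z‖ ^ 2 := by ring
    _ ≤ 2 / c * (√(energy B x) * (‖z‖ / √(c * t))) := by rw [h1]; exact h2.trans (by gcongr)
    _ = _ := by ring

/-- The derivative of the orbit is of order `s^{-1/2}` in terms of the energy, and this singularity
is integrable. -/
theorem norm_expSemigroup_sub_self_le (hB : IsBoundedSectorial B c) {t : ℝ} (ht : 0 < t) (x : H) :
    ‖expSemigroup B t x - x‖ ≤ 4 / c * √(energy B x) * √t / √c := by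
  have hc := hB.pos
  have hcont : Continuous fun s : ℝ => -(expSemigroup B s (B x)) :=
    (((continuous_expSemigroup _).comp Complex.continuous_ofReal).clm_apply continuous_const).neg
  have h1 := intervalIntegral.integral_eq_sub_of_hasDerivAt
    (fun s _ => hasDerivAt_expSemigroup_ofReal B x s) (hcont.intervalIntegrable 0 t)
  rw [Complex.ofReal_zero, expSemigroup_zero, one_apply_eq_self] at h1
  rw [← h1]
  set K := 2 / c * √(energy B x) / √c with hK
  have h2 : ‖∫ s in (0 : ℝ)..t, -(expSemigroup B s (B x))‖
      ≤ ∫ s in (0 : ℝ)..t, K * s ^ (-(1 / 2) : ℝ) := by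
    refine intervalIntegral.norm_integral_le_of_norm_le ht.le ?_ ?_
    · refine Eventually.of_forall fun s hs => ?_
      rw [norm_neg]
      refine (hB.norm_generator_le_energy hs.1 x).trans (le_of_eq ?_)
      rw [Real.sqrt_mul hc.le, Real.rpow_neg hs.1.le, ← Real.sqrt_eq_rpow, hK]
      ring
    · exact (intervalIntegral.intervalIntegrable_rpow' (by norm_num)).const_mul K
  refine h2.trans (le_of_eq ?_)
  rw [intervalIntegral.integral_const_mul, integral_rpow (Or.inl (by norm_num)),
    show (-(1 / 2) + 1 : ℝ) = 1 / 2 by norm_num, Real.zero_rpow (by norm_num), sub_zero,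
    ← Real.sqrt_eq_rpow, hK]
  ring

/-- The semigroup is uniformly bounded for the energy seminorm. -/
theorem energy_expSemigroup_le (hB : IsBoundedSectorial B c) {t : ℝ} (ht : 0 ≤ t) (x : H) :
    energy B (expSemigroup B t x) ≤ (16 / c ^ 3 + 4 / c ^ 2 + 1) * energy B x := by
  have hc := hB.pos
  have hx := hB.energy_nonneg x
  rcases ht.eq_or_lt with rfl | ht
  · rw [Complex.ofReal_zero, expSemigroup_zero, one_apply_eq_self]
    have : 0 ≤ (16 / c ^ 3 + 4 / c ^ 2) * energy B x := by positivity
    linarith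
  set y := expSemigroup B t x with hy
  set p := √(energy B x) with hp
  set X := √(energy B y) with hX
  have hp2 : p ^ 2 = energy B x := Real.sq_sqrt hx
  have hX2 : X ^ 2 = energy B y := Real.sq_sqrt (hB.energy_nonneg y)
  -- The energy need not decrease when `B` is not selfadjoint. In the first term the factors `√t`
  -- and `1/√t` cancel; in the second, Cauchy–Schwarz lets half of `energy B y` be absorbed on the
  -- left.
  have hsplit : energy B y = (inner ℂ (y - x) (B y)).re + (inner ℂ x (B y)).re := by
    rw [energy, ← Complex.add_re, ← inner_add_left, sub_add_cancel]
  have h1 : (inner ℂ (y - x) (B y)).re ≤ 8 / c ^ 3 * p ^ 2 := by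
    refine (Complex.re_le_norm _).trans ((norm_inner_le_norm _ _).trans ?_)
    have e1 := hB.norm_expSemigroup_sub_self_le ht x
    have e2 := hB.norm_generator_le_energy ht x
    rw [expSemigroup_comm] at e2
    calc ‖y - x‖ * ‖B y‖ ≤ (4 / c * p * √t / √c) * (2 / c * p / √(c * t)) := by gcongr
      _ = 8 / c ^ 3 * p ^ 2 := by
        rw [Real.sqrt_mul hc.le]
        have hst : √t ≠ 0 := (Real.sqrt_pos.2 ht).ne'
        have hsc : √c ≠ 0 := (Real.sqrt_pos.2 hc).ne'
        have : √c ^ 2 = c := Real.sq_sqrt hc.le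
        field_simp
        rw [this]; ring
  have h2 : (inner ℂ x (B y)).re ≤ 2 / c * (X * p) :=
    (Complex.re_le_norm _).trans (hB.norm_inner_le y x)
  have h3 : 2 / c * (X * p) ≤ X ^ 2 / 2 + 2 / c ^ 2 * p ^ 2 := by
    have h4 := sq_nonneg (X - 2 / c * p)
    have h5 : (X - 2 / c * p) ^ 2 = 2 * (X ^ 2 / 2 + 2 / c ^ 2 * p ^ 2 - 2 / c * (X * p)) := by
      field_simp; ring
    linarith
  rw [← hX2] at hsplit ⊢
  rw [← hp2]
  have h6 : (16 / c ^ 3 + 4 / c ^ 2 + 1) * p ^ 2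
      = 2 * (8 / c ^ 3 * p ^ 2) + 2 * (2 / c ^ 2 * p ^ 2) + p ^ 2 := by ring
  linarith [sq_nonneg p]

/-- At half speed the energy is exactly minus the derivative of the squared norm, so its integral
telescopes. -/
theorem lintegral_energy_le (hB : IsBoundedSectorial B c) (x : H) :
    ∫⁻ r in Ioi (0 : ℝ), ENNReal.ofReal (energy B (expSemigroup B ((r / 2 : ℝ) : ℂ) x))
      ≤ ENNReal.ofReal (‖x‖ ^ 2) := by
  set g : ℝ → ℝ := fun r => ‖expSemigroup B ((r / 2 : ℝ) : ℂ) x‖ ^ 2 with hg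
  have hd : ∀ r, HasDerivAt g (-energy B (expSemigroup B ((r / 2 : ℝ) : ℂ) x)) r := by
    intro r
    have := (hasDerivAt_norm_sq_expSemigroup B x (r / 2)).scomp r ((hasDerivAt_id r).div_const 2)
    refine this.congr_deriv ?_
    rw [energy, smul_eq_mul]
    ring
  have hanti : Antitone g := antitone_of_hasDerivAt_nonpos hd fun r => by
    simpa using hB.energy_nonneg _
  have hbdd : BddBelow (range g) := ⟨0, by rintro _ ⟨r, rfl⟩; exact sq_nonneg _⟩
  have hlim := tendsto_atTop_ciInf hanti hbdd
  have hnonpos : ∀ r ∈ Ioi (0 : ℝ), -energy B (expSemigroup B ((r / 2 : ℝ) : ℂ) x) ≤ 0 :=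
    fun r _ => by simpa using hB.energy_nonneg _
  have hint := integrableOn_Ioi_deriv_of_nonpos' (fun r _ => hd r) hnonpos hlim
  have heq := integral_Ioi_of_hasDerivAt_of_nonpos' (fun r _ => hd r) hnonpos hlim
  rw [integral_neg] at heq
  have hinf : 0 ≤ ⨅ r, g r := le_ciInf fun r => sq_nonneg _
  rw [← ofReal_integral_eq_lintegral_ofReal (by simpa [IntegrableOn] using hint.neg)
    (Eventually.of_forall fun r => hB.energy_nonneg _)]
  refine ENNReal.ofReal_le_ofReal ?_
  have hg0 : g 0 = ‖x‖ ^ 2 := by simp [hg, expSemigroup_zero]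
  linarith

end IsBoundedSectorial

end Energy

/-! ### Quasi-decreasing kernels and the maximal function -/

section Convolution

/-- After translation by `s`, the weight has mass on `(0, ρ]` at most its mass on the ball of radius
`ρ` about `s`, as the quasi-decreasing estimate requires. The next lemma is the same with time
reversed. -/
theorem lintegral_indicator_sub_mul_le {ν w : ℝ → ℝ≥0∞} {Q : ℝ≥0∞} (hν : Measurable ν)
    (hw : Measurable w) (hmono : ∀ r r', 0 < r → r ≤ r' → ν r' ≤ Q * ν r) (s : ℝ) :
    ∫⁻ t, (Ioi 0).indicator ν (t - s) * w t
      ≤ Q * (∫⁻ r in Ioi 0, ν r) * (4 * maximalFunction w s) := by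
  calc ∫⁻ t, (Ioi 0).indicator ν (t - s) * w t
      = ∫⁻ r, (Ioi 0).indicator ν (r + s - s) * w (r + s) :=
        (lintegral_add_right_eq_self (fun t => (Ioi 0).indicator ν (t - s) * w t) s).symm
    _ = ∫⁻ r in Ioi 0, ν r * w (r + s) := by
        rw [← lintegral_indicator measurableSet_Ioi]
        refine lintegral_congr fun r => ?_
        rw [add_sub_cancel_right, indicator_mul_left]
    _ ≤ _ := by
        refine lintegral_quasiDecreasing_mul_le hν (hw.comp (measurable_add_const s)) hmono ?_
        intro ρ hρ
        refine le_trans ?_ (lintegral_closedBall_le_maximalFunction w s hρ)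
        rw [← lintegral_indicator measurableSet_Ioc,
          ← lintegral_indicator Metric.isClosed_closedBall.measurableSet,
          ← lintegral_add_right_eq_self ((Metric.closedBall s ρ).indicator w) s]
        refine lintegral_mono fun r => ?_
        by_cases hr : r ∈ Ioc 0 ρ
        · rw [indicator_of_mem hr, indicator_of_mem]
          rw [Metric.mem_closedBall, Real.dist_eq, add_sub_cancel_right, abs_of_pos hr.1]
          exact hr.2
        · rw [indicator_of_notMem hr]; exact zero_le

theorem lintegral_indicator_sub_mul_le' {ν w : ℝ → ℝ≥0∞} {Q : ℝ≥0∞} (hν : Measurable ν)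
    (hw : Measurable w) (hmono : ∀ r r', 0 < r → r ≤ r' → ν r' ≤ Q * ν r) (t : ℝ) :
    ∫⁻ s, (Ioi 0).indicator ν (t - s) * w s
      ≤ Q * (∫⁻ r in Ioi 0, ν r) * (4 * maximalFunction w t) := by
  calc ∫⁻ s, (Ioi 0).indicator ν (t - s) * w s
      = ∫⁻ r, (Ioi 0).indicator ν (t - (t - r)) * w (t - r) :=
        (lintegral_sub_left_eq_self (fun s => (Ioi 0).indicator ν (t - s) * w s) t).symm
    _ = ∫⁻ r in Ioi 0, ν r * w (t - r) := by
        rw [← lintegral_indicator measurableSet_Ioi]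
        refine lintegral_congr fun r => ?_
        rw [sub_sub_cancel, indicator_mul_left]
    _ ≤ _ := by
        refine lintegral_quasiDecreasing_mul_le hν (hw.comp (measurable_const_sub t)) hmono ?_
        intro ρ hρ
        refine le_trans ?_ (lintegral_closedBall_le_maximalFunction w t hρ)
        rw [← lintegral_indicator measurableSet_Ioc,
          ← lintegral_indicator Metric.isClosed_closedBall.measurableSet,
          ← lintegral_sub_left_eq_self ((Metric.closedBall t ρ).indicator w) t]
        refine lintegral_mono fun r => ?_
        by_cases hr : r ∈ Ioc 0 ρ
        · rw [indicator_of_mem hr, indicator_of_mem]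
          rw [Metric.mem_closedBall, Real.dist_eq, sub_sub_cancel_left, abs_neg, abs_of_pos hr.1]
          exact hr.2
        · rw [indicator_of_notMem hr]; exact zero_le

end Convolution

/-! ### A bilinear estimate with maximal function weights -/

section Bilinear

theorem maximalFunction_one_le (s : ℝ) : maximalFunction (fun _ => 1) s ≤ 1 := by
  refine iSup_le fun k => ?_
  rw [lintegral_one, Measure.restrict_apply_univ, Real.volume_closedBall]
  exact ENNReal.div_self_le_one

variable {F G : ℝ → ℝ → ℝ≥0∞} {a b : ℝ → ℝ≥0∞} {K : ℝ≥0∞}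

/-- Cauchy–Schwarz on the plane after inserting `w^{1/2} w^{-1/2}`. Where `w` vanishes this factor
is not `1`, but `G` vanishes there too. -/
theorem lintegral_mul_le_of_weight {w : ℝ → ℝ≥0∞} (hF : Measurable (Function.uncurry F))
    (hG : Measurable (Function.uncurry G)) (hw : Measurable w) (hwt : ∀ t, w t ≠ ∞)
    (hw0 : ∀ s t, w t = 0 → G s t = 0) :
    ∫⁻ s, ∫⁻ t, F s t * G s t
      ≤ (∫⁻ s, ∫⁻ t, F s t ^ 2 * w t) ^ (1 / 2 : ℝ)
        * (∫⁻ t, (∫⁻ s, G s t ^ 2) * (w t)⁻¹) ^ (1 / 2 : ℝ) := by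
  have hw2 : Measurable fun p : ℝ × ℝ => w p.2 := hw.comp measurable_snd
  have h1 : ∀ s t, F s t * G s t
      = (F s t * w t ^ (1 / 2 : ℝ)) * (G s t * (w t)⁻¹ ^ (1 / 2 : ℝ)) := by
    intro s t
    by_cases h : w t = 0
    · rw [hw0 s t h]; simp
    · have : w t ^ (1 / 2 : ℝ) * (w t)⁻¹ ^ (1 / 2 : ℝ) = 1 := by
        rw [← ENNReal.mul_rpow_of_nonneg _ _ (by norm_num), ENNReal.mul_inv_cancel h (hwt t),
          ENNReal.one_rpow]
      calc F s t * G s t = F s t * G s t * (w t ^ (1 / 2 : ℝ) * (w t)⁻¹ ^ (1 / 2 : ℝ)) := by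
            rw [this, mul_one]
        _ = _ := by ring
  have hsq : ∀ x y : ℝ≥0∞, (x * y ^ (1 / 2 : ℝ)) ^ (2 : ℝ) = x ^ 2 * y := by
    intro x y
    rw [ENNReal.mul_rpow_of_nonneg _ _ (by norm_num), ← ENNReal.rpow_mul]
    norm_num
  have hm1 : Measurable fun p : ℝ × ℝ => F p.1 p.2 * w p.2 ^ (1 / 2 : ℝ) :=
    hF.mul (hw2.pow_const _)
  have hm2 : Measurable fun p : ℝ × ℝ => G p.1 p.2 * (w p.2)⁻¹ ^ (1 / 2 : ℝ) :=
    hG.mul (hw2.inv.pow_const _)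
  have h2 := ENNReal.lintegral_mul_le_Lp_mul_Lq (volume.prod volume : Measure (ℝ × ℝ))
    Real.HolderConjugate.two_two hm1.aemeasurable hm2.aemeasurable
  simp only [Pi.mul_apply, hsq] at h2
  have hmm : Measurable fun p : ℝ × ℝ =>
      F p.1 p.2 * w p.2 ^ (1 / 2 : ℝ) * (G p.1 p.2 * (w p.2)⁻¹ ^ (1 / 2 : ℝ)) := hm1.mul hm2
  have hm3 : Measurable fun p : ℝ × ℝ => F p.1 p.2 ^ 2 * w p.2 := (hF.pow_const 2).mul hw2
  have hm4 : Measurable fun p : ℝ × ℝ => G p.1 p.2 ^ 2 * (w p.2)⁻¹ := (hG.pow_const 2).mul hw2.inv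
  rw [lintegral_prod _ hmm.aemeasurable, lintegral_prod _ hm3.aemeasurable,
    lintegral_prod_symm _ hm4.aemeasurable] at h2
  simp only [h1]
  refine h2.trans (le_of_eq ?_)
  congr 2
  refine lintegral_congr fun t => ?_
  have hm5 : Measurable fun s => G s t ^ 2 := (hG.comp measurable_prodMk_right).pow_const 2
  exact lintegral_mul_const (μ := volume) ((w t)⁻¹) hm5

/-- The weight is `w = b^{2-q'}`. The factor with `G` becomes `∫ b² w⁻¹ = ∫ b^{q'}`. The factor with
`F` becomes `∫ a² M w`, with `M` the maximal function; Hölder with exponents `q/2` and `q/(q-2)` and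
the maximal inequality bound it by norms of `a` and `b`, because `(2 - q') q/(q - 2) = q'`. -/
theorem lintegral_mul_le_of_two_le {q q' : ℝ} (hqq : q.HolderConjugate q') (hq : 2 ≤ q) :
    ∃ C : ℝ≥0∞, C ≠ ∞ ∧ ∀ (F G : ℝ → ℝ → ℝ≥0∞) (a b : ℝ → ℝ≥0∞) (K : ℝ≥0∞),
      Measurable (Function.uncurry F) → Measurable (Function.uncurry G) →
      Measurable a → Measurable b → (∀ t, b t ≠ ∞) → (∀ s t, b t = 0 → G s t = 0) →
      (∀ w : ℝ → ℝ≥0∞, Measurable w → ∀ s,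
        ∫⁻ t, F s t ^ 2 * w t ≤ K * a s ^ 2 * maximalFunction w s) →
      (∀ w : ℝ → ℝ≥0∞, Measurable w → ∀ t,
        ∫⁻ s, G s t ^ 2 * w s ≤ K * b t ^ 2 * maximalFunction w t) →
      ∫⁻ s, ∫⁻ t, F s t * G s t
        ≤ C * K * (∫⁻ s, a s ^ q) ^ (1 / q) * (∫⁻ t, b t ^ q') ^ (1 / q') := by
  have hq0 : 0 < q := hqq.pos
  have hq'0 : 0 < q' := hqq.symm.pos
  have hmax : ∃ C : ℝ≥0∞, C ≠ ∞ ∧ ∀ a b : ℝ → ℝ≥0∞, Measurable a → Measurable b →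
      ∫⁻ s, a s ^ 2 * maximalFunction (fun t => b t ^ (2 - q')) s
        ≤ C * (∫⁻ s, a s ^ q) ^ (2 / q) * (∫⁻ t, b t ^ q') ^ (2 / q' - 1) := by
    have hsum := hqq.inv_add_inv_eq_one
    -- At `q = 2` the exponent `q/(q - 2)` degenerates, but the weight is constant and no maximal
    -- inequality is needed.
    rcases hq.eq_or_lt with rfl | hq
    · obtain rfl : q' = 2 := by
        have : q'⁻¹ = 2⁻¹ := by linarith
        exact inv_injective this
      refine ⟨1, ENNReal.one_ne_top, fun a b _ _ => ?_⟩
      simp only [sub_self, ENNReal.rpow_zero, div_self (two_ne_zero (α := ℝ)), one_mul, mul_one,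
        ENNReal.rpow_one, ENNReal.rpow_two]
      exact lintegral_mono fun s => mul_le_of_le_one_right' (maximalFunction_one_le s)
    · have hq2 : 0 < q - 2 := by linarith
      have hρ : (q / 2).HolderConjugate (q / (q - 2)) := by
        rw [Real.holderConjugate_iff]
        refine ⟨by linarith, ?_⟩
        field_simp
        ring
      obtain ⟨C, hC, hM⟩ := maximalFunction_strong_type hρ.symm.lt
      refine ⟨C ^ ((q - 2) / q), ENNReal.rpow_ne_top_of_nonneg (by positivity) hC,
        fun a b ha hb => ?_⟩
      have hwm : Measurable fun t => b t ^ (2 - q') := hb.pow_const _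
      have hexp : (2 - q') * (q / (q - 2)) = q' := by
        have h1 : q * q' = q + q' := hqq.mul_eq_add
        field_simp
        linarith
      have hexp2 : (q - 2) / q = 2 / q' - 1 := by
        field_simp at hsum ⊢
        linarith
      have h1 := ENNReal.lintegral_mul_le_Lp_mul_Lq volume hρ (ha.pow_const 2).aemeasurable
        (measurable_maximalFunction hwm).aemeasurable
      simp only [Pi.mul_apply] at h1
      refine h1.trans ?_
      have e1 : ∀ s, (a s ^ 2) ^ (q / 2) = a s ^ q := fun s => by
        rw [← ENNReal.rpow_natCast, ← ENNReal.rpow_mul]; congr 1; push_cast; ring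
      have e2 := hM _ hwm
      simp only [← ENNReal.rpow_mul, hexp] at e2
      simp only [e1, one_div_div]
      calc _ ≤ (∫⁻ s, a s ^ q) ^ (2 / q) * (C * ∫⁻ s, b s ^ q') ^ ((q - 2) / q) := by gcongr
        _ = _ := by
          rw [ENNReal.mul_rpow_of_nonneg _ _ (by positivity), ← hexp2]; ring
  obtain ⟨C, hC, hmax⟩ := hmax
  refine ⟨C ^ (1 / 2 : ℝ), ENNReal.rpow_ne_top_of_nonneg (by norm_num) hC, ?_⟩
  intro F G a b K hF hG ha hb hbt hb0 h1 h2
  have hq'2 : q' ≤ 2 := by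
    have := hqq.inv_add_inv_eq_one
    have h3 : q⁻¹ ≤ 2⁻¹ := inv_anti₀ (by norm_num) hq
    have h4 : (2 : ℝ)⁻¹ ≤ q'⁻¹ := by linarith
    exact (inv_le_inv₀ (by norm_num) hq'0).1 h4
  set w : ℝ → ℝ≥0∞ := fun t => b t ^ (2 - q') with hw
  have hwm : Measurable w := hb.pow_const _
  have hwt : ∀ t, w t ≠ ∞ := fun t => ENNReal.rpow_ne_top_of_nonneg (by linarith) (hbt t)
  have hw0 : ∀ s t, w t = 0 → G s t = 0 := fun s t h => by
    rcases ENNReal.rpow_eq_zero_iff.1 h with h | h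
    · exact hb0 s t h.1
    · exact absurd h.1 (hbt t)
  refine (lintegral_mul_le_of_weight hF hG hwm hwt hw0).trans ?_
  have e1 : ∫⁻ s, ∫⁻ t, F s t ^ 2 * w t
      ≤ K * (C * (∫⁻ s, a s ^ q) ^ (2 / q) * (∫⁻ t, b t ^ q') ^ (2 / q' - 1)) := by
    calc _ ≤ ∫⁻ s, K * (a s ^ 2 * maximalFunction w s) :=
          lintegral_mono fun s => (h1 w hwm s).trans (by rw [mul_assoc])
      _ = K * ∫⁻ s, a s ^ 2 * maximalFunction w s :=
          lintegral_const_mul _ ((ha.pow_const 2).mul (measurable_maximalFunction hwm))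
      _ ≤ _ := by gcongr; exact hmax a b ha hb
  have e2 : ∫⁻ t, (∫⁻ s, G s t ^ 2) * (w t)⁻¹ ≤ K * ∫⁻ t, b t ^ q' := by
    rw [← lintegral_const_mul _ (hb.pow_const _)]
    refine lintegral_mono fun t => ?_
    have h3 := h2 (fun _ => 1) measurable_const t
    simp only [mul_one] at h3
    have h4 : ∫⁻ s, G s t ^ 2 ≤ K * b t ^ 2 :=
      h3.trans (by simpa using mul_le_mul_right (maximalFunction_one_le t) (K * b t ^ 2))
    by_cases hb' : b t = 0
    · have : ∫⁻ s, G s t ^ 2 = 0 := by simp [hb0 _ t hb']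
      rw [this, zero_mul]; exact zero_le
    · calc _ ≤ K * b t ^ 2 * (w t)⁻¹ := by gcongr
        _ = K * b t ^ q' := by
          rw [hw, mul_assoc, ← ENNReal.rpow_neg, ← ENNReal.rpow_natCast,
            ← ENNReal.rpow_add _ _ hb' (hbt t)]
          congr 2; push_cast; ring
  set Ia := ∫⁻ s, a s ^ q
  set Ib := ∫⁻ t, b t ^ q'
  calc _ ≤ (K * (C * Ia ^ (2 / q) * Ib ^ (2 / q' - 1))) ^ (1 / 2 : ℝ) * (K * Ib) ^ (1 / 2 : ℝ) := by
        gcongr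
    _ = C ^ (1 / 2 : ℝ) * K * Ia ^ (1 / q) * Ib ^ (1 / q') := by
      have hexp : 0 ≤ 2 / q' - 1 := by
        rw [sub_nonneg, le_div_iff₀ hq'0]; linarith
      have hh : (0 : ℝ) ≤ 1 / 2 := by norm_num
      have hK : K ^ (1 / 2 : ℝ) * K ^ (1 / 2 : ℝ) = K := by
        rw [← ENNReal.rpow_add_of_nonneg _ _ hh hh]; norm_num
      have hI : (Ib ^ (2 / q' - 1)) ^ (1 / 2 : ℝ) * Ib ^ (1 / 2 : ℝ) = Ib ^ (1 / q') := by
        rw [← ENNReal.rpow_mul, ← ENNReal.rpow_add_of_nonneg _ _ (by positivity) hh]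
        congr 1; ring
      have hA : (Ia ^ (2 / q)) ^ (1 / 2 : ℝ) = Ia ^ (1 / q) := by
        rw [← ENNReal.rpow_mul]; congr 1; ring
      rw [ENNReal.mul_rpow_of_nonneg _ _ hh, ENNReal.mul_rpow_of_nonneg _ _ hh,
        ENNReal.mul_rpow_of_nonneg _ _ hh, ENNReal.mul_rpow_of_nonneg _ _ hh, hA]
      calc _ = C ^ (1 / 2 : ℝ) * (K ^ (1 / 2 : ℝ) * K ^ (1 / 2 : ℝ)) * Ia ^ (1 / q)
            * ((Ib ^ (2 / q' - 1)) ^ (1 / 2 : ℝ) * Ib ^ (1 / 2 : ℝ)) := by ring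
        _ = _ := by rw [hK, hI]

/-- The hypotheses are symmetric in the two factors, so for `q ≤ 2` the roles of `F` and `G` are
exchanged, with `q' ≥ 2`. -/
theorem lintegral_mul_le_Lp_mul_Lq_of_maximal {q q' : ℝ} (hqq : q.HolderConjugate q') :
    ∃ C : ℝ≥0∞, C ≠ ∞ ∧ ∀ (F G : ℝ → ℝ → ℝ≥0∞) (a b : ℝ → ℝ≥0∞) (K : ℝ≥0∞),
      Measurable (Function.uncurry F) → Measurable (Function.uncurry G) →
      Measurable a → Measurable b → (∀ s, a s ≠ ∞) → (∀ t, b t ≠ ∞) →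
      (∀ s t, a s = 0 → F s t = 0) → (∀ s t, b t = 0 → G s t = 0) →
      (∀ w : ℝ → ℝ≥0∞, Measurable w → ∀ s,
        ∫⁻ t, F s t ^ 2 * w t ≤ K * a s ^ 2 * maximalFunction w s) →
      (∀ w : ℝ → ℝ≥0∞, Measurable w → ∀ t,
        ∫⁻ s, G s t ^ 2 * w s ≤ K * b t ^ 2 * maximalFunction w t) →
      ∫⁻ s, ∫⁻ t, F s t * G s t
        ≤ C * K * (∫⁻ s, a s ^ q) ^ (1 / q) * (∫⁻ t, b t ^ q') ^ (1 / q') := by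
  rcases le_total 2 q with hq | hq
  · obtain ⟨C, hC, h⟩ := lintegral_mul_le_of_two_le hqq hq
    exact ⟨C, hC, fun F G a b K hF hG ha hb _ hbt _ hb0 h1 h2 =>
      h F G a b K hF hG ha hb hbt hb0 h1 h2⟩
  · have hq' : 2 ≤ q' := by
      have := hqq.inv_add_inv_eq_one
      have h3 : 2⁻¹ ≤ q⁻¹ := inv_anti₀ hqq.pos hq
      have h4 : q'⁻¹ ≤ (2 : ℝ)⁻¹ := by linarith
      exact (inv_le_inv₀ hqq.symm.pos (by norm_num)).1 h4
    obtain ⟨C, hC, h⟩ := lintegral_mul_le_of_two_le hqq.symm hq'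
    refine ⟨C, hC, fun F G a b K hF hG ha hb hat _ ha0 _ h1 h2 => ?_⟩
    have h3 := h (fun t s => G s t) (fun t s => F s t) b a K (hG.comp measurable_swap)
      (hF.comp measurable_swap) hb ha hat (fun t s h => ha0 s t h) h2 h1
    rw [lintegral_lintegral_swap (hF.mul hG).aemeasurable]
    calc _ ≤ _ := le_of_eq (lintegral_congr fun t => lintegral_congr fun s => mul_comm _ _)
      _ ≤ _ := h3
      _ = _ := by ring

end Bilinear

/-! ### Maximal regularity for bounded sectorial operators -/

section BoundedRegularity

variable {H : Type*} [NormedAddCommGroup H] [InnerProductSpace ℂ H] [CompleteSpace H]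

theorem stronglyMeasurable_expSemigroup_apply {α : Type*} [MeasurableSpace α] (B : H →L[ℂ] H)
    {φ : α → ℝ} {h : α → H} (hφ : Measurable φ) (hh : StronglyMeasurable h) :
    StronglyMeasurable fun a => expSemigroup B (φ a) (h a) := by
  have hc : Continuous fun p : ℝ × H => expSemigroup B p.1 p.2 :=
    ((continuous_expSemigroup B).comp (Complex.continuous_ofReal.comp continuous_fst)).clm_apply
      continuous_snd
  exact hc.comp_stronglyMeasurable (hφ.stronglyMeasurable.prodMk hh)

/-- The energy density of an orbit, at half time and cut off at negative times. -/
noncomputable def energyDensity (B : H →L[ℂ] H) (x : H) (r : ℝ) : ℝ≥0∞ :=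
  (Ioi 0).indicator
    (fun r : ℝ => ENNReal.ofReal (energy B (expSemigroup B ((r / 2 : ℝ) : ℂ) x))) r

theorem measurable_energyDensity {α : Type*} [MeasurableSpace α] (B : H →L[ℂ] H)
    {φ : α → ℝ} {h : α → H} (hφ : Measurable φ) (hh : StronglyMeasurable h) :
    Measurable fun a => energyDensity B (h a) (φ a) := by
  have h1 : Measurable fun a =>
      ENNReal.ofReal (energy B (expSemigroup B ((φ a / 2 : ℝ) : ℂ) (h a))) :=
    ((continuous_energy B).comp_stronglyMeasurable
      (stronglyMeasurable_expSemigroup_apply B (hφ.div_const 2) hh)).measurable.ennreal_ofReal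
  exact h1.indicator (hφ measurableSet_Ioi)

theorem energyDensity_zero (B : H →L[ℂ] H) (r : ℝ) : energyDensity B 0 r = 0 := by
  simp [energyDensity, energy_zero, indicator]

namespace IsBoundedSectorial

variable {B : H →L[ℂ] H} {c : ℝ}

/-- Uniform boundedness of the semigroup in the energy seminorm, applied from one time to a later
one. -/
theorem energyDensity_quasiDecreasing (hB : IsBoundedSectorial B c) (x : H) {r r' : ℝ}
    (hrr : r ≤ r') :
    ENNReal.ofReal (energy B (expSemigroup B ((r' / 2 : ℝ) : ℂ) x))
      ≤ ENNReal.ofReal (16 / c ^ 3 + 4 / c ^ 2 + 1)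
        * ENNReal.ofReal (energy B (expSemigroup B ((r / 2 : ℝ) : ℂ) x)) := by
  have hc := hB.pos
  rw [← ENNReal.ofReal_mul (by positivity)]
  refine ENNReal.ofReal_le_ofReal ?_
  have h := hB.energy_expSemigroup_le (t := (r' - r) / 2) (by linarith)
    (expSemigroup B ((r / 2 : ℝ) : ℂ) x)
  have e : ((r' / 2 : ℝ) : ℂ) = (((r' - r) / 2 : ℝ) : ℂ) + ((r / 2 : ℝ) : ℂ) := by
    push_cast; ring
  rwa [e, expSemigroup_add]

theorem measurable_ofReal_energy (B : H →L[ℂ] H) (x : H) :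
    Measurable fun r : ℝ => ENNReal.ofReal (energy B (expSemigroup B ((r / 2 : ℝ) : ℂ) x)) :=
  ((continuous_energy B).comp_stronglyMeasurable
    (stronglyMeasurable_expSemigroup_apply B (measurable_id.div_const 2)
      stronglyMeasurable_const)).measurable.ennreal_ofReal

theorem lintegral_energyDensity_forward (hB : IsBoundedSectorial B c) (x : H) {w : ℝ → ℝ≥0∞}
    (hw : Measurable w) (s : ℝ) :
    ∫⁻ t, energyDensity B x (t - s) * w t
      ≤ 4 * ENNReal.ofReal (16 / c ^ 3 + 4 / c ^ 2 + 1) * ‖x‖ₑ ^ 2 * maximalFunction w s := by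
  refine (lintegral_indicator_sub_mul_le (measurable_ofReal_energy B x) hw
    (fun r r' _ hrr => hB.energyDensity_quasiDecreasing x hrr) s).trans ?_
  calc _ ≤ ENNReal.ofReal (16 / c ^ 3 + 4 / c ^ 2 + 1) * ‖x‖ₑ ^ 2 * (4 * maximalFunction w s) := by
        gcongr
        refine (hB.lintegral_energy_le x).trans (le_of_eq ?_)
        rw [ENNReal.ofReal_pow (norm_nonneg _), ofReal_norm]
    _ = _ := by ring

theorem lintegral_energyDensity_backward (hB : IsBoundedSectorial B c) (x : H) {w : ℝ → ℝ≥0∞}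
    (hw : Measurable w) (t : ℝ) :
    ∫⁻ s, energyDensity B x (t - s) * w s
      ≤ 4 * ENNReal.ofReal (16 / c ^ 3 + 4 / c ^ 2 + 1) * ‖x‖ₑ ^ 2 * maximalFunction w t := by
  refine (lintegral_indicator_sub_mul_le' (measurable_ofReal_energy B x) hw
    (fun r r' _ hrr => hB.energyDensity_quasiDecreasing x hrr) t).trans ?_
  calc _ ≤ ENNReal.ofReal (16 / c ^ 3 + 4 / c ^ 2 + 1) * ‖x‖ₑ ^ 2 * (4 * maximalFunction w t) := by
        gcongr
        refine (hB.lintegral_energy_le x).trans (le_of_eq ?_)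
        rw [ENNReal.ofReal_pow (norm_nonneg _), ofReal_norm]
    _ = _ := by ring

/-- Half of the time is moved to the adjoint, and the sectorial Cauchy–Schwarz inequality separates
`x` from `y`. The adjoint has the same energy form and the same constant `c`. -/
theorem enorm_inner_expSemigroup_le (hB : IsBoundedSectorial B c) (x y : H) {r : ℝ} (hr : 0 < r) :
    ‖inner ℂ y (expSemigroup B r (B x))‖ₑ ≤ ENNReal.ofReal (2 / c)
      * (energyDensity B x r ^ (1 / 2 : ℝ)
        * energyDensity (ContinuousLinearMap.adjoint B) y r ^ (1 / 2 : ℝ)) := by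
  have hc := hB.pos
  have e : (r : ℂ) = ((r / 2 : ℝ) : ℂ) + ((r / 2 : ℝ) : ℂ) := by push_cast; ring
  have h := hB.norm_inner_le (expSemigroup B ((r / 2 : ℝ) : ℂ) x)
    (expSemigroup (ContinuousLinearMap.adjoint B) ((r / 2 : ℝ) : ℂ) y)
  have h1 : inner ℂ y (expSemigroup B r (B x))
      = inner ℂ (expSemigroup (ContinuousLinearMap.adjoint B) ((r / 2 : ℝ) : ℂ) y)
        (B (expSemigroup B ((r / 2 : ℝ) : ℂ) x)) := by
    rw [expSemigroup_adjoint, ContinuousLinearMap.adjoint_inner_left, ← expSemigroup_comm, e,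
      expSemigroup_add]
    rfl
  rw [← h1] at h
  rw [energyDensity, energyDensity, indicator_of_mem (mem_Ioi.2 hr),
    indicator_of_mem (mem_Ioi.2 hr), energy_adjoint,
    ENNReal.ofReal_rpow_of_nonneg (hB.energy_nonneg _) (by norm_num),
    ENNReal.ofReal_rpow_of_nonneg (hB.energy_nonneg _) (by norm_num), ← Real.sqrt_eq_rpow,
    ← Real.sqrt_eq_rpow, ← ENNReal.ofReal_mul (by positivity), ← ENNReal.ofReal_mul (by positivity),
    ← ofReal_norm]
  exact ENNReal.ofReal_le_ofReal h

end IsBoundedSectorial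

/-- The bilinear estimate is applied to the square roots of the two energy densities. The constant
is fixed before `B`, so it involves only `q` and `c` and not the norm of `B`. -/
theorem exists_lintegral_inner_le {q q' : ℝ} (hqq : q.HolderConjugate q') {c : ℝ} :
    ∃ C : ℝ≥0∞, C ≠ ∞ ∧ ∀ (B : H →L[ℂ] H), IsBoundedSectorial B c → ∀ f g : ℝ → H,
      StronglyMeasurable f → StronglyMeasurable g →
      ∫⁻ t, ∫⁻ s, (Ioi 0).indicator (fun r : ℝ => ‖inner ℂ (g t) (expSemigroup B r (B (f s)))‖ₑ)
          (t - s)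
        ≤ C * (∫⁻ s, ‖f s‖ₑ ^ q) ^ (1 / q) * (∫⁻ t, ‖g t‖ₑ ^ q') ^ (1 / q') := by
  obtain ⟨C, hC, h⟩ := lintegral_mul_le_Lp_mul_Lq_of_maximal hqq
  set K := 4 * ENNReal.ofReal (16 / c ^ 3 + 4 / c ^ 2 + 1) with hK
  refine ⟨ENNReal.ofReal (2 / c) * (C * K), by finiteness, fun B hB f g hf hg => ?_⟩
  have hsq : ∀ x : ℝ≥0∞, (x ^ (1 / 2 : ℝ)) ^ 2 = x := fun x => by
    rw [← ENNReal.rpow_natCast, ← ENNReal.rpow_mul]; norm_num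
  have hm1 : Measurable fun p : ℝ × ℝ => energyDensity B (f p.1) (p.2 - p.1) :=
    measurable_energyDensity B (measurable_snd.sub measurable_fst)
      (hf.comp_measurable measurable_fst)
  have hm2 : Measurable fun p : ℝ × ℝ =>
      energyDensity (ContinuousLinearMap.adjoint B) (g p.2) (p.2 - p.1) :=
    measurable_energyDensity _ (measurable_snd.sub measurable_fst)
      (hg.comp_measurable measurable_snd)
  have key := h (fun s t => energyDensity B (f s) (t - s) ^ (1 / 2 : ℝ))
    (fun s t => energyDensity (ContinuousLinearMap.adjoint B) (g t) (t - s) ^ (1 / 2 : ℝ))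
    (fun s => ‖f s‖ₑ) (fun t => ‖g t‖ₑ) K (hm1.pow_const _) (hm2.pow_const _) hf.enorm hg.enorm
    (fun s => enorm_ne_top) (fun t => enorm_ne_top)
    (fun s t h0 => by rw [enorm_eq_zero.1 h0, energyDensity_zero]; simp)
    (fun s t h0 => by rw [enorm_eq_zero.1 h0, energyDensity_zero]; simp)
    (fun w hw s => by
      simp only [hsq]; exact hB.lintegral_energyDensity_forward (f s) hw s)
    (fun w hw t => by
      simp only [hsq]; exact hB.adjoint.lintegral_energyDensity_backward (g t) hw t)
  have hm3 : Measurable fun p : ℝ × ℝ => energyDensity B (f p.1) (p.2 - p.1) ^ (1 / 2 : ℝ)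
      * energyDensity (ContinuousLinearMap.adjoint B) (g p.2) (p.2 - p.1) ^ (1 / 2 : ℝ) :=
    (hm1.pow_const _).mul (hm2.pow_const _)
  rw [lintegral_lintegral_swap hm3.aemeasurable] at key
  calc _ ≤ ∫⁻ t, ∫⁻ s, ENNReal.ofReal (2 / c) * (energyDensity B (f s) (t - s) ^ (1 / 2 : ℝ)
      * energyDensity (ContinuousLinearMap.adjoint B) (g t) (t - s) ^ (1 / 2 : ℝ)) := by
        refine lintegral_mono fun t => lintegral_mono fun s => ?_
        refine indicator_apply_le' (fun hr => hB.enorm_inner_expSemigroup_le _ _ hr)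
          fun _ => zero_le
    _ = ENNReal.ofReal (2 / c) * ∫⁻ t, ∫⁻ s, (energyDensity B (f s) (t - s) ^ (1 / 2 : ℝ)
      * energyDensity (ContinuousLinearMap.adjoint B) (g t) (t - s) ^ (1 / 2 : ℝ)) := by
        rw [← lintegral_const_mul' _ _ ENNReal.ofReal_ne_top]
        exact lintegral_congr fun t => lintegral_const_mul' _ _ ENNReal.ofReal_ne_top
    _ ≤ _ := mul_le_mul_right key _
    _ = _ := by ring

end BoundedRegularity

/-! ### Duality and the uniform `L^q` bound -/

section BoundedRegularity

variable {H : Type*} [NormedAddCommGroup H] [InnerProductSpace ℂ H]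

theorem ENNReal.le_rpow_of_le_mul_rpow {q q' : ℝ} (hqq : q.HolderConjugate q') {X a : ℝ≥0∞}
    (hX : X ≠ ∞) (h : X ≤ a * X ^ (1 / q')) : X ≤ a ^ q := by
  by_cases h0 : X = 0
  · rw [h0]; exact zero_le
  have hsum : 1 / q + 1 / q' = 1 := by
    have := hqq.inv_add_inv_eq_one; simpa using this
  have h1 : X ^ (1 / q) * X ^ (1 / q') = X := by
    rw [← ENNReal.rpow_add _ _ h0 hX, hsum, ENNReal.rpow_one]
  have h2 : X ^ (1 / q) ≤ a := by
    have hn0 : X ^ (1 / q') ≠ 0 := by simp [h0, hX]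
    have hnt : X ^ (1 / q') ≠ ∞ := ENNReal.rpow_ne_top_of_nonneg
      (one_div_nonneg.2 hqq.symm.pos.le) hX
    refine (ENNReal.mul_le_mul_iff_left hn0 hnt).1 ?_
    rwa [h1]
  calc X = (X ^ (1 / q)) ^ q := by
        rw [← ENNReal.rpow_mul, one_div_mul_cancel hqq.pos.ne', ENNReal.rpow_one]
    _ ≤ a ^ q := by gcongr; exact hqq.pos.le

theorem mildSolution_eq_integral_indicator (T : ℝ → H →L[ℂ] H) (f : ℝ → H) {t : ℝ} (ht : 0 ≤ t) :
    mildSolution T f t = ∫ s, (Ioo 0 t).indicator (fun s => T (t - s) (f s)) s := by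
  rw [mildSolution, intervalIntegral.integral_of_le ht, integral_Ioc_eq_integral_Ioo,
    integral_indicator measurableSet_Ioo]

theorem enorm_mildSolution_le {T : ℝ → H →L[ℂ] H} {f : ℝ → H} {M : ℝ≥0∞} {t : ℝ}
    (hT : ∀ s ∈ Ioo 0 t, ‖T (t - s) (f s)‖ₑ ≤ M * ‖f s‖ₑ) (ht : 0 ≤ t) (hM : M ≠ ∞) :
    ‖mildSolution T f t‖ₑ ≤ M * ∫⁻ s in Ioo 0 t, ‖f s‖ₑ := by
  rw [mildSolution_eq_integral_indicator T f ht, integral_indicator measurableSet_Ioo,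
    ← lintegral_const_mul' _ _ hM]
  exact (enorm_integral_le_lintegral_enorm _).trans (setLIntegral_mono' measurableSet_Ioo hT)

/-- The vector `‖x‖^{q-2} x` norms `x` in the `L^q` duality; by the next lemma its `q'`-th power is
again `‖x‖^q`, since `(q - 1) q' = q`. -/
theorem enorm_inner_rpow_smul_self (x : H) {q : ℝ} (hq : 0 < q) :
    ‖inner ℂ (((‖x‖ ^ (q - 2) : ℝ) : ℂ) • x) x‖ₑ = ‖x‖ₑ ^ q := by
  by_cases hx : x = 0
  · simp [hx, hq]
  have hx' : 0 < ‖x‖ := norm_pos_iff.2 hx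
  rw [inner_smul_left, Complex.conj_ofReal, inner_self_eq_norm_sq_to_K, ← ofReal_norm, norm_mul,
    ← ofReal_norm, ENNReal.ofReal_rpow_of_pos hx']
  congr 1
  rw [Complex.norm_real, Real.norm_of_nonneg (by positivity), norm_pow]
  simp only [Complex.coe_algebraMap, Complex.norm_real, norm_norm]
  rw [← Real.rpow_natCast, ← Real.rpow_add hx']
  congr 1; push_cast; ring

theorem enorm_rpow_smul_self_rpow (x : H) {q q' : ℝ} (hqq : q.HolderConjugate q') :
    ‖(((‖x‖ ^ (q - 2) : ℝ) : ℂ) • x)‖ₑ ^ q' = ‖x‖ₑ ^ q := by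
  by_cases hx : x = 0
  · simp [hx, hqq.pos, hqq.symm.pos]
  have hx' : 0 < ‖x‖ := norm_pos_iff.2 hx
  have h1 : ‖(((‖x‖ ^ (q - 2) : ℝ) : ℂ) • x)‖ = ‖x‖ ^ (q - 1) := by
    rw [norm_smul, Complex.norm_real, Real.norm_of_nonneg (by positivity)]
    conv_lhs => rw [← Real.rpow_one ‖x‖]
    rw [← Real.rpow_mul hx'.le, one_mul, ← Real.rpow_add hx']
    congr 1; ring
  rw [← ofReal_norm, h1, ← ENNReal.ofReal_rpow_of_pos hx', ← ENNReal.rpow_mul, ofReal_norm]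
  congr 1
  have := hqq.mul_eq_add
  linarith

variable [CompleteSpace H]

theorem stronglyMeasurable_integral_expSemigroup (B : H →L[ℂ] H) {f : ℝ → H}
    (hf : StronglyMeasurable f) :
    StronglyMeasurable fun t : ℝ =>
      ∫ s, (Ioo 0 t).indicator (fun s => expSemigroup B ((t - s : ℝ) : ℂ) (f s)) s := by
  have h : StronglyMeasurable fun p : ℝ × ℝ => {p : ℝ × ℝ | 0 < p.2 ∧ p.2 < p.1}.indicator
      (fun p => expSemigroup B ((p.1 - p.2 : ℝ) : ℂ) (f p.2)) p :=
    (stronglyMeasurable_expSemigroup_apply B (measurable_fst.sub measurable_snd)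
      (hf.comp_measurable measurable_snd)).indicator
      ((measurableSet_lt measurable_const measurable_snd).inter
        (measurableSet_lt measurable_snd measurable_fst))
  exact h.integral_prod_right

/-- Maximal regularity for bounded sectorial operators, with a constant depending only on `q` and
on the angle. -/
theorem exists_lintegral_mildSolution_le {q : ℝ} (hq : 1 < q) (c : ℝ) :
    ∃ D : ℝ≥0∞, D ≠ ∞ ∧ ∀ B : H →L[ℂ] H, IsBoundedSectorial B c → ∀ f : ℝ → H,
      StronglyMeasurable f → MemLp f (ENNReal.ofReal q) volume →
      ∫⁻ t in Ioi 0, ‖mildSolution (fun r : ℝ => expSemigroup B r) (fun s => B (f s)) t‖ₑ ^ q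
        ≤ D * ∫⁻ s, ‖f s‖ₑ ^ q := by
  have hq0 : 0 < q := by linarith
  have hqq := Real.HolderConjugate.conjExponent hq
  set q' := q.conjExponent
  obtain ⟨C, hC, hmain⟩ := exists_lintegral_inner_le (H := H) hqq (c := c)
  refine ⟨C ^ q, ENNReal.rpow_ne_top_of_nonneg hq0.le hC, fun B hB f hf hfq => ?_⟩
  set v : ℝ → H := fun t =>
    ∫ s, (Ioo 0 t).indicator (fun s => expSemigroup B ((t - s : ℝ) : ℂ) (B (f s))) s with hv
  have hvm : StronglyMeasurable v :=
    stronglyMeasurable_integral_expSemigroup B (B.continuous.comp_stronglyMeasurable hf)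
  have hvt : ∀ t, 0 ≤ t →
      mildSolution (fun r : ℝ => expSemigroup B r) (fun s => B (f s)) t = v t := fun t ht =>
    mildSolution_eq_integral_indicator _ _ ht
  have hN : ∀ N : ℕ, ∫⁻ t in Ioo (0 : ℝ) N, ‖v t‖ₑ ^ q ≤ C ^ q * ∫⁻ s, ‖f s‖ₑ ^ q := by
    intro N
    set X := ∫⁻ t in Ioo (0 : ℝ) N, ‖v t‖ₑ ^ q with hX
    -- Finiteness is needed to divide by `X^{1/q'}` below. It comes from a crude bound on `(0, N)`
    -- with the norm of `B`, which does not enter the final constant.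
    have hfin : X ≠ ∞ := by
      have hI : ∫⁻ s in Ioo (0 : ℝ) N, ‖f s‖ₑ ≠ ∞ := by
        have h1 : MemLp f (ENNReal.ofReal q) (volume.restrict (Ioo (0 : ℝ) N)) := hfq.restrict _
        have h2 := h1.integrable (by
          rw [← ENNReal.ofReal_one]; exact ENNReal.ofReal_le_ofReal hq.le)
        exact h2.2.ne
      have hb : ∀ t ∈ Ioo (0 : ℝ) N, ‖v t‖ₑ ^ q
          ≤ (‖B‖ₑ * ∫⁻ s in Ioo (0 : ℝ) N, ‖f s‖ₑ) ^ q := by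
        intro t ht
        refine ENNReal.rpow_le_rpow ?_ hq0.le
        rw [← hvt t ht.1.le]
        refine (enorm_mildSolution_le (M := 1) (fun s hs => ?_) ht.1.le ENNReal.one_ne_top).trans ?_
        · rw [one_mul, ← ofReal_norm, ← ofReal_norm]
          exact ENNReal.ofReal_le_ofReal
            (hB.norm_expSemigroup_apply_le (by linarith [hs.2] : 0 ≤ t - s) _)
        · rw [one_mul, ← lintegral_const_mul' _ _ enorm_ne_top]
          calc _ ≤ ∫⁻ s in Ioo 0 t, ‖B‖ₑ * ‖f s‖ₑ := by
                gcongr with s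
                exact B.le_opENorm (f s)
            _ ≤ _ := lintegral_mono_set (Ioo_subset_Ioo_right ht.2.le)
      refine ((setLIntegral_mono' measurableSet_Ioo hb).trans_lt ?_).ne
      rw [setLIntegral_const, Real.volume_Ioo]
      exact ENNReal.mul_lt_top
        (ENNReal.rpow_lt_top_of_nonneg hq0.le (ENNReal.mul_ne_top enorm_ne_top hI))
        ENNReal.ofReal_lt_top
    set g : ℝ → H := (Ioo (0 : ℝ) N).indicator fun t => ((‖v t‖ ^ (q - 2) : ℝ) : ℂ) • v t with hg
    have hgm : StronglyMeasurable g := by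
      refine StronglyMeasurable.indicator ?_ measurableSet_Ioo
      exact ((Complex.measurable_ofReal.comp
        (hvm.norm.measurable.pow_const (q - 2))).stronglyMeasurable).smul hvm
    have hgq : ∫⁻ t, ‖g t‖ₑ ^ q' = X := by
      rw [hX, ← lintegral_indicator measurableSet_Ioo]
      refine lintegral_congr fun t => ?_
      by_cases ht : t ∈ Ioo (0 : ℝ) N
      · rw [hg, indicator_of_mem ht, indicator_of_mem ht, enorm_rpow_smul_self_rpow _ hqq]
      · rw [hg, indicator_of_notMem ht, indicator_of_notMem ht, enorm_zero,
          ENNReal.zero_rpow_of_pos hqq.symm.pos]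
    have h1 : X ≤ ∫⁻ t, ∫⁻ s,
        (Ioi 0).indicator (fun r : ℝ => ‖inner ℂ (g t) (expSemigroup B r (B (f s)))‖ₑ) (t - s) := by
      rw [hX, ← lintegral_indicator measurableSet_Ioo]
      refine lintegral_mono fun t => ?_
      by_cases ht : t ∈ Ioo (0 : ℝ) N
      · rw [indicator_of_mem ht, ← enorm_inner_rpow_smul_self _ hq0]
        have hgt : g t = ((‖v t‖ ^ (q - 2) : ℝ) : ℂ) • v t := by rw [hg, indicator_of_mem ht]
        rw [← hgt]
        -- Where the integrand is not integrable, the Bochner integral is `0` and there is nothing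
        -- to bound.
        by_cases hi : Integrable
            ((Ioo 0 t).indicator fun s => expSemigroup B ((t - s : ℝ) : ℂ) (B (f s)))
        · have h2 := integral_inner hi (g t) (𝕜 := ℂ)
          have h3 : inner ℂ (g t) (v t) = ∫ s, inner ℂ (g t)
              ((Ioo 0 t).indicator (fun s => expSemigroup B ((t - s : ℝ) : ℂ) (B (f s))) s) :=
            h2.symm
          rw [h3]
          refine (enorm_integral_le_lintegral_enorm _).trans (lintegral_mono fun s => ?_)
          by_cases hs : s ∈ Ioo 0 t
          · rw [indicator_of_mem hs, indicator_of_mem (by simpa using hs.2)]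
          · rw [indicator_of_notMem hs, inner_zero_right, enorm_zero]; exact zero_le
        · have : v t = 0 := integral_undef hi
          rw [this, inner_zero_right, enorm_zero]; exact zero_le
      · rw [indicator_of_notMem ht]; exact zero_le
    have h2 := h1.trans (hmain B hB f g hf hgm)
    rw [hgq] at h2
    refine (ENNReal.le_rpow_of_le_mul_rpow hqq hfin h2).trans (le_of_eq ?_)
    rw [ENNReal.mul_rpow_of_nonneg _ _ hq0.le, ← ENNReal.rpow_mul, one_div_mul_cancel hq0.ne',
      ENNReal.rpow_one]
  have hU : Ioi (0 : ℝ) = ⋃ N : ℕ, Ioo (0 : ℝ) N := by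
    ext t
    simp only [mem_Ioi, mem_iUnion, mem_Ioo]
    exact ⟨fun h => (exists_nat_gt t).imp fun _ hn => ⟨h, hn⟩, fun ⟨_, h, _⟩ => h⟩
  rw [setLIntegral_congr_fun measurableSet_Ioi
    (fun t ht => by rw [hvt t (le_of_lt ht)] : EqOn _ (fun t => ‖v t‖ₑ ^ q) _), hU,
    setLIntegral_iUnion_of_directed]
  · exact iSup_le hN
  · exact (monotone_nat_of_le_succ fun n => Ioo_subset_Ioo_right (by simp)).directed_le

end BoundedRegularity

/-! ### Mild solutions -/

section MildSolution

variable {H : Type*} [NormedAddCommGroup H] [InnerProductSpace ℂ H] [CompleteSpace H]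

section Bounded

variable {B : H →L[ℂ] H} {c : ℝ} {f : ℝ → H} {t : ℝ}

namespace IsBoundedSectorial

theorem intervalIntegrable_expSemigroup (hB : IsBoundedSectorial B c) (hf : StronglyMeasurable f)
    (ht : 0 ≤ t) (hfi : IntervalIntegrable f volume 0 t) :
    IntervalIntegrable (fun s : ℝ => expSemigroup B ((t - s : ℝ) : ℂ) (f s)) volume 0 t := by
  refine hfi.mono_fun (stronglyMeasurable_expSemigroup_apply B
    (measurable_const.sub measurable_id) hf).aestronglyMeasurable ?_
  rw [uIoc_of_le ht]
  filter_upwards [ae_restrict_mem measurableSet_Ioc] with s hs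
  exact hB.norm_expSemigroup_apply_le (by linarith [hs.2]) _

theorem map_mildSolution (hB : IsBoundedSectorial B c) (hf : StronglyMeasurable f) (ht : 0 ≤ t)
    (hfi : IntervalIntegrable f volume 0 t) :
    B (mildSolution (fun r : ℝ => expSemigroup B r) f t)
      = mildSolution (fun r : ℝ => expSemigroup B r) (fun s => B (f s)) t := by
  rw [mildSolution, mildSolution,
    ← B.intervalIntegral_comp_comm (hB.intervalIntegrable_expSemigroup hf ht hfi)]
  simp only [expSemigroup_comm]

/-- Fubini on the triangle `0 < s < r ≤ t` for `exp(-(r - s)B) B f(s)`: integrating in `s` first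
gives `B u(r)`, and integrating in `r` first gives `f(s) - exp(-(t - s)B) f(s)` by the fundamental
theorem. -/
theorem mildSolution_eq_integral (hB : IsBoundedSectorial B c) (hf : StronglyMeasurable f)
    (ht : 0 ≤ t) (hfi : IntervalIntegrable f volume 0 t) :
    mildSolution (fun r : ℝ => expSemigroup B r) f t = (∫ s in (0 : ℝ)..t, f s)
      - ∫ s in (0 : ℝ)..t, mildSolution (fun r : ℝ => expSemigroup B r) (fun s => B (f s)) s := by
  set k : ℝ × ℝ → H := {p : ℝ × ℝ | 0 < p.2 ∧ p.2 < p.1 ∧ p.1 ≤ t}.indicator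
    (fun p => expSemigroup B ((p.1 - p.2 : ℝ) : ℂ) (B (f p.2))) with hk
  have hBf : StronglyMeasurable fun s => B (f s) := B.continuous.comp_stronglyMeasurable hf
  have hkm : StronglyMeasurable k :=
    (stronglyMeasurable_expSemigroup_apply B (measurable_fst.sub measurable_snd)
      (hBf.comp_measurable measurable_snd)).indicator
      ((measurableSet_lt measurable_const measurable_snd).inter
        ((measurableSet_lt measurable_snd measurable_fst).inter
          (measurableSet_le measurable_fst measurable_const)))
  have hBfi : IntegrableOn (fun s => ‖B (f s)‖) (Ioc 0 t) :=
    ((B.integrable_comp ((intervalIntegrable_iff_integrableOn_Ioc_of_le ht).1 hfi)).norm)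
  have hki : Integrable k (volume.prod volume) := by
    have h1 : Integrable ((Ioc 0 t).indicator fun _ : ℝ => (1 : ℝ)) :=
      (integrable_indicator_iff measurableSet_Ioc).2 (by simp)
    have h2 : Integrable ((Ioc 0 t).indicator fun s => ‖B (f s)‖) :=
      (integrable_indicator_iff measurableSet_Ioc).2 hBfi
    refine (h1.mul_prod h2).mono' hkm.aestronglyMeasurable (Eventually.of_forall fun p => ?_)
    by_cases hp : p ∈ {p : ℝ × ℝ | 0 < p.2 ∧ p.2 < p.1 ∧ p.1 ≤ t}
    · have hp1 : p.1 ∈ Ioc 0 t := ⟨hp.1.trans hp.2.1, hp.2.2⟩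
      have hp2 : p.2 ∈ Ioc 0 t := ⟨hp.1, hp.2.1.le.trans hp.2.2⟩
      rw [hk, indicator_of_mem hp, indicator_of_mem hp1, indicator_of_mem hp2, one_mul]
      exact hB.norm_expSemigroup_apply_le (by linarith [hp.2.1]) _
    · rw [hk, indicator_of_notMem hp, norm_zero]
      exact mul_nonneg (indicator_nonneg (by simp) _) (indicator_nonneg (by simp) _)
  have e1 : (fun r => ∫ s, k (r, s)) = (Ioc 0 t).indicator
      (mildSolution (fun r : ℝ => expSemigroup B r) fun s => B (f s)) := by
    ext1 r
    by_cases hr : r ∈ Ioc 0 t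
    · rw [indicator_of_mem hr, mildSolution_eq_integral_indicator _ _ hr.1.le]
      congr 1
      ext1 s
      by_cases hs : s ∈ Ioo 0 r
      · rw [indicator_of_mem hs, hk, indicator_of_mem]
        exact ⟨hs.1, hs.2, hr.2⟩
      · rw [indicator_of_notMem hs, hk, indicator_of_notMem]
        exact fun h => hs ⟨h.1, h.2.1⟩
    · rw [indicator_of_notMem hr]
      have : ∀ s, k (r, s) = 0 := fun s => by
        rw [hk, indicator_of_notMem]
        exact fun h => hr ⟨h.1.trans h.2.1, h.2.2⟩
      simp [this]
  have e2 : ∀ s, ∫ r, k (r, s)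
      = (Ioc 0 t).indicator (fun s => f s - expSemigroup B ((t - s : ℝ) : ℂ) (f s)) s := by
    intro s
    by_cases hs : s ∈ Ioc 0 t
    · rw [indicator_of_mem hs]
      have h1 : (fun r => k (r, s)) = (Ioc s t).indicator
          fun r => expSemigroup B ((r - s : ℝ) : ℂ) (B (f s)) := by
        ext1 r
        by_cases hr : r ∈ Ioc s t
        · rw [indicator_of_mem hr, hk, indicator_of_mem]
          exact ⟨hs.1, hr.1, hr.2⟩
        · rw [indicator_of_notMem hr, hk, indicator_of_notMem]
          exact fun h => hr ⟨h.2.1, h.2.2⟩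
      rw [h1, integral_indicator measurableSet_Ioc, ← intervalIntegral.integral_of_le hs.2]
      have hd : ∀ r ∈ uIcc s t, HasDerivAt (fun r : ℝ => -expSemigroup B ((r - s : ℝ) : ℂ) (f s))
          (expSemigroup B ((r - s : ℝ) : ℂ) (B (f s))) r := fun r _ => by
        have := ((hasDerivAt_expSemigroup_ofReal B (f s) (r - s)).scomp r
          ((hasDerivAt_id r).sub_const s)).neg
        exact this.congr_deriv (by simp)
      have hc : Continuous fun r : ℝ => expSemigroup B ((r - s : ℝ) : ℂ) (B (f s)) :=
        ((continuous_expSemigroup B).comp (Complex.continuous_ofReal.comp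
          (continuous_id.sub continuous_const))).clm_apply continuous_const
      rw [intervalIntegral.integral_eq_sub_of_hasDerivAt hd (hc.intervalIntegrable s t), sub_self,
        Complex.ofReal_zero, expSemigroup_zero, one_apply_eq_self]
      abel
    · rw [indicator_of_notMem hs]
      have : ∀ r, k (r, s) = 0 := fun r => by
        rw [hk, indicator_of_notMem]
        exact fun h => hs ⟨h.1, h.2.1.le.trans h.2.2⟩
      simp [this]
  have hswap := integral_integral_swap (f := fun r s => k (r, s)) hki
  rw [e1] at hswap
  simp only [e2] at hswap
  rw [integral_indicator measurableSet_Ioc, integral_indicator measurableSet_Ioc,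
    ← intervalIntegral.integral_of_le ht, ← intervalIntegral.integral_of_le ht,
    intervalIntegral.integral_sub hfi (hB.intervalIntegrable_expSemigroup hf ht hfi)] at hswap
  rw [hswap, mildSolution]
  abel

end IsBoundedSectorial

end Bounded

namespace IsYosidaLimit

variable {A : H →ₗ.[ℂ] H} {ω : ℝ} {Rn : ℕ → H →L[ℂ] H} {S : ℂ → H →L[ℂ] H}

/-- The constant `cos ω` is the same for every `n`, so estimates depending only on it survive the
limit. -/
theorem isBoundedSectorial (h : IsYosidaLimit A ω Rn S) (n : ℕ) :
    IsBoundedSectorial (yosida (n + 1) (Rn n)) (Real.cos ω) where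
  pos := Real.cos_pos_of_mem_Ioo
    ⟨by linarith [h.sectorial.angle_nonneg, Real.pi_pos], h.sectorial.angle_lt⟩
  bound x := by
    have := (mem_sector_iff h.sectorial.angle_nonneg
      (by linarith [h.sectorial.angle_lt, Real.pi_pos]) _).1
      (h.sectorial.inner_yosida_mem (r := n + 1) (by positivity) (h.resolvent n) x)
    linarith

theorem tendsto_apply (h : IsYosidaLimit A ω Rn S) {z : ℂ} (hz : z ∈ sector (Real.pi / 2 - ω))
    {x : ℕ → H} {y : H} (hx : Tendsto x atTop (𝓝 y)) :
    Tendsto (fun n => yosidaSemigroup Rn n z (x n)) atTop (𝓝 (S z y)) := by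
  have h2 : Tendsto (fun n => yosidaSemigroup Rn n z (x n - y)) atTop (𝓝 0) := by
    refine squeeze_zero_norm (fun n => h.norm_approx_le hz n _) ?_
    simpa using (hx.sub_const y).norm
  have h3 := h2.add (h.tendsto z hz y)
  rw [zero_add] at h3
  refine h3.congr fun n => ?_
  rw [← _root_.map_add, sub_add_cancel]

theorem norm_smul_resolvent_apply_le (h : IsYosidaLimit A ω Rn S) (n : ℕ) (x : H) :
    ‖((n + 1 : ℝ) : ℂ) • Rn n x‖ ≤ ‖x‖ := by
  simpa using (((n + 1 : ℝ) : ℂ) • Rn n).le_of_opNorm_le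
    (h.sectorial.norm_smul_resolvent_le (r := n + 1) (by positivity) (h.resolvent n)) x

theorem isClosed_graph (h : IsYosidaLimit A ω Rn S) : IsClosed (A.graph : Set (H × H)) :=
  isClosed_of_mem_resolventSet h.sectorial.neg_one_mem

theorem tendsto_mildSolution (h : IsYosidaLimit A ω Rn S) {F : ℕ → ℝ → H} {a : ℝ → H} {b : ℝ → ℝ}
    {t : ℝ} (ht : 0 ≤ t) (hF : ∀ n, StronglyMeasurable (F n)) (hFb : ∀ n s, ‖F n s‖ ≤ b s)
    (hb : IntervalIntegrable b volume 0 t) (hlim : ∀ s, Tendsto (fun n => F n s) atTop (𝓝 (a s))) :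
    Tendsto (fun n => mildSolution (fun r : ℝ => yosidaSemigroup Rn n r) (F n) t) atTop
      (𝓝 (mildSolution (fun r : ℝ => S r) a t)) := by
  refine intervalIntegral.tendsto_integral_filter_of_dominated_convergence b ?_ ?_ hb ?_
  · exact Eventually.of_forall fun n => (stronglyMeasurable_expSemigroup_apply _
      (measurable_const.sub measurable_id) (hF n)).aestronglyMeasurable
  · refine Eventually.of_forall fun n => Eventually.of_forall fun s hs => ?_
    rw [uIoc_of_le ht] at hs
    exact (h.norm_approx_le (h.ofReal_mem (by linarith [hs.2])) n _).trans (hFb n s)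
  · refine Eventually.of_forall fun s hs => ?_
    rw [uIoc_of_le ht] at hs
    exact h.tendsto_apply (h.ofReal_mem (by linarith [hs.2])) (hlim s)

theorem aestronglyMeasurable_orbit (h : IsYosidaLimit A ω Rn S) {f : ℝ → H}
    (hf : StronglyMeasurable f) (t : ℝ) :
    AEStronglyMeasurable (fun s : ℝ => S ((t - s : ℝ) : ℂ) (f s)) (volume.restrict (Ioc 0 t)) := by
  refine aestronglyMeasurable_of_tendsto_ae atTop
    (f := fun n s => yosidaSemigroup Rn n ((t - s : ℝ) : ℂ) (f s))
    (fun n => (stronglyMeasurable_expSemigroup_apply _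
      (measurable_const.sub measurable_id) hf).aestronglyMeasurable) ?_
  filter_upwards [ae_restrict_mem measurableSet_Ioc] with s hs
  exact h.tendsto _ (h.ofReal_mem (by linarith [hs.2])) _

end IsYosidaLimit

end MildSolution

/-! ### Mild solutions with data in the domain of `A` -/

section MildSolution

variable {H : Type*} [NormedAddCommGroup H] [InnerProductSpace ℂ H] [CompleteSpace H]

theorem MeasureTheory.MemLp.intervalIntegrable_of_one_le {E : Type*} [NormedAddCommGroup E]
    {f : ℝ → E} {q : ℝ≥0∞} (hq : 1 ≤ q) (hf : MemLp f q volume) (s t : ℝ) :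
    IntervalIntegrable f volume s t := by
  rw [intervalIntegrable_iff, uIoc]
  exact (hf.restrict (Ioc (min s t) (max s t))).integrable hq

namespace IsYosidaLimit

variable {A : H →ₗ.[ℂ] H} {ω : ℝ} {Rn : ℕ → H →L[ℂ] H} {S : ℂ → H →L[ℂ] H}

section DomainValued

variable {f a : ℝ → H}

theorem yosida_eq (h : IsYosidaLimit A ω Rn S) {x y : H} (hxy : (x, y) ∈ A.graph) (n : ℕ) :
    yosida (n + 1) (Rn n) x = ((n + 1 : ℝ) : ℂ) • Rn n y :=
  (h.resolvent n).yosida_eq_of_mem_graph hxy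

theorem norm_yosida_le (h : IsYosidaLimit A ω Rn S) {x y : H} (hxy : (x, y) ∈ A.graph) (n : ℕ) :
    ‖yosida (n + 1) (Rn n) x‖ ≤ ‖y‖ := by
  rw [h.yosida_eq hxy]
  exact h.norm_smul_resolvent_apply_le n y

theorem tendsto_mildSolution_generator (h : IsYosidaLimit A ω Rn S) (hf : StronglyMeasurable f)
    (hfa : ∀ s, (f s, a s) ∈ A.graph) (hai : ∀ t, IntervalIntegrable a volume 0 t) {t : ℝ}
    (ht : 0 ≤ t) :
    Tendsto (fun n => mildSolution (fun r : ℝ => yosidaSemigroup Rn n r)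
      (fun s => yosida (n + 1) (Rn n) (f s)) t) atTop (𝓝 (mildSolution (fun r : ℝ => S r) a t)) :=
  h.tendsto_mildSolution ht (fun n => (yosida (n + 1) (Rn n)).continuous.comp_stronglyMeasurable hf)
    (fun n s => h.norm_yosida_le (hfa s) n) (hai t).norm
    fun s => h.sectorial.tendsto_yosida h.resolvent (hfa s)

theorem norm_mildSolution_generator_le (h : IsYosidaLimit A ω Rn S)
    (hfa : ∀ s, (f s, a s) ∈ A.graph) (hai : ∀ t, IntervalIntegrable a volume 0 t) (n : ℕ) {s t : ℝ}
    (hs : 0 ≤ s) (hst : s ≤ t) :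
    ‖mildSolution (fun r : ℝ => yosidaSemigroup Rn n r)
      (fun s => yosida (n + 1) (Rn n) (f s)) s‖ ≤ ∫ r in (0 : ℝ)..t, ‖a r‖ := by
  calc _ ≤ ∫ r in (0 : ℝ)..s, ‖a r‖ := by
        refine intervalIntegral.norm_integral_le_of_norm_le hs ?_ (hai s).norm
        refine Eventually.of_forall fun r hr => ?_
        exact (h.norm_approx_le (h.ofReal_mem (by linarith [hr.2])) n _).trans
          (h.norm_yosida_le (hfa r) n)
    _ ≤ _ := intervalIntegral.integral_mono_interval le_rfl hs hst
        (Eventually.of_forall fun _ => norm_nonneg _) (hai t).norm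

/-- For the approximate solutions `u_n`, the vectors `(n+1) R_n u_n` lie in the domain and `A` maps
them to `A_n u_n`, the mild solution with data `A_n f`. Both sequences converge, and `A` is closed.
-/
theorem mildSolution_mem_graph (h : IsYosidaLimit A ω Rn S) (hf : StronglyMeasurable f)
    (hfi : ∀ t, IntervalIntegrable f volume 0 t)
    (hfa : ∀ s, (f s, a s) ∈ A.graph) (hai : ∀ t, IntervalIntegrable a volume 0 t) {t : ℝ}
    (ht : 0 ≤ t) :
    (mildSolution (fun r : ℝ => S r) f t, mildSolution (fun r : ℝ => S r) a t) ∈ A.graph := by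
  set u : ℕ → H := fun n => mildSolution (fun r : ℝ => yosidaSemigroup Rn n r) f t with hu
  have hu1 : Tendsto u atTop (𝓝 (mildSolution (fun r : ℝ => S r) f t)) :=
    h.tendsto_mildSolution ht (fun _ => hf) (fun _ _ => le_rfl) (hfi t).norm
      fun _ => tendsto_const_nhds
  have hu2 : Tendsto (fun n : ℕ => ((n + 1 : ℝ) : ℂ) • Rn n (u n)) atTop
      (𝓝 (mildSolution (fun r : ℝ => S r) f t)) := by
    have h1 : Tendsto (fun n : ℕ => ((n + 1 : ℝ) : ℂ) • Rn n
        (u n - mildSolution (fun r : ℝ => S r) f t)) atTop (𝓝 0) := by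
      refine squeeze_zero_norm (fun n => h.norm_smul_resolvent_apply_le n _) ?_
      simpa using (hu1.sub_const (mildSolution (fun r : ℝ => S r) f t)).norm
    have h2 := h1.add (h.sectorial.tendsto_smul_resolvent h.resolvent
      (mildSolution (fun r : ℝ => S r) f t))
    rw [zero_add] at h2
    refine h2.congr fun n => ?_
    rw [← smul_add, ← _root_.map_add, sub_add_cancel]
  have hv := h.tendsto_mildSolution_generator hf hfa hai ht
  refine h.isClosed_graph.mem_of_tendsto (hu2.prodMk_nhds hv) (Eventually.of_forall fun n => ?_)
  have h3 := (h.isBoundedSectorial n).map_mildSolution hf ht (hfi t)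
  have h4 := (h.resolvent n).yosida_mem_graph (u n)
  rw [hu] at h4
  have h5 : yosida (n + 1) (Rn n) (mildSolution (fun r : ℝ => yosidaSemigroup Rn n r) f t)
    = mildSolution (fun r : ℝ => yosidaSemigroup Rn n r)
      (fun s => yosida (n + 1) (Rn n) (f s)) t := h3
  rw [h5] at h4
  exact h4

theorem aestronglyMeasurable_mildSolution (h : IsYosidaLimit A ω Rn S) (hf : StronglyMeasurable f)
    (hfa : ∀ s, (f s, a s) ∈ A.graph) (hai : ∀ t, IntervalIntegrable a volume 0 t) :
    (∀ n, AEStronglyMeasurable (mildSolution (fun r : ℝ => yosidaSemigroup Rn n r)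
      (fun s => yosida (n + 1) (Rn n) (f s))) (volume.restrict (Ioi 0))) ∧
    AEStronglyMeasurable (mildSolution (fun r : ℝ => S r) a) (volume.restrict (Ioi 0)) := by
  have h1 : ∀ n, AEStronglyMeasurable (mildSolution (fun r : ℝ => yosidaSemigroup Rn n r)
      (fun s => yosida (n + 1) (Rn n) (f s))) (volume.restrict (Ioi 0)) := by
    intro n
    refine (stronglyMeasurable_integral_expSemigroup (yosida (n + 1) (Rn n))
      ((yosida (n + 1) (Rn n)).continuous.comp_stronglyMeasurable hf)).aestronglyMeasurable.congr ?_
    filter_upwards [ae_restrict_mem measurableSet_Ioi] with t ht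
    exact (mildSolution_eq_integral_indicator (fun r : ℝ => yosidaSemigroup Rn n r)
      (fun s => yosida (n + 1) (Rn n) (f s)) (le_of_lt ht)).symm
  refine ⟨h1, aestronglyMeasurable_of_tendsto_ae atTop h1 ?_⟩
  filter_upwards [ae_restrict_mem measurableSet_Ioi] with t ht
  exact h.tendsto_mildSolution_generator hf hfa hai (le_of_lt ht)

theorem mildSolution_eq_integral (h : IsYosidaLimit A ω Rn S) (hf : StronglyMeasurable f)
    (hfi : ∀ t, IntervalIntegrable f volume 0 t)
    (hfa : ∀ s, (f s, a s) ∈ A.graph) (hai : ∀ t, IntervalIntegrable a volume 0 t) {t : ℝ}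
    (ht : 0 ≤ t) :
    mildSolution (fun r : ℝ => S r) f t = (∫ s in (0 : ℝ)..t, f s)
      - ∫ s in (0 : ℝ)..t, mildSolution (fun r : ℝ => S r) a s := by
  have hu1 : Tendsto (fun n => mildSolution (fun r : ℝ => yosidaSemigroup Rn n r) f t) atTop
      (𝓝 (mildSolution (fun r : ℝ => S r) f t)) :=
    h.tendsto_mildSolution ht (fun _ => hf) (fun _ _ => le_rfl) (hfi t).norm
      fun _ => tendsto_const_nhds
  refine tendsto_nhds_unique hu1 ?_
  have hn := fun n => (h.isBoundedSectorial n).mildSolution_eq_integral hf ht (hfi t)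
  refine Tendsto.congr (fun n => (hn n).symm) (tendsto_const_nhds.sub ?_)
  refine intervalIntegral.tendsto_integral_filter_of_dominated_convergence
    (fun _ => ∫ r in (0 : ℝ)..t, ‖a r‖) ?_ ?_ intervalIntegrable_const ?_
  · refine Eventually.of_forall fun n => ?_
    rw [uIoc_of_le ht]
    exact ((h.aestronglyMeasurable_mildSolution hf hfa hai).1 n).mono_measure
      (Measure.restrict_mono Ioc_subset_Ioi_self le_rfl)
  · refine Eventually.of_forall fun n => Eventually.of_forall fun s hs => ?_
    rw [uIoc_of_le ht] at hs
    exact h.norm_mildSolution_generator_le hfa hai n hs.1.le hs.2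
  · refine Eventually.of_forall fun s hs => ?_
    rw [uIoc_of_le ht] at hs
    exact h.tendsto_mildSolution_generator hf hfa hai hs.1.le

end DomainValued

/-- Fatou's lemma along the Yosida approximations, which share the constant `D`. The bound involves
only `f`, although the solution is driven by `a = A f`. -/
theorem eLpNorm_mildSolution_le {q : ℝ} (hq : 1 < q) {D : ℝ≥0∞}
    (hD : ∀ B : H →L[ℂ] H, IsBoundedSectorial B (Real.cos ω) → ∀ f : ℝ → H,
      StronglyMeasurable f → MemLp f (ENNReal.ofReal q) volume →
      ∫⁻ t in Ioi 0, ‖mildSolution (fun r : ℝ => expSemigroup B r) (fun s => B (f s)) t‖ₑ ^ q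
        ≤ D * ∫⁻ s, ‖f s‖ₑ ^ q)
    (h : IsYosidaLimit A ω Rn S) {f a : ℝ → H} (hf : StronglyMeasurable f)
    (hfq : MemLp f (ENNReal.ofReal q) volume) (hfa : ∀ s, (f s, a s) ∈ A.graph)
    (hai : ∀ t, IntervalIntegrable a volume 0 t) :
    eLpNorm (mildSolution (fun r : ℝ => S r) a) (ENNReal.ofReal q) (volume.restrict (Ioi 0))
      ≤ D ^ (1 / q) * eLpNorm f (ENNReal.ofReal q) volume := by
  have hq0 : 0 < q := by linarith
  have hm := h.aestronglyMeasurable_mildSolution hf hfa hai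
  refine (Lp.eLpNorm_lim_le_liminf_eLpNorm hm.1 _ ?_).trans ?_
  · filter_upwards [ae_restrict_mem measurableSet_Ioi] with t ht
    exact h.tendsto_mildSolution_generator hf hfa hai (le_of_lt ht)
  · refine liminf_le_of_le (by isBoundedDefault) fun b hb => ?_
    obtain ⟨n, hn⟩ := hb.exists
    refine hn.trans ?_
    have h1 := hD _ (h.isBoundedSectorial n) f hf hfq
    rw [eLpNorm_eq_lintegral_rpow_enorm_toReal (by simpa using hq0) ENNReal.ofReal_ne_top,
      eLpNorm_eq_lintegral_rpow_enorm_toReal (by simpa using hq0) ENNReal.ofReal_ne_top,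
      ENNReal.toReal_ofReal hq0.le, ← ENNReal.mul_rpow_of_nonneg _ _ (by positivity)]
    exact ENNReal.rpow_le_rpow h1 (by positivity)

end IsYosidaLimit

end MildSolution

/-! ### Density of domain-valued data and maximal regularity -/

section MaximalRegularity

theorem tendsto_eLpNorm_of_dominated {E : Type*} [NormedAddCommGroup E] {α : Type*}
    [MeasurableSpace α] {μ : Measure α} {q : ℝ}
    (hq : 0 < q) {F : ℕ → α → E} {f : α → E} (hF : ∀ n, AEStronglyMeasurable (F n) μ)
    (hf : MemLp f (ENNReal.ofReal q) μ) (hb : ∀ n x, ‖F n x‖ ≤ ‖f x‖)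
    (hlim : ∀ x, Tendsto (fun n => F n x) atTop (𝓝 (f x))) :
    Tendsto (fun n => eLpNorm (F n - f) (ENNReal.ofReal q) μ) atTop (𝓝 0) := by
  have hq' : ENNReal.ofReal q ≠ 0 := by simpa using hq
  have hfin : ∫⁻ x, ‖f x‖ₑ ^ q ∂μ ≠ ∞ := by
    have := lintegral_rpow_enorm_lt_top_of_eLpNorm_lt_top hq' ENNReal.ofReal_ne_top hf.2
    rw [ENNReal.toReal_ofReal hq.le] at this
    exact this.ne
  have h1 : Tendsto (fun n => ∫⁻ x, ‖F n x - f x‖ₑ ^ q ∂μ) atTop (𝓝 (∫⁻ _, 0 ∂μ)) := by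
    refine tendsto_lintegral_of_dominated_convergence' (fun x => (2 * ‖f x‖ₑ) ^ q) ?_ ?_ ?_ ?_
    · exact fun n => ((hF n).sub hf.1).enorm.pow_const _
    · refine fun n => Eventually.of_forall fun x => ?_
      refine ENNReal.rpow_le_rpow ?_ hq.le
      refine enorm_sub_le.trans ?_
      rw [two_mul]
      gcongr
      rw [← ofReal_norm, ← ofReal_norm]
      exact ENNReal.ofReal_le_ofReal (hb n x)
    · simp only [ENNReal.mul_rpow_of_nonneg _ _ hq.le]
      rw [lintegral_const_mul' _ _ (ENNReal.rpow_ne_top_of_nonneg hq.le (by simp))]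
      exact ENNReal.mul_ne_top (ENNReal.rpow_ne_top_of_nonneg hq.le (by simp)) hfin
    · refine Eventually.of_forall fun x => ?_
      have h2 : Tendsto (fun n => ‖F n x - f x‖ₑ) atTop (𝓝 0) := by
        simpa using ((hlim x).sub_const (f x)).enorm
      have h3 := ((ENNReal.continuous_rpow_const (y := q)).tendsto 0).comp h2
      rwa [ENNReal.zero_rpow_of_pos hq] at h3
  rw [lintegral_zero] at h1
  have h4 := ((ENNReal.continuous_rpow_const (y := 1 / q)).tendsto 0).comp h1
  rw [ENNReal.zero_rpow_of_pos (by positivity)] at h4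
  refine h4.congr fun n => ?_
  rw [eLpNorm_eq_lintegral_rpow_enorm_toReal hq' ENNReal.ofReal_ne_top, ENNReal.toReal_ofReal hq.le]
  rfl

theorem exists_limit_of_eLpNorm_sub_le {E : Type*} [NormedAddCommGroup E] [CompleteSpace E]
    {α : Type*} [MeasurableSpace α] {μ : Measure α} {p : ℝ≥0∞}
    (hp : 1 ≤ p) {w : ℕ → α → E} (hw : ∀ n, MemLp (w n) p μ) {e : ℕ → ℝ≥0∞}
    (he : Tendsto e atTop (𝓝 0)) (hwe : ∀ m n, eLpNorm (w m - w n) p μ ≤ e m + e n) :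
    ∃ g, MemLp g p μ ∧ Tendsto (fun n => eLpNorm (w n - g) p μ) atTop (𝓝 0) := by
  have : Fact (1 ≤ p) := ⟨hp⟩
  have hc : CauchySeq fun n => (hw n).toLp (w n) := by
    rw [EMetric.cauchySeq_iff]
    intro ε hε
    obtain ⟨N, hN⟩ := eventually_atTop.1 (he.eventually (gt_mem_nhds (ENNReal.half_pos hε.ne')))
    refine ⟨N, fun m hm n hn => ?_⟩
    rw [Lp.edist_toLp_toLp]
    refine (hwe m n).trans_lt ?_
    rw [← ENNReal.add_halves ε]
    exact ENNReal.add_lt_add (hN m hm) (hN n hn)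
  obtain ⟨g, hg⟩ := cauchySeq_tendsto_of_complete hc
  refine ⟨g, Lp.memLp g, ?_⟩
  rw [Lp.tendsto_Lp_iff_tendsto_eLpNorm'] at hg
  refine hg.congr fun n => eLpNorm_congr_ae ?_
  exact (hw n).coeFn_toLp.sub (ae_eq_refl _)

variable {H : Type*} [NormedAddCommGroup H] [InnerProductSpace ℂ H] [CompleteSpace H]

namespace IsYosidaLimit

variable {A : H →ₗ.[ℂ] H} {ω : ℝ} {Rn : ℕ → H →L[ℂ] H} {S : ℂ → H →L[ℂ] H}

theorem intervalIntegrable_orbit (h : IsYosidaLimit A ω Rn S) {f : ℝ → H}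
    (hf : StronglyMeasurable f) {t : ℝ} (ht : 0 ≤ t) (hfi : IntervalIntegrable f volume 0 t) :
    IntervalIntegrable (fun s : ℝ => S ((t - s : ℝ) : ℂ) (f s)) volume 0 t := by
  refine hfi.mono_fun ?_ ?_
  · rw [uIoc_of_le ht]; exact h.aestronglyMeasurable_orbit hf t
  · rw [uIoc_of_le ht]
    filter_upwards [ae_restrict_mem measurableSet_Ioc] with s hs
    exact h.norm_apply_le (h.ofReal_mem (by linarith [hs.2])) _

theorem mildSolution_sub (h : IsYosidaLimit A ω Rn S) {f g : ℝ → H} (hf : StronglyMeasurable f)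
    (hg : StronglyMeasurable g) {t : ℝ} (ht : 0 ≤ t) (hfi : IntervalIntegrable f volume 0 t)
    (hgi : IntervalIntegrable g volume 0 t) :
    mildSolution (fun r : ℝ => S r) (f - g) t
      = mildSolution (fun r : ℝ => S r) f t - mildSolution (fun r : ℝ => S r) g t := by
  rw [mildSolution, mildSolution, mildSolution, ← intervalIntegral.integral_sub
    (h.intervalIntegrable_orbit hf ht hfi) (h.intervalIntegrable_orbit hg ht hgi)]
  simp only [Pi.sub_apply, _root_.map_sub]

/-- Maximal regularity on the half line. -/
theorem exists_maximalRegularity (h : IsYosidaLimit A ω Rn S) {q : ℝ} (hq : 1 < q) {f : ℝ → H}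
    (hf : StronglyMeasurable f) (hfq : MemLp f (ENNReal.ofReal q) volume) :
    ∃ g : ℝ → H, MemLp g (ENNReal.ofReal q) (volume.restrict (Ioi 0)) ∧
      (∀ᵐ t ∂volume.restrict (Ioi 0), (mildSolution (fun r : ℝ => S r) f t, g t) ∈ A.graph) ∧
      ∀ t : ℝ, 0 ≤ t → mildSolution (fun r : ℝ => S r) f t
        = (∫ s in (0 : ℝ)..t, f s) - ∫ s in (0 : ℝ)..t, g s := by
  have hq0 : 0 < q := by linarith
  have hq1 : 1 ≤ ENNReal.ofReal q := by
    rw [← ENNReal.ofReal_one]; exact ENNReal.ofReal_le_ofReal hq.le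
  obtain ⟨D, hD, hDB⟩ := exists_lintegral_mildSolution_le (H := H) hq (Real.cos ω)
  -- The regularized data `J k f` lie in the domain and tend to `f` in `L^q`. Since `A J k` is the
  -- bounded Yosida operator, `A J k f` is again in `L^q`.
  set J : ℕ → H →L[ℂ] H := fun k => ((k + 1 : ℝ) : ℂ) • Rn k with hJ
  set F : ℕ → ℝ → H := fun k s => J k (f s) with hF
  set a : ℕ → ℝ → H := fun k s => yosida (k + 1) (Rn k) (f s) with ha
  have hFm : ∀ k, StronglyMeasurable (F k) := fun k => (J k).continuous.comp_stronglyMeasurable hf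
  have ham : ∀ k, StronglyMeasurable (a k) := fun k =>
    (yosida (k + 1) (Rn k)).continuous.comp_stronglyMeasurable hf
  have hFq : ∀ k, MemLp (F k) (ENNReal.ofReal q) volume := fun k => (J k).comp_memLp' hfq
  have haq : ∀ k, MemLp (a k) (ENNReal.ofReal q) volume := fun k =>
    (yosida (k + 1) (Rn k)).comp_memLp' hfq
  have hFi := fun k => (hFq k).intervalIntegrable_of_one_le hq1 0
  have hai := fun k => (haq k).intervalIntegrable_of_one_le hq1 0
  have hfi := hfq.intervalIntegrable_of_one_le hq1 0
  have hFa : ∀ k s, (F k s, a k s) ∈ A.graph := fun k s => (h.resolvent k).yosida_mem_graph (f s)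
  have hFb : ∀ k s, ‖F k s‖ ≤ ‖f s‖ := fun k s => h.norm_smul_resolvent_apply_le k (f s)
  have hFlim : ∀ s, Tendsto (fun k => F k s) atTop (𝓝 (f s)) := fun s =>
    h.sectorial.tendsto_smul_resolvent h.resolvent (f s)
  set w : ℕ → ℝ → H := fun k => mildSolution (fun r : ℝ => S r) (a k) with hw
  have hwq : ∀ k, MemLp (w k) (ENNReal.ofReal q) (volume.restrict (Ioi 0)) := fun k =>
    ⟨(h.aestronglyMeasurable_mildSolution (hFm k) (hFa k) (hai k)).2,
      (h.eLpNorm_mildSolution_le hq hDB (hFm k) (hFq k) (hFa k) (hai k)).trans_lt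
        (ENNReal.mul_lt_top (ENNReal.rpow_lt_top_of_nonneg (by positivity) hD) (hFq k).2)⟩
  set e : ℕ → ℝ≥0∞ := fun k => D ^ (1 / q) * eLpNorm (F k - f) (ENNReal.ofReal q) volume with he
  have hD' : D ^ (1 / q) ≠ ∞ := ENNReal.rpow_ne_top_of_nonneg (by positivity) hD
  have he0 : Tendsto e atTop (𝓝 0) := by
    have := ENNReal.Tendsto.const_mul (a := D ^ (1 / q)) (tendsto_eLpNorm_of_dominated hq0
      (fun k => (hFm k).aestronglyMeasurable) hfq hFb hFlim) (Or.inr hD')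
    rwa [mul_zero] at this
  -- By linearity the uniform estimate applies to differences of data, so the functions `A u_k` form
  -- a Cauchy sequence in `L^q`.
  have hwe : ∀ m n, eLpNorm (w m - w n) (ENNReal.ofReal q) (volume.restrict (Ioi 0))
      ≤ e m + e n := by
    intro m n
    have h1 := h.eLpNorm_mildSolution_le hq hDB (f := F m - F n) (a := a m - a n)
      ((hFm m).sub (hFm n)) ((hFq m).sub (hFq n))
      (fun s => A.graph.sub_mem (hFa m s) (hFa n s)) (fun t => (hai m t).sub (hai n t))
    have h2 : eLpNorm (F m - F n) (ENNReal.ofReal q) volume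
        ≤ eLpNorm (F m - f) (ENNReal.ofReal q) volume
          + eLpNorm (F n - f) (ENNReal.ofReal q) volume := by
      have h3 : F m - F n = (F m - f) - (F n - f) := by abel
      rw [h3]
      exact eLpNorm_sub_le ((hFq m).sub hfq).1 ((hFq n).sub hfq).1 hq1
    have h4 : eLpNorm (w m - w n) (ENNReal.ofReal q) (volume.restrict (Ioi 0))
        = eLpNorm (mildSolution (fun r : ℝ => S r) (a m - a n)) (ENNReal.ofReal q)
          (volume.restrict (Ioi 0)) := by
      refine eLpNorm_congr_ae ?_
      filter_upwards [ae_restrict_mem measurableSet_Ioi] with t ht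
      exact (h.mildSolution_sub (ham m) (ham n) (le_of_lt ht) (hai m t) (hai n t)).symm
    rw [h4, he]
    simp only
    rw [← mul_add]
    exact h1.trans (mul_le_mul_right h2 _)
  obtain ⟨g, hgq, hg⟩ := exists_limit_of_eLpNorm_sub_le hq1 hwq he0 hwe
  have hu : ∀ t : ℝ, 0 ≤ t → Tendsto (fun k => mildSolution (fun r : ℝ => S r) (F k) t) atTop
      (𝓝 (mildSolution (fun r : ℝ => S r) f t)) := by
    intro t ht
    refine intervalIntegral.tendsto_integral_filter_of_dominated_convergence (fun s => ‖f s‖)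
      (Eventually.of_forall fun k => ?_) (Eventually.of_forall fun k => Eventually.of_forall
        fun s hs => ?_) (hfi t).norm (Eventually.of_forall fun s _ =>
          ((S ((t - s : ℝ) : ℂ)).continuous.tendsto _).comp (hFlim s))
    · rw [uIoc_of_le ht]
      exact h.aestronglyMeasurable_orbit (hFm k) t
    · rw [uIoc_of_le ht] at hs
      exact (h.norm_apply_le (h.ofReal_mem (by linarith [hs.2])) _).trans (hFb k s)
  refine ⟨g, hgq, ?_, fun t ht => ?_⟩
  -- A subsequence of `A u_k` converges almost everywhere to `g` while `u_k` converges at every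
  -- time, so closedness of `A` puts the limit in the graph.
  · obtain ⟨ns, hns, hlim⟩ := (tendstoInMeasure_of_tendsto_eLpNorm (by simpa using hq0)
      (fun n => (hwq n).1) hgq.1 hg).exists_seq_tendsto_ae
    filter_upwards [hlim, ae_restrict_mem measurableSet_Ioi] with t ht ht0
    exact h.isClosed_graph.mem_of_tendsto
      (((hu t (le_of_lt ht0)).comp hns.tendsto_atTop).prodMk_nhds ht)
      (Eventually.of_forall fun k =>
        h.mildSolution_mem_graph (hFm (ns k)) (hFi (ns k)) (hFa (ns k)) (hai (ns k)) (le_of_lt ht0))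
  · refine tendsto_nhds_unique (hu t ht) ?_
    refine Tendsto.congr (fun k => (h.mildSolution_eq_integral (hFm k) (hFi k) (hFa k) (hai k)
      ht).symm) (Tendsto.sub ?_ ?_)
    · refine intervalIntegral.tendsto_integral_filter_of_dominated_convergence (fun s => ‖f s‖)
        (Eventually.of_forall fun k => (hFm k).aestronglyMeasurable)
        (Eventually.of_forall fun k => Eventually.of_forall fun s _ => hFb k s) (hfi t).norm
        (Eventually.of_forall fun s _ => hFlim s)
    -- On the bounded interval, `L^q` convergence implies `L¹` convergence and hence convergence of
    -- the integrals.
    · have hle : volume.restrict (Ioc 0 t) ≤ volume.restrict (Ioi 0) :=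
        Measure.restrict_mono Ioc_subset_Ioi_self le_rfl
      simp only [intervalIntegral.integral_of_le ht]
      refine tendsto_integral_of_L1' g (hgq.mono_measure hle).1
        (Eventually.of_forall fun k => ((hwq k).mono_measure hle).integrable hq1) ?_
      refine tendsto_of_tendsto_of_tendsto_of_le_of_le tendsto_const_nhds ?_ (fun _ => zero_le)
        fun k => (eLpNorm_le_eLpNorm_mul_rpow_measure_univ hq1
          (((hwq k).sub hgq).1.mono_measure hle)).trans
            (mul_le_mul_left (eLpNorm_mono_measure _ hle) _)
      have := ENNReal.Tendsto.mul_const hg (b := (volume.restrict (Ioc 0 t)) univ ^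
        (1 / ENNReal.toReal 1 - 1 / (ENNReal.ofReal q).toReal)) (Or.inr ?_)
      · rwa [zero_mul] at this
      · refine ENNReal.rpow_ne_top_of_nonneg ?_ (by simp)
        rw [ENNReal.toReal_one, ENNReal.toReal_ofReal hq0.le, sub_nonneg]
        gcongr

end IsYosidaLimit

end MaximalRegularity

/-! ### Restriction to finite time intervals and the theorem -/

section Conclusion

variable {H : Type*} [NormedAddCommGroup H] [InnerProductSpace ℂ H] [CompleteSpace H]
  {A : H →ₗ.[ℂ] H} {ω : ℝ} {Rn : ℕ → H →L[ℂ] H} {S : ℂ → H →L[ℂ] H}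

theorem measurableSet_timeInterval (τ : ℝ≥0∞) : MeasurableSet (timeInterval τ) :=
  (measurableSet_lt measurable_const measurable_id).inter
    (measurableSet_lt ENNReal.measurable_ofReal measurable_const)

theorem timeInterval_subset (τ : ℝ≥0∞) : timeInterval τ ⊆ Ioi 0 := fun _ h => h.1

theorem Ioc_subset_timeInterval {τ : ℝ≥0∞} {t : ℝ} (ht : t ∈ timeInterval τ) :
    Ioc 0 t ⊆ timeInterval τ := fun _ hs =>
  ⟨hs.1, (ENNReal.ofReal_le_ofReal hs.2).trans_lt ht.2⟩

theorem IsYosidaLimit.hasMaximalParabolicRegularity (h : IsYosidaLimit A ω Rn S) (τ : ℝ≥0∞)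
    {q : ℝ≥0∞} (hq : 1 < q) (hq' : q ≠ ∞) : HasMaximalParabolicRegularity A τ q := by
  refine ⟨fun t : ℝ => S t, h.isHolomorphicContractionSemigroup.isSemigroup, h.isGeneratorOf,
    ⟨S, _, h.isHolomorphicContractionSemigroup.toIsHolomorphicSemigroup⟩, fun f hf => ?_⟩
  have hI := measurableSet_timeInterval τ
  have hqr : 1 < q.toReal := by
    rw [← ENNReal.toReal_one]; exact (ENNReal.toReal_lt_toReal ENNReal.one_ne_top hq').2 hq
  have hqe : ENNReal.ofReal q.toReal = q := ENNReal.ofReal_toReal hq'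
  -- Extension by zero of a strongly measurable representative. At `t` in the interval the mild
  -- solution only sees data on `(0, t]`, so it does not change.
  set φ : ℝ → H := (timeInterval τ).indicator (hf.1.mk f) with hφ
  have hφm : StronglyMeasurable φ := hf.1.stronglyMeasurable_mk.indicator hI
  have hφf : φ =ᵐ[volume.restrict (timeInterval τ)] f := by
    filter_upwards [hf.1.ae_eq_mk, ae_restrict_mem hI] with t ht ht'
    rw [hφ, indicator_of_mem ht', ht]
  have hφq : MemLp φ q volume :=
    (memLp_indicator_iff_restrict hI).2 (hf.ae_eq hf.1.ae_eq_mk)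
  obtain ⟨g, hgq, hgraph, hint⟩ := h.exists_maximalRegularity hqr hφm (by rwa [hqe])
  rw [hqe] at hgq
  have hle : volume.restrict (timeInterval τ) ≤ volume.restrict (Ioi 0) :=
    Measure.restrict_mono (timeInterval_subset τ) le_rfl
  have hmild : ∀ t ∈ timeInterval τ,
      mildSolution (fun t : ℝ => S t) f t = mildSolution (fun t : ℝ => S t) φ t := by
    intro t ht
    rw [mildSolution, mildSolution, intervalIntegral.integral_of_le ht.1.le,
      intervalIntegral.integral_of_le ht.1.le]
    refine integral_congr_ae ?_
    filter_upwards [ae_restrict_of_ae_restrict_of_subset (Ioc_subset_timeInterval ht) hφf] with s hs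
    rw [hs]
  refine ⟨fun t => φ t - g t, g, (hφq.restrict _).sub (hgq.mono_measure hle),
    hgq.mono_measure hle, fun t ht => ?_, ?_⟩
  · have hgi : IntervalIntegrable g volume 0 t := by
      rw [intervalIntegrable_iff_integrableOn_Ioc_of_le ht.1.le]
      exact (hgq.mono_measure (Measure.restrict_mono Ioc_subset_Ioi_self le_rfl)).integrable hq.le
    rw [hmild t ht, hint t ht.1.le,
      intervalIntegral.integral_sub (hφq.intervalIntegrable_of_one_le hq.le 0 t) hgi]
  · filter_upwards [ae_restrict_mem hI, hφf, ae_restrict_of_ae_restrict_of_subset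
      (timeInterval_subset τ) hgraph] with t ht h1 h2
    rw [hmild t ht]
    exact ⟨h2, by rw [sub_add_cancel, h1]⟩

end Conclusion

theorem theorem3p15 (d : ℕ) (Ω : Opens (EuclideanSpace ℝ (Fin d)))
    (μ : EuclideanSpace ℝ (Fin d) →
      EuclideanSpace ℂ (Fin d) →L[ℂ] EuclideanSpace ℂ (Fin d))
    (hμ : IsBoundedCoefficient Ω μ)
    (hell : ∃ m : ℝ, 0 < m ∧
      ∀ᵐ x ∂(volume.restrict (Ω : Set (EuclideanSpace ℝ (Fin d)))),
        ∀ ξ : EuclideanSpace ℂ (Fin d), m * ‖ξ‖ ^ 2 ≤ (inner ℂ ξ (μ x ξ)).re)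
    (V : Submodule ℂ (sobolevW12 Ω))
    (hVclosed : IsClosed (V : Set (sobolevW12 Ω)))
    (hVdense : Dense (sobolevToL2 '' (V : Set (sobolevW12 Ω))))
    (A : L2Space Ω →ₗ.[ℂ] L2Space Ω) (hA : A = formOperator hμ V)
    (ω : ℝ) (hω : ω = optimalAngle (formNumericalRange μ V)) :
    optimalAngle (numericalRange A) = ω ∧
    IsMAccretiveOfAngle A ω ∧
    IsSectorialOfAngle A ω ∧
    spectralAngle A ≤ ω ∧
    (∀ θ : ℝ, ω < θ → θ ≤ Real.pi / 2 → ∀ z ∉ sector θ,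
      ∃ R : L2Space Ω →L[ℂ] L2Space Ω, IsResolventAt A z R ∧
        ‖z • R‖ ≤ 1 / Real.sin (θ - ω)) ∧
    (∃ (T : ℝ → L2Space Ω →L[ℂ] L2Space Ω) (S : ℂ → L2Space Ω →L[ℂ] L2Space Ω),
      IsGeneratorOf (-A) T ∧ IsHolomorphicContractionSemigroup T S (Real.pi / 2 - ω)) ∧
    (∀ τ q : ℝ≥0∞, 0 < τ → 1 < q → q ≠ ∞ → HasMaximalParabolicRegularity A τ q) := by
  obtain ⟨⟨θ₀, h0, h1, hsub⟩, hiff, hneg⟩ := formOperator_properties hμ hell V hVclosed hVdense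
  rw [← hA] at hiff hneg
  obtain ⟨hω0, hω1, hωsub⟩ := optimalAngle_spec h0 h1 hsub
  rw [← hω] at hω0 hω1 hωsub
  have hpi := Real.pi_pos
  have hN : numericalRange A ⊆ sector ω := (hiff ω hω0 (by linarith)).2 hωsub
  have hsec := isSectorialOfAngle_of_numericalRange hω0 hω1 hN hneg
  obtain ⟨Rn, S, hS⟩ := IsMSectorial.exists_yosidaLimit (A := A) (ω := ω) ⟨hω0, hω1, hN, hneg⟩
  refine ⟨?_, isMAccretiveOfAngle_of_numericalRange hω0 hω1 hN hneg, hsec,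
    csInf_le ⟨0, fun φ hφ => hφ.angle_nonneg⟩ hsec, fun θ hθ hθ' z hz => ?_,
    ⟨_, S, hS.isGeneratorOf, hS.isHolomorphicContractionSemigroup⟩,
    fun τ q _ hq hq' => hS.hasMaximalParabolicRegularity τ hq hq'⟩
  -- Both angles are infima of one and the same set.
  · rw [hω, optimalAngle, optimalAngle]
    congr 1
    ext θ
    exact and_congr_right fun hθ => and_congr_right fun hθ' => hiff θ hθ hθ'
  · obtain ⟨⟨R, hR⟩, hb⟩ := exists_resolvent_notMem_sector hω0 hN hneg hθ hθ' hz
    exact ⟨R, hR, hb R hR⟩
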